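/- Let $T\ge 0$, let $\mu$ be a Gaussian law of an input $U=(U_1,\dots,U_T)$ on $\mathbb R^T$ with positive definite covariance matrix, and let $\gamma$ be a (possibly degenerate) Gaussian law of $(U,Y)$ on $\mathbb R^T\times\mathbb R^T$. Let $\Pi_c(\mu,*)$ be the set of probability measures on $\mathbb R^T\times\mathbb R^T$ with $U$-marginal $\mu$ under which, for every $t$, $Y_{1:t}$ and $U_{t+1:T}$ are conditionally independent given $U_{1:t}$. Assume $\inf_{\pi'\in\Pi_c(\mu,*)}D_{\rm KL}(\pi',\gamma)<\infty$, where $D_{\rm KL}(\pi',\gamma)=\int\log\frac{d\pi'}{d\gamma}\,d\pi'$. Then $D_{\rm KL}(\cdot,\gamma)$ has exactly one minimizer $\pi$ on $\Pi_c(\mu,*)$, and $\pi$ is Gaussian. Write $z_{1:t}=(u_{1:t},y_{1:t})$, $\tilde z_{1:t-1}=(u_{1:t},y_{1:t-1})$, and for a Gaussian law $\rho$ of $(U,Y)$ (here $\rho=\gamma$ or $\pi$) write its conditional laws as $$\rho(y_t\mid \tilde z_{1:t-1})=\mathcal N\big(K^\rho_{y_t|u_{1:t}}u_{1:t}+K^\rho_{y_t|y_{1:t-1}}y_{1:t-1}+m^\rho_{y_t|\tilde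 z_{1:t-1}},\ \Sigma^\rho_{y_t|\tilde z_{1:t-1}}\big),$$ $$\rho(z_{t+1:T}\mid z_{1:t})=\mathcal N\big(K^\rho_{z_{t+1:T}|u_{1:t}}u_{1:t}+K^\rho_{z_{t+1:T}|y_{1:t-1}}y_{1:t-1}+K^\rho_{z_{t+1:T}|y_t}y_t+m^\rho_{z_{t+1:T}|z_{1:t}},\ \Sigma^\rho_{z_{t+1:T}|z_{1:t}}\big),$$ and $\mu(u_t\mid u_{1:t-1})=\mathcal N(K^\mu_{u_t|u_{1:t-1}}u_{1:t-1}+m^\mu_{u_t|u_{1:t-1}},\Sigma^\mu_{u_t|u_{1:t-1}})$ (such representations exist). For every $t=1,\dots,T$: (i) $\pi(u_t\mid u_{1:t-1},y_{1:t-1})=\mathcal N(K^\mu_{u_t|u_{1:t-1}}u_{1:t-1}+0\cdot y_{1:t-1}+m^\mu_{u_t|u_{1:t-1}},\ \Sigma^\mu_{u_t|u_{1:t-1}})$. (ii) Let $G_t=(\Sigma^\gamma_{z_{t+1:T}|z_{1:t}})^{-1}$ or, if this matrix $\Sigma$ is singular, any $G_t$ with $\Sigma G_t\Sigma=\Sigma$,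 and put $$\delta_t=K^\pi_{z_{t+1:T}|y_t}-K^\gamma_{z_{t+1:T}|y_t},\quad \Delta^y_t=K^\pi_{z_{t+1:T}|y_{1:t-1}}-K^\gamma_{z_{t+1:T}|y_{1:t-1}},$$ $$\Delta^u_t=K^\pi_{z_{t+1:T}|u_{1:t}}-K^\gamma_{z_{t+1:T}|u_{1:t}},\quad \Delta m_t=m^\pi_{z_{t+1:T}|z_{1:t}}-m^\gamma_{z_{t+1:T}|z_{1:t}},$$ $$\Sigma^\psi_t=\frac1{\delta_t^\top G_t\delta_t},\quad K^{\psi,y}_t=-\Sigma^\psi_t\delta_t^\top G_t\Delta^y_t,\quad K^{\psi,u}_t=-\Sigma^\psi_t\delta_t^\top G_t\Delta^u_t,\quad m^\psi_t=-\Sigma^\psi_t\delta_t^\top G_t\Delta m_t,$$ $$\alpha_t=\frac{\Sigma^\psi_t}{\Sigma^\gamma_{y_t|\tilde z_{1:t-1}}+\Sigma^\psi_t};$$ if $\delta_t^\top G_t\delta_t=0$ (in particular for $t=T$), so that $\Sigma^\psi_t=\infty$, put instead $\alpha_t=1$ and let the terms with factor $1-\alpha_t$ vanish. Then the conditional law $\pi(y_t\mid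 u_{1:t},y_{1:t-1})$ is Gaussian with $$K^\pi_{y_t|y_{1:t-1}}=\alpha_tK^\gamma_{y_t|y_{1:t-1}}+(1-\alpha_t)K^{\psi,y}_t,\qquad K^\pi_{y_t|u_{1:t}}=\alpha_tK^\gamma_{y_t|u_{1:t}}+(1-\alpha_t)K^{\psi,u}_t,$$ $$m^\pi_{y_t|\tilde z_{1:t-1}}=\alpha_tm^\gamma_{y_t|\tilde z_{1:t-1}}+(1-\alpha_t)m^\psi_t,\qquad \Sigma^\pi_{y_t|\tilde z_{1:t-1}}=\alpha_t\Sigma^\gamma_{y_t|\tilde z_{1:t-1}}.$$ -/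

import Mathlib

open MeasureTheory ProbabilityTheory InformationTheory Matrix

noncomputable section

namespace CausalSB

/-! ### Paths and their pieces

Times are the elements of `Fin T` (so the first time is `0` and the last one is `T - 1`). A point of
`Path T` is a pair `(u, y)` of an input path and an output path. -/

/-- Input-output paths `(u, y)` over `T` time steps. -/
abbrev Path (T : ℕ) : Type := (Fin T → ℝ) × (Fin T → ℝ)

/-- The times strictly before `t`. -/
abbrev Before {T : ℕ} (t : Fin T) : Type := {s : Fin T // s < t}

/-- The times up to and including `t`. -/
abbrev UpTo {T : ℕ} (t : Fin T) : Type := {s : Fin T // s ≤ t}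

/-- The times strictly after `t`. -/
abbrev After {T : ℕ} (t : Fin T) : Type := {s : Fin T // t < s}

/-- `x_{1:t-1}`. -/
def before {T : ℕ} (t : Fin T) (x : Fin T → ℝ) : Before t → ℝ := fun s => x s

/-- `x_{1:t}`. -/
def upTo {T : ℕ} (t : Fin T) (x : Fin T → ℝ) : UpTo t → ℝ := fun s => x s

/-- `x_{t+1:T}`. -/
def after {T : ℕ} (t : Fin T) (x : Fin T → ℝ) : After t → ℝ := fun s => x s

/-- `z_{t+1:T} = (u_{t+1:T}, y_{t+1:T})`, as one vector. -/
def future {T : ℕ} (t : Fin T) (z : Path T) : After t ⊕ After t → ℝ :=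
  Sum.elim (after t z.1) (after t z.2)

theorem measurable_upTo_fst {T : ℕ} (t : Fin T) :
    Measurable (fun z : Path T => upTo t z.1) := by
  unfold upTo
  fun_prop

/-! ### Causal couplings and the projection problem -/

/-- Causality: for every time `t`, `Y_{1:t}` and `U_{t+1:T}` are conditionally independent given
`U_{1:t}`. (At the last time the condition is void.) -/
def IsCausal {T : ℕ} (π : ProbabilityMeasure (Path T)) : Prop :=
  ∀ t : Fin T,
    CondIndepFun (MeasurableSpace.comap (fun z : Path T => upTo t z.1) inferInstance)
      (measurable_upTo_fst t).comap_le
      (fun z : Path T => upTo t z.2) (fun z : Path T => after t z.1) (π : Measure (Path T))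

/-- `Π_c(μ, *)`: the causal couplings of `(U, Y)` whose `U`-marginal is `μ`. -/
def causalCouplings {T : ℕ} (μ : Measure (Fin T → ℝ)) : Set (ProbabilityMeasure (Path T)) :=
  {π | (π : Measure (Path T)).map Prod.fst = μ ∧ IsCausal π}

/-- `π` minimizes `D(·, γ)` over `Π_c(μ, *)`. -/
def IsCausalProjection {T : ℕ} (μ : Measure (Fin T → ℝ)) (γ : Measure (Path T))
    (π : ProbabilityMeasure (Path T)) : Prop :=
  π ∈ causalCouplings μ ∧
    ∀ π' ∈ causalCouplings μ,
      klDiv (π : Measure (Path T)) γ ≤ klDiv (π' : Measure (Path T)) γ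

/-- The covariance matrix of a measure on `ℝ^T`. -/
def covMatrix {T : ℕ} (μ : Measure (Fin T → ℝ)) : Matrix (Fin T) (Fin T) ℝ :=
  Matrix.of fun s t => cov[fun u => u s, fun u => u t; μ]

/-! ### Parameters of Gaussian conditional laws -/

/-- The law `N(m, S)` on `ℝ^ι`, for a positive semidefinite `S`. -/
def gaussianVec {ι : Type*} [Fintype ι] [DecidableEq ι] (m : ι → ℝ) (S : Matrix ι ι ℝ) :
    Measure (ι → ℝ) :=
  (multivariateGaussian (WithLp.toLp 2 m) S).map WithLp.ofLp

/-- Parameters of the conditional law of `U_t` given `U_{1:t-1}`. -/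
structure MarginalParams {T : ℕ} (t : Fin T) where
  /-- the gain on `u_{1:t-1}` -/
  K : Before t → ℝ
  /-- the constant term -/
  m : ℝ
  /-- the conditional variance -/
  var : ℝ

/-- Parameters of the conditional law of `U_t` given `(U_{1:t-1}, Y_{1:t-1})`. -/
structure InputParams {T : ℕ} (t : Fin T) where
  /-- the gain on `u_{1:t-1}` -/
  Ku : Before t → ℝ
  /-- the gain on `y_{1:t-1}` -/
  Ky : Before t → ℝ
  /-- the constant term -/
  m : ℝ
  /-- the conditional variance -/
  var : ℝ

/-- Parameters of the conditional law of `Y_t` given `(U_{1:t}, Y_{1:t-1})`. -/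
structure OutputParams {T : ℕ} (t : Fin T) where
  /-- the gain on `u_{1:t}` -/
  Ku : UpTo t → ℝ
  /-- the gain on `y_{1:t-1}` -/
  Ky : Before t → ℝ
  /-- the constant term -/
  m : ℝ
  /-- the conditional variance -/
  var : ℝ

/-- Parameters of the conditional law of `Z_{t+1:T}` given `Z_{1:t}`, where the gain on `z_{1:t}` is
split into the gains on `u_{1:t}`, `y_{1:t-1}` and `y_t`. -/
structure FutureParams {T : ℕ} (t : Fin T) where
  /-- the gain on `u_{1:t}` -/
  Ku : Matrix (After t ⊕ After t) (UpTo t) ℝ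
  /-- the gain on `y_{1:t-1}` -/
  Ky : Matrix (After t ⊕ After t) (Before t) ℝ
  /-- the gain on `y_t` -/
  Kyt : After t ⊕ After t → ℝ
  /-- the constant term -/
  m : After t ⊕ After t → ℝ
  /-- the conditional covariance -/
  cov : Matrix (After t ⊕ After t) (After t ⊕ After t) ℝ

/-- Under `μ`, the conditional law of `U_t` given `U_{1:t-1} = u` is `N(K u + m, var)`. -/
def IsMarginalLaw {T : ℕ} (μ : Measure (Fin T → ℝ)) [IsFiniteMeasure μ] (t : Fin T)
    (a : MarginalParams t) : Prop :=
  0 ≤ a.var ∧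
    ∀ᵐ u ∂(μ.map (before t)),
      condDistrib (fun x : Fin T → ℝ => x t) (before t) μ u =
        gaussianReal (a.K ⬝ᵥ u + a.m) a.var.toNNReal

/-- Under `π`, the conditional law of `U_t` given `(U_{1:t-1}, Y_{1:t-1}) = (u, y)` is
`N(Ku u + Ky y + m, var)`. -/
def IsInputLaw {T : ℕ} (π : Measure (Path T)) [IsFiniteMeasure π] (t : Fin T)
    (a : InputParams t) : Prop :=
  0 ≤ a.var ∧
    ∀ᵐ x ∂(π.map fun z => (before t z.1, before t z.2)),
      condDistrib (fun z : Path T => z.1 t) (fun z => (before t z.1, before t z.2)) π x =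
        gaussianReal (a.Ku ⬝ᵥ x.1 + a.Ky ⬝ᵥ x.2 + a.m) a.var.toNNReal

/-- Under `π`, the conditional law of `Y_t` given `(U_{1:t}, Y_{1:t-1}) = (u, y)` is
`N(Ku u + Ky y + m, var)`. -/
def IsOutputLaw {T : ℕ} (π : Measure (Path T)) [IsFiniteMeasure π] (t : Fin T)
    (a : OutputParams t) : Prop :=
  0 ≤ a.var ∧
    ∀ᵐ x ∂(π.map fun z => (upTo t z.1, before t z.2)),
      condDistrib (fun z : Path T => z.2 t) (fun z => (upTo t z.1, before t z.2)) π x =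
        gaussianReal (a.Ku ⬝ᵥ x.1 + a.Ky ⬝ᵥ x.2 + a.m) a.var.toNNReal

/-- Under `π`, the conditional law of `Z_{t+1:T}` given `(U_{1:t}, Y_{1:t-1}, Y_t) = (u, y, y')` is
`N(Ku u + Ky y + y' Kyt + m, cov)`. -/
def IsFutureLaw {T : ℕ} (π : Measure (Path T)) [IsFiniteMeasure π] (t : Fin T)
    (a : FutureParams t) : Prop :=
  a.cov.PosSemidef ∧
    ∀ᵐ x ∂(π.map fun z => (upTo t z.1, before t z.2, z.2 t)),
      condDistrib (future t) (fun z => (upTo t z.1, before t z.2, z.2 t)) π x =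
        gaussianVec (a.Ku *ᵥ x.1 + a.Ky *ᵥ x.2.1 + x.2.2 • a.Kyt + a.m) a.cov

/-! ### The backward formulas

Below `c` are the parameters of `γ(z_{t+1:T} | z_{1:t})`, `c'` those of `π(z_{t+1:T} | z_{1:t})`,
`b` those of `γ(y_t | u_{1:t}, y_{1:t-1})`, and `G` is the inverse of `c.cov`, or any matrix with `c.cov * G * c.cov = c.cov` (a generalized inverse) if `c.cov` is
singular; if `c.cov` is invertible, the latter equation holds only for `G = c.cov⁻¹`. -/

/-- `δ_tᵀ G δ_t` with `δ_t` the difference of the gains on `y_t`; this is the reciprocal of the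
`ψ`-variance. -/
def psiPrecision {T : ℕ} {t : Fin T} (c c' : FutureParams t)
    (G : Matrix (After t ⊕ After t) (After t ⊕ After t) ℝ) : ℝ :=
  (c'.Kyt - c.Kyt) ⬝ᵥ (G *ᵥ (c'.Kyt - c.Kyt))

/-- The `ψ` parameters of `y_t` given `(u_{1:t}, y_{1:t-1})`; meaningful if `psiPrecision ≠ 0`. -/
def psiParams {T : ℕ} {t : Fin T} (c c' : FutureParams t)
    (G : Matrix (After t ⊕ After t) (After t ⊕ After t) ℝ) : OutputParams t where
  Ku := -(1 / psiPrecision c c' G) • (((c'.Kyt - c.Kyt) ᵥ* G) ᵥ* (c'.Ku - c.Ku))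
  Ky := -(1 / psiPrecision c c' G) • (((c'.Kyt - c.Kyt) ᵥ* G) ᵥ* (c'.Ky - c.Ky))
  m := -(1 / psiPrecision c c' G) * (((c'.Kyt - c.Kyt) ᵥ* G) ⬝ᵥ (c'.m - c.m))
  var := 1 / psiPrecision c c' G

/-- The weight `α_t = Σ^ψ / (Σ^γ + Σ^ψ)`, equal to `1` when `Σ^ψ` is infinite. -/
def alpha {T : ℕ} {t : Fin T} (b : OutputParams t) (c c' : FutureParams t)
    (G : Matrix (After t ⊕ After t) (After t ⊕ After t) ℝ) : ℝ :=
  if psiPrecision c c' G = 0 then 1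
  else (psiParams c c' G).var / (b.var + (psiParams c c' G).var)

/-- The parameters of the conditional law of `Y_t` after the projection. -/
def oddOutputParams {T : ℕ} {t : Fin T} (b : OutputParams t) (c c' : FutureParams t)
    (G : Matrix (After t ⊕ After t) (After t ⊕ After t) ℝ) : OutputParams t where
  Ku := alpha b c c' G • b.Ku + (1 - alpha b c c' G) • (psiParams c c' G).Ku
  Ky := alpha b c c' G • b.Ky + (1 - alpha b c c' G) • (psiParams c c' G).Ky
  m := alpha b c c' G * b.m + (1 - alpha b c c' G) * (psiParams c c' G).m
  var := alpha b c c' G * b.var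

end CausalSB

end

noncomputable section

namespace CausalSB

open Filter Topology
open scoped ENNReal NNReal

/-! ### Kullback-Leibler divergence -/

section KullbackLeibler

variable {α β : Type*} {mα : MeasurableSpace α} {mβ : MeasurableSpace β}

/-! Existence and uniqueness. As μ is Gaussian, U_{t+1:T} is a linear function of U_{1:t} plus an
innovation independent of U_{1:t}, and causality says that this innovation is independent of
(U_{1:t}, Y_{1:t}) (`mem_causalCouplings_iff`). The law of the innovation is fixed by μ, so the
condition is affine in the coupling, and the causal couplings are stable under midpoints and setwise
limits. On such a set the divergence has exactly one minimizer (`exists_unique_klDiv_minimizer`),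
because its convexity defect at a midpoint controls the Hellinger distance.

Gaussianity. Centre two independent copies ζ₁, ζ₂ of the minimizer and rotate the pair by 45
degrees. Both (ζ₁ + ζ₂)/√2 and (ζ₂ - ζ₁)/√2, with the mean restored, are again causal couplings,
since causality and the input marginal only involve linear maps, independence and a Gaussian law.
The centred γ ⊗ γ is rotation invariant, and the divergence from a product dominates the sum of the
divergences of the marginals, so the two new divergences add up to at most twice the minimum. Hence
both are minimal, and by uniqueness ζ₁ has the law of (ζ₁ + ζ₂)/√2. With finite second moments the
central limit theorem makes it Gaussian (`isGaussian_of_klDiv_mixedLaw`).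

Conditional laws. That of U_t follows from the independence of the innovations. For Y_t, replace
only the kernel of Y_t given (U_{1:t}, Y_{1:t-1}) and keep all other kernels of π; the result is
still causal (`mem_causalCouplings_of_withDensity`). By the chain rule, the cost as a function of
the new mean and variance consists of the divergence from the kernel of γ and the expectation of a
quadratic function of y_t, which is the cost of the mismatch between the future means of π and γ.
Completing the square gives a normal law whose precision is the sum of 1/Σ^γ and 1/Σ^ψ
(`klDiv_twoStepLaw_le`), and uniqueness of the minimizer forces the kernel of π to be this one.
Singular covariances are handled by Cameron-Martin theory: finite divergence puts all mean
differences into the range of the covariance, where any generalized inverse serves. -/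

theorem klDiv_map_eq_of_leftInverse {f : α → β} {g : β → α} (hf : Measurable f) (hg : Measurable g)
    (hgf : Function.LeftInverse g f) (P Q : Measure α) [IsFiniteMeasure P] [IsFiniteMeasure Q] :
    klDiv (P.map f) (Q.map f) = klDiv P Q := by
  refine le_antisymm (klDiv_map_le _ _ hf) ?_
  have h (R : Measure α) : (R.map f).map g = R := by
    rw [Measure.map_map hg hf, hgf.comp_eq_id, Measure.map_id]
  calc klDiv P Q = klDiv ((P.map f).map g) ((Q.map f).map g) := by rw [h, h]
    _ ≤ klDiv (P.map f) (Q.map f) := klDiv_map_le _ _ hg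

theorem klDiv_prod_left (P : Measure α) [IsProbabilityMeasure P] (Q R : Measure β)
    [IsProbabilityMeasure Q] [IsProbabilityMeasure R] :
    klDiv (P.prod Q) (P.prod R) = klDiv Q R := by
  have h : klDiv (Q.prod P) (R.prod P) = klDiv Q R := by
    simpa [Measure.compProd_const] using klDiv_compProd_left Q R (Kernel.const β P)
  rw [← h, ← Measure.prod_swap (μ := Q) (ν := P), ← Measure.prod_swap (μ := R) (ν := P)]
  exact klDiv_map_eq_of_leftInverse measurable_swap measurable_swap Prod.swap_leftInverse _ _

theorem klDiv_prod (P Q : Measure α) (P' Q' : Measure β) [IsProbabilityMeasure P]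
    [IsProbabilityMeasure Q] [IsProbabilityMeasure P'] [IsProbabilityMeasure Q'] :
    klDiv (P.prod P') (Q.prod Q') = klDiv P Q + klDiv P' Q' := by
  have h := klDiv_compProd_eq_add P Q (Kernel.const α P') (Kernel.const α Q')
  simpa [Measure.compProd_const, klDiv_prod_left] using h

/-- Superadditivity: the chain rule splits off the first marginal and leaves the divergence of `P`
from `P.fst.prod Q'`, which can only decrease under projection to the second coordinate. -/
theorem add_klDiv_marginals_le [StandardBorelSpace β] [Nonempty β] (P : Measure (α × β))
    [IsProbabilityMeasure P] (Q : Measure α) (Q' : Measure β)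
    [IsProbabilityMeasure Q] [IsProbabilityMeasure Q'] :
    klDiv (P.map Prod.fst) Q + klDiv (P.map Prod.snd) Q' ≤ klDiv P (Q.prod Q') := by
  have h := klDiv_compProd_eq_add P.fst Q P.condKernel (Kernel.const α Q')
  rw [P.disintegrate, Measure.compProd_const, Measure.compProd_const] at h
  rw [h]
  refine add_le_add le_rfl ?_
  have h2 : klDiv (P.map Prod.snd) ((P.fst.prod Q').map Prod.snd) ≤ klDiv P (P.fst.prod Q') :=
    klDiv_map_le _ _ measurable_snd
  rwa [Measure.map_snd_prod, measure_univ, one_smul] at h2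

/-- Fenchel-Young inequality, from e^x ≥ x + 1 at x = b - log a. -/
theorem mul_le_klFun_add_exp {a : ℝ} (ha : 0 ≤ a) (b : ℝ) : a * b ≤ klFun a + Real.exp b := by
  rcases ha.eq_or_lt with rfl | ha
  · simp only [zero_mul, klFun_zero]; positivity
  · have h := Real.add_one_le_exp (b - Real.log a)
    have h2 : Real.exp b = a * Real.exp (b - Real.log a) := by
      rw [Real.exp_sub, Real.exp_log ha]; field_simp
    rw [h2, klFun_apply]
    nlinarith

/-- Entropy inequality: exponential moments under `Q` become plain moments under any law at finite
divergence from `Q`. -/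
theorem lintegral_ne_top_of_klDiv_ne_top {P Q : Measure α} [IsFiniteMeasure P] [IsFiniteMeasure Q]
    (h : klDiv P Q ≠ ∞) {g : α → ℝ} (hg : Measurable g)
    (hint : Integrable (fun x => Real.exp (g x)) Q) :
    ∫⁻ x, ENNReal.ofReal (g x) ∂P ≠ ∞ := by
  have hac := (klDiv_ne_top_iff.1 h).1
  rw [klDiv_eq_lintegral_klFun_of_ac hac] at h
  rw [← lintegral_rnDeriv_mul hac (by fun_prop)]
  refine ne_top_of_le_ne_top (b := ∫⁻ x, ENNReal.ofReal (klFun (P.rnDeriv Q x).toReal) ∂Q +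
    ∫⁻ x, ENNReal.ofReal (Real.exp (g x)) ∂Q) ?_ ?_
  · refine ENNReal.add_ne_top.2 ⟨h, ?_⟩
    exact (hint.lintegral_lt_top).ne
  · rw [← lintegral_add_left (by fun_prop)]
    refine lintegral_mono_ae ?_
    filter_upwards [P.rnDeriv_lt_top Q] with x hx
    rw [← ENNReal.ofReal_add (klFun_nonneg ENNReal.toReal_nonneg) (Real.exp_pos _).le]
    nth_rw 1 [← ENNReal.ofReal_toReal hx.ne]
    rw [← ENNReal.ofReal_mul ENNReal.toReal_nonneg]
    exact ENNReal.ofReal_le_ofReal (mul_le_klFun_add_exp ENNReal.toReal_nonneg _)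

/-- The log-likelihood ratios with respect to `Q` and `Q'` differ by `l`. Since `Q` and `Q'` are
mutually absolutely continuous, the two divergences are infinite together. The sign condition `hnn`
keeps `ENNReal.ofReal` from truncating. -/
theorem klDiv_eq_add_of_withDensity_exp {P Q Q' : Measure α} [IsProbabilityMeasure P]
    [IsProbabilityMeasure Q] [IsProbabilityMeasure Q'] {l : α → ℝ} (hl : Measurable l)
    (hQ : Q' = Q.withDensity fun x => ENNReal.ofReal (Real.exp (l x)))
    (hint : Integrable l P) (hnn : 0 ≤ ∫ x, l x ∂P) :
    klDiv P Q = klDiv P Q' + ENNReal.ofReal (∫ x, l x ∂P) := by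
  have hone : ∫⁻ x, ENNReal.ofReal (Real.exp (l x)) ∂Q = 1 := by
    have := measure_univ (μ := Q')
    rwa [hQ, withDensity_apply _ MeasurableSet.univ, setLIntegral_univ] at this
  have hexp : Integrable (fun x => Real.exp (l x)) Q := by
    refine ⟨by fun_prop, ?_⟩
    rw [hasFiniteIntegral_iff_ofReal (ae_of_all _ fun x => (Real.exp_pos _).le), hone]
    exact ENNReal.one_lt_top
  have hI : ∫ x, Real.exp (l x) ∂Q = 1 := by
    rw [integral_eq_lintegral_of_nonneg_ae (ae_of_all _ fun x => (Real.exp_pos _).le)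
      (by fun_prop), hone, ENNReal.toReal_one]
  have hQt : Q' = Q.tilted l := by
    rw [hQ, Measure.tilted, hI]; simp
  have hiff : P ≪ Q ↔ P ≪ Q' := by
    rw [hQt]
    exact ⟨fun h => h.trans (absolutelyContinuous_tilted hexp),
      fun h => h.trans (tilted_absolutelyContinuous _ _)⟩
  by_cases hac : P ≪ Q
  swap
  · rw [klDiv_of_not_ac hac, klDiv_of_not_ac (fun h => hac (hiff.2 h)), top_add]
  have hllr : llr P Q' =ᵐ[P] fun x => llr P Q x - l x := by
    have := llr_tilted_right hac hexp
    rw [hI, Real.log_one] at this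
    rw [hQt]
    filter_upwards [this] with x hx
    rw [hx]; ring
  by_cases hi : Integrable (llr P Q) P
  swap
  · rw [klDiv_of_not_integrable hi, klDiv_of_not_integrable, top_add]
    intro h
    refine hi (((h.congr hllr).add hint).congr (ae_of_all _ fun x => ?_))
    simp
  have hi' : Integrable (llr P Q') P := (hi.sub hint).congr hllr.symm
  have hnn' := integral_llr_add_sub_measure_univ_nonneg (hiff.1 hac) hi'
  rw [klDiv_of_ac_of_integrable hac hi, klDiv_of_ac_of_integrable (hiff.1 hac) hi',
    ← ENNReal.ofReal_add hnn' hnn, integral_congr_ae hllr, integral_sub hi hint]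
  congr 1
  simp

end KullbackLeibler

/-! ### Minimizing the divergence over a convex closed set of laws -/

section Minimizer

theorem two_mul_sub_le_mul_log_sub {a m : ℝ} (ha : 0 ≤ a) (hm : 0 < m) :
    2 * a - 2 * (√a * √m) ≤ a * Real.log a - a * Real.log m := by
  rcases ha.eq_or_lt with rfl | ha
  · simp
  · have hs := Real.sqrt_pos.2 ha
    have hr := Real.sqrt_pos.2 hm
    have h := Real.log_le_sub_one_of_pos (div_pos hr hs)
    rw [Real.log_div hr.ne' hs.ne', Real.log_sqrt ha.le, Real.log_sqrt hm.le] at h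
    have h2 : a * (√m / √a) = √a * √m := by
      nth_rw 1 [← Real.mul_self_sqrt ha.le]; field_simp
    nlinarith

/-- Strong convexity of `klFun` in the Hellinger metric; this replaces the parallelogram identity in
the projection argument. -/
theorem two_mul_klFun_midpoint_add_le {a b : ℝ} (ha : 0 ≤ a) (hb : 0 ≤ b) :
    2 * klFun ((a + b) / 2) + (√a - √b) ^ 2 / 2 ≤ klFun a + klFun b := by
  rcases (add_nonneg ha hb).eq_or_lt with h0 | h0
  · have h1 : a = 0 := by linarith
    have h2 : b = 0 := by linarith
    subst h1 h2; simp; linarith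
  · have hm : 0 < (a + b) / 2 := by linarith
    have h1 := two_mul_sub_le_mul_log_sub ha hm
    have h2 := two_mul_sub_le_mul_log_sub hb hm
    have h3 := Real.mul_self_sqrt ha
    have h4 := Real.mul_self_sqrt hb
    have h5 := Real.mul_self_sqrt hm.le
    simp only [klFun_apply]
    -- With s = √a + √b and m the midpoint, 4m = s² + (√a - √b)², so the slack is (s - 2√m)²/2.
    nlinarith [sq_nonneg (√a + √b - 2 * √((a + b) / 2))]

variable {Ω : Type*} {mΩ : MeasurableSpace Ω}

theorem klDiv_midpoint_add_le {γ P Q R : Measure Ω} [IsProbabilityMeasure γ]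
    [IsProbabilityMeasure P] [IsProbabilityMeasure Q] [IsProbabilityMeasure R]
    (hR : R = (2⁻¹ : ℝ≥0∞) • (P + Q)) (hP : P ≪ γ) (hQ : Q ≪ γ) :
    2 * klDiv R γ + ∫⁻ x, ENNReal.ofReal
      ((√(P.rnDeriv γ x).toReal - √(Q.rnDeriv γ x).toReal) ^ 2 / 2) ∂γ
      ≤ klDiv P γ + klDiv Q γ := by
  have hRac : R ≪ γ := by
    rw [hR]
    exact (Measure.AbsolutelyContinuous.add_left_iff.2 ⟨hP, hQ⟩).smul_left _
  have hd : (fun x => (R.rnDeriv γ x).toReal) =ᵐ[γ]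
      fun x => ((P.rnDeriv γ x).toReal + (Q.rnDeriv γ x).toReal) / 2 := by
    rw [hR]
    filter_upwards [Measure.rnDeriv_smul_left_of_ne_top (P + Q) γ
      (r := (2⁻¹ : ℝ≥0∞)) (by simp), Measure.rnDeriv_add P Q γ, P.rnDeriv_lt_top γ,
      Q.rnDeriv_lt_top γ] with x h1 h2 h3 h4
    rw [h1, Pi.smul_apply, h2, Pi.add_apply, smul_eq_mul, ENNReal.toReal_mul,
      ENNReal.toReal_add h3.ne h4.ne, ENNReal.toReal_inv, ENNReal.toReal_ofNat]
    ring
  rw [klDiv_eq_lintegral_klFun_of_ac hRac, klDiv_eq_lintegral_klFun_of_ac hP,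
    klDiv_eq_lintegral_klFun_of_ac hQ, ← lintegral_const_mul _ (by fun_prop),
    ← lintegral_add_left (by fun_prop), ← lintegral_add_left (by fun_prop)]
  refine lintegral_mono_ae ?_
  filter_upwards [hd] with x hx
  rw [hx]
  have h1 : (0 : ℝ) ≤ (P.rnDeriv γ x).toReal := ENNReal.toReal_nonneg
  have h2 : (0 : ℝ) ≤ (Q.rnDeriv γ x).toReal := ENNReal.toReal_nonneg
  have h3 : (2 : ℝ≥0∞) = ENNReal.ofReal 2 := by simp
  rw [h3, ← ENNReal.ofReal_mul (by norm_num), ← ENNReal.ofReal_add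
    (mul_nonneg (by norm_num) (klFun_nonneg (by positivity))) (by positivity),
    ← ENNReal.ofReal_add (klFun_nonneg h1) (klFun_nonneg h2)]
  exact ENNReal.ofReal_le_ofReal (two_mul_klFun_midpoint_add_le h1 h2)

/-- The midpoint of two probability measures. -/
def midpointLaw (P Q : ProbabilityMeasure Ω) : ProbabilityMeasure Ω :=
  ⟨(2⁻¹ : ℝ≥0∞) • ((P : Measure Ω) + (Q : Measure Ω)), ⟨by
    simp only [Measure.smul_apply, Measure.add_apply, measure_univ, smul_eq_mul]
    rw [one_add_one_eq_two, ENNReal.inv_mul_cancel (by simp) (by simp)]⟩⟩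

/-- Quantitative uniqueness: near-minimizers have close square-root densities. -/
theorem lintegral_sqrt_rnDeriv_sub_le {γ : Measure Ω} [IsProbabilityMeasure γ]
    {C : Set (ProbabilityMeasure Ω)} (hmid : ∀ P ∈ C, ∀ Q ∈ C, midpointLaw P Q ∈ C)
    {v : ℝ≥0∞} (hv : v ≠ ∞) (hle : ∀ P ∈ C, v ≤ klDiv (P : Measure Ω) γ)
    {P Q : ProbabilityMeasure Ω} (hP : P ∈ C) (hQ : Q ∈ C) {a b : ℝ≥0∞}
    (hPa : klDiv (P : Measure Ω) γ ≤ v + a) (hQb : klDiv (Q : Measure Ω) γ ≤ v + b)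
    (ha : a ≠ ∞) (hb : b ≠ ∞) :
    ∫⁻ x, ENNReal.ofReal ((√((P : Measure Ω).rnDeriv γ x).toReal -
      √((Q : Measure Ω).rnDeriv γ x).toReal) ^ 2 / 2) ∂γ ≤ a + b := by
  have hPac := (klDiv_ne_top_iff.1 (ne_top_of_le_ne_top (ENNReal.add_ne_top.2 ⟨hv, ha⟩) hPa)).1
  have hQac := (klDiv_ne_top_iff.1 (ne_top_of_le_ne_top (ENNReal.add_ne_top.2 ⟨hv, hb⟩) hQb)).1
  have h := klDiv_midpoint_add_le (R := midpointLaw P Q) rfl hPac hQac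
  have h2 := hle _ (hmid P hP Q hQ)
  set I := ∫⁻ x, ENNReal.ofReal ((√((P : Measure Ω).rnDeriv γ x).toReal -
      √((Q : Measure Ω).rnDeriv γ x).toReal) ^ 2 / 2) ∂γ
  have h3 : 2 * v + I ≤ 2 * v + (a + b) := calc
    2 * v + I ≤ 2 * klDiv (midpointLaw P Q : Measure Ω) γ + I := by gcongr
    _ ≤ (v + a) + (v + b) := h.trans (add_le_add hPa hQb)
    _ = 2 * v + (a + b) := by ring
  exact (ENNReal.add_le_add_iff_left (ENNReal.mul_ne_top (by simp) hv)).1 h3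

theorem tendsto_eLpNorm_of_tendsto_sub {γ : Measure Ω} {f : ℕ → Ω → ℝ} {g : Ω → ℝ}
    (hf : ∀ n, AEStronglyMeasurable (f n) γ) (hg : MemLp g 2 γ)
    (h : Tendsto (fun n => eLpNorm (f n - g) 2 γ) atTop (𝓝 0)) :
    Tendsto (fun n => eLpNorm (f n) 2 γ) atTop (𝓝 (eLpNorm g 2 γ)) := by
  have hl : Tendsto (fun n => eLpNorm g 2 γ - eLpNorm (f n - g) 2 γ) atTop
      (𝓝 (eLpNorm g 2 γ)) := by
    simpa using ENNReal.Tendsto.sub tendsto_const_nhds h (Or.inl hg.eLpNorm_ne_top)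
  have hu : Tendsto (fun n => eLpNorm g 2 γ + eLpNorm (f n - g) 2 γ) atTop
      (𝓝 (eLpNorm g 2 γ)) := by
    simpa using tendsto_const_nhds.add h
  refine tendsto_of_tendsto_of_tendsto_of_le_of_le hl hu (fun n => ?_) (fun n => ?_)
  · refine tsub_le_iff_right.2 ?_
    calc eLpNorm g 2 γ = eLpNorm (f n - (f n - g)) 2 γ := by simp
      _ ≤ _ := eLpNorm_sub_le (hf n) ((hf n).sub hg.1) (by norm_num)
  · calc eLpNorm (f n) 2 γ = eLpNorm (g + (f n - g)) 2 γ := by simp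
      _ ≤ _ := eLpNorm_add_le hg.1 ((hf n).sub hg.1) (by norm_num)

theorem eLpNorm_two_sq (γ : Measure Ω) (f : Ω → ℝ) :
    eLpNorm f 2 γ ^ 2 = ∫⁻ x, ENNReal.ofReal (f x ^ 2) ∂γ := by
  have h := eLpNorm_nnreal_pow_eq_lintegral (μ := γ) (f := f) (p := 2) (by norm_num)
  have h2 (x : ℝ≥0∞) : x ^ ((2 : ℝ≥0) : ℝ) = x ^ 2 := by
    rw [← ENNReal.rpow_natCast]; norm_num
  simp only [h2] at h
  rw [show ((2 : ℝ≥0) : ℝ≥0∞) = 2 by simp] at h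
  rw [h]
  refine lintegral_congr fun x => ?_
  rw [← sq_abs, ENNReal.ofReal_pow (abs_nonneg _), Real.enorm_eq_ofReal_abs]

theorem lintegral_sq_sqrt_rnDeriv {γ P : Measure Ω} [IsFiniteMeasure P] [SigmaFinite γ]
    (hP : P ≪ γ) (A : Set Ω) :
    ∫⁻ x in A, ENNReal.ofReal (√(P.rnDeriv γ x).toReal ^ 2) ∂γ = P A := by
  rw [← Measure.setLIntegral_rnDeriv hP]
  refine lintegral_congr_ae (ae_restrict_of_ae ?_)
  filter_upwards [P.rnDeriv_lt_top γ] with x hx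
  rw [Real.sq_sqrt ENNReal.toReal_nonneg, ENNReal.ofReal_toReal hx.ne]

/-- Near-minimizers have close square-root densities, so these form a Cauchy sequence in L²(γ). The
square of the limit is the density of the minimizer: the laws converge on every set, so `hlim`
applies, and Fatou's lemma along an almost everywhere convergent subsequence gives lower
semicontinuity. -/
theorem exists_unique_klDiv_minimizer {γ : Measure Ω} [IsProbabilityMeasure γ]
    {C : Set (ProbabilityMeasure Ω)} (hmid : ∀ P ∈ C, ∀ Q ∈ C, midpointLaw P Q ∈ C)
    (hlim : ∀ (u : ℕ → ProbabilityMeasure Ω) (R : ProbabilityMeasure Ω), (∀ n, u n ∈ C) →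
      (∀ A, MeasurableSet A →
        Tendsto (fun n => (u n : Measure Ω) A) atTop (𝓝 ((R : Measure Ω) A))) → R ∈ C)
    (hfin : (⨅ P ∈ C, klDiv (P : Measure Ω) γ) < ⊤) :
    ∃ P ∈ C, klDiv (P : Measure Ω) γ < ⊤ ∧
      (∀ Q ∈ C, klDiv (P : Measure Ω) γ ≤ klDiv (Q : Measure Ω) γ) ∧
      ∀ Q ∈ C, klDiv (Q : Measure Ω) γ ≤ klDiv (P : Measure Ω) γ → Q = P := by
  set v := ⨅ P ∈ C, klDiv (P : Measure Ω) γ with hvdef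
  have hv : v ≠ ∞ := hfin.ne
  have hle : ∀ P ∈ C, v ≤ klDiv (P : Measure Ω) γ := fun P hP => iInf₂_le P hP
  -- The squared L² distance is at most 2(ε n + ε m) ≤ 4 ε N = (2^{-N}/2)²; the spare factor 1/2
  -- yields the strict bound needed for completeness.
  obtain ⟨ε, hε⟩ : ∃ ε : ℕ → ℝ, ε = fun n => (1 / 2) ^ (2 * n) / 16 := ⟨_, rfl⟩
  have hεpos (n : ℕ) : 0 < ε n := by rw [hε]; positivity
  have hseq : ∀ n : ℕ, ∃ P ∈ C, klDiv (P : Measure Ω) γ < v + ENNReal.ofReal (ε n) := by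
    intro n
    have h : v < v + ENNReal.ofReal (ε n) :=
      ENNReal.lt_add_right hv (by simpa using hεpos n)
    obtain ⟨P, hP⟩ := iInf_lt_iff.1 (hvdef ▸ h)
    obtain ⟨hPC, hP⟩ := iInf_lt_iff.1 hP
    exact ⟨P, hPC, hP⟩
  choose u huC hu using hseq
  have huac (n : ℕ) : (u n : Measure Ω) ≪ γ :=
    (klDiv_ne_top_iff.1 (ne_top_of_lt (hu n))).1
  set f : ℕ → Ω → ℝ := fun n x => √((u n : Measure Ω).rnDeriv γ x).toReal with hf
  have hfm (n : ℕ) : Measurable (f n) := by fun_prop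
  have hnorm (n : ℕ) (A : Set Ω) : eLpNorm (f n) 2 (γ.restrict A) ^ 2 = (u n : Measure Ω) A := by
    rw [eLpNorm_two_sq]
    exact lintegral_sq_sqrt_rnDeriv (huac n) A
  have hfL (n : ℕ) : MemLp (f n) 2 γ := by
    refine ⟨(hfm n).aestronglyMeasurable, ?_⟩
    have h := hnorm n Set.univ
    rw [Measure.restrict_univ, measure_univ] at h
    by_contra hcon
    rw [not_lt, top_le_iff] at hcon
    rw [hcon] at h
    simp at h
  have hcau : ∀ N n m : ℕ, N ≤ n → N ≤ m →
      eLpNorm (f n - f m) 2 γ < ENNReal.ofReal ((1 / 2) ^ N) := by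
    intro N n m hn hm
    have h := lintegral_sqrt_rnDeriv_sub_le hmid hv hle (huC n) (huC m) (hu n).le (hu m).le
      ENNReal.ofReal_ne_top ENNReal.ofReal_ne_top
    have hεle {k : ℕ} (hk : N ≤ k) : ε k ≤ ε N := by
      simp only [hε]
      have : ((1 : ℝ) / 2) ^ (2 * k) ≤ (1 / 2) ^ (2 * N) :=
        pow_le_pow_of_le_one (by norm_num) (by norm_num) (by omega)
      linarith
    have h2 : eLpNorm (f n - f m) 2 γ ^ 2 ≤ ENNReal.ofReal ((1 / 2) ^ N / 2) ^ 2 := by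
      rw [eLpNorm_two_sq]
      calc ∫⁻ x, ENNReal.ofReal ((f n - f m) x ^ 2) ∂γ
          = 2 * ∫⁻ x, ENNReal.ofReal ((f n x - f m x) ^ 2 / 2) ∂γ := by
            rw [← lintegral_const_mul _ (by fun_prop)]
            refine lintegral_congr fun x => ?_
            rw [show (2 : ℝ≥0∞) = ENNReal.ofReal 2 by simp,
              ← ENNReal.ofReal_mul (by norm_num)]
            congr 1
            simp only [Pi.sub_apply]; ring
        _ ≤ 2 * (ENNReal.ofReal (ε n) + ENNReal.ofReal (ε m)) := by gcongr
        _ ≤ 2 * (ENNReal.ofReal (ε N) + ENNReal.ofReal (ε N)) := by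
            gcongr
            · exact hεle hn
            · exact hεle hm
        _ = ENNReal.ofReal ((1 / 2) ^ N / 2) ^ 2 := by
            rw [← ENNReal.ofReal_add (hεpos N).le (hεpos N).le,
              show (2 : ℝ≥0∞) = ENNReal.ofReal 2 by simp,
              ← ENNReal.ofReal_mul (by norm_num), ← ENNReal.ofReal_pow (by positivity)]
            congr 1
            simp only [hε]; ring
    have h3 : eLpNorm (f n - f m) 2 γ ≤ ENNReal.ofReal ((1 / 2) ^ N / 2) := by
      by_contra hcon
      exact absurd h2 (not_le.2 (ENNReal.pow_lt_pow_left (by norm_num) (not_le.1 hcon)))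
    refine h3.trans_lt ((ENNReal.ofReal_lt_ofReal_iff (by positivity)).2 ?_)
    exact half_lt_self (by positivity)
  have hsum : ∑' N : ℕ, ENNReal.ofReal ((1 / 2) ^ N) ≠ ∞ := by
    rw [← ENNReal.ofReal_tsum_of_nonneg (fun n => by positivity) summable_geometric_two]
    exact ENNReal.ofReal_ne_top
  obtain ⟨g, hgL, hg⟩ := Lp.cauchy_complete_eLpNorm (by norm_num) hfL hsum hcau
  obtain ⟨g', hg'm, hgg'⟩ := hgL.1.aemeasurable
  have hg'L : MemLp g' 2 γ := hgL.ae_eq hgg'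
  have hg' : Tendsto (fun n => eLpNorm (f n - g') 2 γ) atTop (𝓝 0) := by
    refine hg.congr fun n => eLpNorm_congr_ae ?_
    filter_upwards [hgg'] with x hx
    simp [hx]
  -- The squared L² norm of `f n` over `A` is the mass that `u n` gives to `A`.
  have hset (A : Set Ω) : Tendsto (fun n => (u n : Measure Ω) A) atTop
      (𝓝 (∫⁻ x in A, ENNReal.ofReal (g' x ^ 2) ∂γ)) := by
    have h1 : Tendsto (fun n => eLpNorm (f n - g') 2 (γ.restrict A)) atTop (𝓝 0) :=
      tendsto_of_tendsto_of_tendsto_of_le_of_le tendsto_const_nhds hg' (fun n => zero_le)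
        (fun n => eLpNorm_mono_measure _ Measure.restrict_le_self)
    have h2 := tendsto_eLpNorm_of_tendsto_sub
      (fun n => (hfm n).aestronglyMeasurable) (hg'L.mono_measure Measure.restrict_le_self) h1
    have h3 := (ENNReal.continuous_pow 2).continuousAt.tendsto.comp h2
    rw [eLpNorm_two_sq] at h3
    exact h3.congr fun n => hnorm n A
  set D : Ω → ℝ≥0∞ := fun x => ENNReal.ofReal (g' x ^ 2) with hD
  have hDm : Measurable D := by fun_prop
  have hprob : IsProbabilityMeasure (γ.withDensity D) := by
    refine ⟨?_⟩
    rw [withDensity_apply _ MeasurableSet.univ]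
    refine tendsto_nhds_unique (hset Set.univ) ?_
    simp
  have hPC := hlim u ⟨γ.withDensity D, hprob⟩ huC (fun A hA => by
    have : (γ.withDensity D) A = ∫⁻ x in A, D x ∂γ := withDensity_apply _ hA
    simpa [this] using hset A)
  have hPle : klDiv (γ.withDensity D) γ ≤ v := by
    obtain ⟨ns, hns, hae⟩ := (tendstoInMeasure_of_tendsto_eLpNorm (p := 2) (by norm_num)
      (fun n => (hfm n).aestronglyMeasurable) hg'L.1 hg').exists_seq_tendsto_ae
    rw [klDiv_eq_lintegral_klFun_of_ac (withDensity_absolutelyContinuous _ _)]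
    have hkl (n : ℕ) : klDiv (u n : Measure Ω) γ = ∫⁻ x, ENNReal.ofReal (klFun (f n x ^ 2)) ∂γ := by
      rw [klDiv_eq_lintegral_klFun_of_ac (huac n)]
      refine lintegral_congr fun x => ?_
      rw [Real.sq_sqrt ENNReal.toReal_nonneg]
    calc ∫⁻ x, ENNReal.ofReal (klFun ((γ.withDensity D).rnDeriv γ x).toReal) ∂γ
        = ∫⁻ x, ENNReal.ofReal (klFun (g' x ^ 2)) ∂γ := by
          refine lintegral_congr_ae ?_
          filter_upwards [Measure.rnDeriv_withDensity γ hDm] with x hx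
          rw [hx, hD, ENNReal.toReal_ofReal (by positivity)]
      _ ≤ ∫⁻ x, liminf (fun k => ENNReal.ofReal (klFun (f (ns k) x ^ 2))) atTop ∂γ := by
          refine lintegral_mono_ae ?_
          filter_upwards [hae] with x hx
          have : Tendsto (fun k => ENNReal.ofReal (klFun (f (ns k) x ^ 2))) atTop
              (𝓝 (ENNReal.ofReal (klFun (g' x ^ 2)))) := by
            refine (ENNReal.continuous_ofReal.comp continuous_klFun).continuousAt.tendsto.comp ?_
            exact hx.pow 2
          rw [this.liminf_eq]
      _ ≤ liminf (fun k => ∫⁻ x, ENNReal.ofReal (klFun (f (ns k) x ^ 2)) ∂γ) atTop :=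
          lintegral_liminf_le fun k => by fun_prop
      _ ≤ liminf (fun k => v + ENNReal.ofReal (ε (ns k))) atTop := by
          refine liminf_le_liminf (Eventually.of_forall fun k => ?_)
          rw [← hkl]; exact (hu _).le
      _ = v := by
          have h1 : Tendsto ε atTop (𝓝 0) := by
            rw [hε]
            have : Tendsto (fun n : ℕ => ((1 / 4 : ℝ)) ^ n / 16) atTop (𝓝 (0 / 16)) :=
              (tendsto_pow_atTop_nhds_zero_of_lt_one (by norm_num) (by norm_num)).div_const 16
            rw [zero_div] at this
            refine this.congr fun n => ?_
            rw [pow_mul]; norm_num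
          have h2 : Tendsto (fun k => v + ENNReal.ofReal (ε (ns k))) atTop (𝓝 (v + 0)) := by
            refine tendsto_const_nhds.add ?_
            rw [← ENNReal.ofReal_zero]
            exact (ENNReal.continuous_ofReal.continuousAt.tendsto.comp h1).comp hns.tendsto_atTop
          rw [h2.liminf_eq, add_zero]
  refine ⟨⟨γ.withDensity D, hprob⟩, hPC, hPle.trans_lt hfin,
    fun Q hQ => hPle.trans (hle Q hQ), fun Q hQ hQle => ?_⟩
  -- With zero excess on both sides the Hellinger integral vanishes, so the densities agree almost
  -- everywhere.
  have h := lintegral_sqrt_rnDeriv_sub_le hmid hv hle hQ hPC (a := 0) (b := 0)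
    (by rw [add_zero]; exact hQle.trans hPle) (by rw [add_zero]; exact hPle) (by simp) (by simp)
  rw [add_zero, nonpos_iff_eq_zero, lintegral_eq_zero_iff (by fun_prop)] at h
  have hQac : (Q : Measure Ω) ≪ γ :=
    (klDiv_ne_top_iff.1 (ne_top_of_le_ne_top hv (hQle.trans hPle))).1
  refine Subtype.ext ?_
  change (Q : Measure Ω) = γ.withDensity D
  rw [← Measure.withDensity_rnDeriv_eq _ _ hQac,
    ← Measure.withDensity_rnDeriv_eq _ _ (withDensity_absolutelyContinuous γ D)]
  refine withDensity_congr_ae ?_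
  filter_upwards [h, (Q : Measure Ω).rnDeriv_lt_top γ, (γ.withDensity D).rnDeriv_lt_top γ]
    with x hx h1 h2
  rw [Pi.zero_apply, ENNReal.ofReal_eq_zero] at hx
  have h3 : √((Q : Measure Ω).rnDeriv γ x).toReal = √((γ.withDensity D).rnDeriv γ x).toReal := by
    have := sq_nonneg (√((Q : Measure Ω).rnDeriv γ x).toReal -
      √((γ.withDensity D).rnDeriv γ x).toReal)
    have h4 : (√((Q : Measure Ω).rnDeriv γ x).toReal -
      √((γ.withDensity D).rnDeriv γ x).toReal) ^ 2 = 0 := le_antisymm (by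
        have : (√((Q : Measure Ω).rnDeriv γ x).toReal -
          √((γ.withDensity D).rnDeriv γ x).toReal) ^ 2 / 2 ≤ 0 := hx
        linarith) this
    exact sub_eq_zero.1 (pow_eq_zero_iff (by norm_num) |>.1 h4)
  rw [Real.sqrt_inj ENNReal.toReal_nonneg ENNReal.toReal_nonneg,
    ENNReal.toReal_eq_toReal_iff' h1.ne h2.ne] at h3
  exact h3

end Minimizer

/-! ### Translations of Gaussian measures -/

/-- Fredholm alternative: in finite dimension the range of `B` is the annihilator of its
coannihilator. -/
theorem exists_bilin_eq_of_forall_ker {V : Type*} [AddCommGroup V] [Module ℝ V]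
    [FiniteDimensional ℝ V] (B : V →ₗ[ℝ] Module.Dual ℝ V) (f : Module.Dual ℝ V)
    (hf : ∀ M, (∀ L, B L M = 0) → f M = 0) : ∃ L, B L = f := by
  have h : f ∈ (LinearMap.range B).dualCoannihilator.dualAnnihilator := by
    rw [Submodule.mem_dualAnnihilator]
    intro M hM
    rw [Submodule.mem_dualCoannihilator] at hM
    exact hf M fun L => hM _ ⟨L, rfl⟩
  rw [Subspace.dualCoannihilator_dualAnnihilator_eq] at h
  exact h

theorem covarianceBilinDual_eq_zero_of_self_eq_zero {E : Type*} [NormedAddCommGroup E]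
    [NormedSpace ℝ E] [MeasurableSpace E] [BorelSpace E] {ν : Measure E} {L : StrongDual ℝ E}
    (hL : covarianceBilinDual ν L L = 0) (M : StrongDual ℝ E) :
    covarianceBilinDual ν L M = 0 := by
  have h (t : ℝ) : 0 ≤ covarianceBilinDual ν M M - 2 * t * covarianceBilinDual ν L M := by
    have := covarianceBilinDual_self_nonneg (μ := ν) (M - t • L)
    simp only [map_sub, map_smul, FunLike.coe_sub, Pi.sub_apply,
      FunLike.coe_smul, Pi.smul_apply, smul_eq_mul, hL,
      covarianceBilinDual_comm (μ := ν) M L] at this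
    linarith
  by_contra hne
  -- For this multiple of `L` the variance of `M - t • L` would be -1.
  have := h ((covarianceBilinDual ν M M + 1) / (2 * covarianceBilinDual ν L M))
  field_simp at this
  linarith

/-- Translation of the second coordinate by a function of the first one. -/
def shear {X E : Type*} [Add E] (h : X → E) (p : X × E) : X × E := (p.1, h p.1 + p.2)

theorem shear_leftInverse {X E : Type*} [AddGroup E] (h : X → E) :
    Function.LeftInverse (shear fun x => -h x) (shear h) := fun p => by
  simp [shear]

theorem measurable_shear {X E : Type*} [MeasurableSpace X] [MeasurableSpace E] [Add E]
    [MeasurableAdd₂ E] {h : X → E} (hh : Measurable h) : Measurable (shear h) :=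
  measurable_fst.prodMk ((hh.comp measurable_fst).add measurable_snd)

section CameronMartin

variable {E : Type*} [NormedAddCommGroup E] [NormedSpace ℝ E] [FiniteDimensional ℝ E]
  [MeasurableSpace E] [BorelSpace E]

/-- Write M = aL + R with R uncorrelated with L, hence independent of it by joint Gaussianity. The
integral then factors into a complex moment generating function of L at 1 + ai and a characteristic
function of R. If L has variance zero, a = 0 works. -/
theorem integral_exp_mul_cexp_gaussian {ν : Measure E} [IsGaussian ν] (hν : ν[id] = 0)
    (L M : StrongDual ℝ E) :
    ∫ x, Complex.exp (L x) * Complex.exp (M x * Complex.I) ∂ν =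
      Complex.exp (covarianceBilinDual ν L L / 2 + covarianceBilinDual ν L M * Complex.I
        - covarianceBilinDual ν M M / 2) := by
  have h2 : MemLp id 2 ν := IsGaussian.memLp_two_id
  have hmean (N : StrongDual ℝ E) : ∫ x, N x ∂ν = 0 := by
    rw [IsGaussian.integral_dual]
    simp only [id_eq] at hν
    simp [hν]
  obtain ⟨a, ha⟩ : ∃ a : ℝ, covarianceBilinDual ν L M = a * covarianceBilinDual ν L L := by
    by_cases h0 : covarianceBilinDual ν L L = 0
    · exact ⟨0, by rw [covarianceBilinDual_eq_zero_of_self_eq_zero h0]; simp⟩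
    · exact ⟨covarianceBilinDual ν L M / covarianceBilinDual ν L L, by field_simp⟩
  set R : StrongDual ℝ E := M - a • L with hR
  have hLR : covarianceBilinDual ν L R = 0 := by
    rw [hR, map_sub, map_smul, ha, smul_eq_mul, sub_self]
  have hjoint : HasGaussianLaw (fun x => (L x, R x)) ν :=
    (IsGaussian.hasGaussianLaw_id (μ := ν)).map_fun (L.prod R)
  have hind : IndepFun (fun x => L x) (fun x => R x) ν := by
    refine hjoint.indepFun_of_covariance_eq_zero ?_
    have := covarianceBilinDual_eq_covariance h2 L R
    rw [hLR] at this
    exact this.symm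
  have hvar (N : StrongDual ℝ E) : Var[N; ν] = covarianceBilinDual ν N N :=
    (covarianceBilinDual_self_eq_variance h2 N).symm
  have hRR : covarianceBilinDual ν M M =
      covarianceBilinDual ν R R + a ^ 2 * covarianceBilinDual ν L L := by
    have hM : M = R + a • L := by rw [hR]; abel
    have hRL : covarianceBilinDual ν R L = 0 := by rw [covarianceBilinDual_comm, hLR]
    conv_lhs => rw [hM]
    simp only [map_add, map_smul, FunLike.coe_add, Pi.add_apply,
      FunLike.coe_smul, Pi.smul_apply, smul_eq_mul, hLR, hRL]
    ring
  have h1 : ∫ x, Complex.exp ((1 + a * Complex.I) * L x) ∂ν =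
      Complex.exp (covarianceBilinDual ν L L * (1 + a * Complex.I) ^ 2 / 2) := by
    have hmap := IsGaussian.map_eq_gaussianReal (μ := ν) L
    have := complexMGF_gaussianReal hmap (1 + a * Complex.I)
    rw [complexMGF] at this
    rw [this, hvar]
    congr 1
    have h3 : ∫ x, L x ∂ν = 0 := hmean L
    rw [h3, Real.coe_toNNReal _ (covarianceBilinDual_self_nonneg L)]
    simp
  have h3 : ∫ x, Complex.exp (R x * Complex.I) ∂ν =
      Complex.exp (-covarianceBilinDual ν R R / 2) := by
    have := IsGaussian.charFunDual_eq_of_integral_eq_zero hν R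
    rw [charFunDual_apply, hvar] at this
    rw [this]
  calc ∫ x, Complex.exp (L x) * Complex.exp (M x * Complex.I) ∂ν
      = ∫ x, Complex.exp ((1 + a * Complex.I) * L x) * Complex.exp (R x * Complex.I) ∂ν := by
        congr 1; ext x
        rw [← Complex.exp_add, ← Complex.exp_add]
        congr 1
        rw [hR]
        simp
        ring
    _ = (∫ x, Complex.exp ((1 + a * Complex.I) * L x) ∂ν) *
          ∫ x, Complex.exp (R x * Complex.I) ∂ν := by
        refine IndepFun.integral_fun_mul_eq_mul_integral ?_ ?_ ?_
        · exact hind.comp (φ := fun s : ℝ => Complex.exp ((1 + a * Complex.I) * s))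
            (ψ := fun s : ℝ => Complex.exp (s * Complex.I)) (by fun_prop) (by fun_prop)
        · exact Measurable.aestronglyMeasurable (by fun_prop)
        · exact Measurable.aestronglyMeasurable (by fun_prop)
    _ = _ := by
        rw [h1, h3, ← Complex.exp_add, ha, hRR]
        congr 1
        push_cast
        ring_nf
        simp only [Complex.I_sq]
        ring

/-- Cameron-Martin formula, checked on characteristic functions. Here `L d` is the variance of `L`,
and the covariance may be singular. -/
theorem map_const_add_eq_withDensity {ν : Measure E} [IsGaussian ν] (hν : ν[id] = 0)
    {L : StrongDual ℝ E} {d : E} (hd : ∀ M : StrongDual ℝ E, M d = covarianceBilinDual ν L M) :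
    ν.map (fun x => d + x) =
      ν.withDensity fun x => ENNReal.ofReal (Real.exp (L x - L d / 2)) := by
  have hexp : Integrable (fun x => Real.exp (L x - L d / 2)) ν := by
    have h : Integrable (fun x => Real.exp (1 * L x)) ν := by
      have := integrable_exp_mul_gaussianReal (μ := ν[L]) (v := Var[L; ν].toNNReal) 1
      rw [← IsGaussian.map_eq_gaussianReal, integrable_map_measure (by fun_prop) (by fun_prop)]
        at this
      exact this
    simp only [one_mul] at h
    simpa [sub_eq_add_neg, Real.exp_add] using h.mul_const _
  have hfin : IsFiniteMeasure
      (ν.withDensity fun x => ENNReal.ofReal (Real.exp (L x - L d / 2))) :=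
    isFiniteMeasure_withDensity_ofReal hexp.2
  refine Measure.ext_of_charFunDual ?_
  ext M
  rw [charFunDual_apply, charFunDual_apply, integral_map (by fun_prop) (by fun_prop),
    integral_withDensity_eq_integral_toReal_smul (by fun_prop) (by simp)]
  have h1 : ∫ x, Complex.exp (M (d + x) * Complex.I) ∂ν =
      Complex.exp (M d * Complex.I) * ∫ x, Complex.exp (M x * Complex.I) ∂ν := by
    rw [← integral_const_mul]
    congr 1; ext x
    rw [← Complex.exp_add, map_add]
    push_cast
    ring_nf
  have h2 : ∀ x, (ENNReal.ofReal (Real.exp (L x - L d / 2))).toReal •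
      Complex.exp (M x * Complex.I) = Complex.exp (-(L d / 2)) *
      (Complex.exp (L x) * Complex.exp (M x * Complex.I)) := by
    intro x
    rw [ENNReal.toReal_ofReal (Real.exp_pos _).le, Complex.real_smul, Complex.ofReal_exp]
    simp only [← Complex.exp_add]
    congr 1
    push_cast
    ring
  have h3 := integral_exp_mul_cexp_gaussian hν 0 M
  simp only [FunLike.coe_zero, Pi.zero_apply, Complex.ofReal_zero, Complex.exp_zero, one_mul,
    map_zero, zero_div, zero_mul, zero_add, zero_sub] at h3
  simp_rw [h2]
  rw [h1, h3, integral_const_mul, integral_exp_mul_cexp_gaussian hν L M, ← Complex.exp_add,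
    ← Complex.exp_add, hd, hd]
  congr 1
  ring

variable {X : Type*} [MeasurableSpace X]

theorem map_shear_eq_withDensity (ρ : Measure X) [IsProbabilityMeasure ρ] {ν : Measure E}
    [IsGaussian ν] (hν : ν[id] = 0) {L : X → StrongDual ℝ E} {d : X → E} (hdm : Measurable d)
    (hL : Measurable fun p : X × E => L p.1 p.2)
    (hd : ∀ x (M : StrongDual ℝ E), M (d x) = covarianceBilinDual ν (L x) M) :
    (ρ.prod ν).map (shear d) = (ρ.prod ν).withDensity
      fun p => ENNReal.ofReal (Real.exp (L p.1 p.2 - L p.1 (d p.1) / 2)) := by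
  have hLd : Measurable fun x => L x (d x) := hL.comp (measurable_id.prodMk hdm)
  refine Measure.ext_of_lintegral _ fun f hf => ?_
  rw [lintegral_map hf (measurable_shear hdm),
    lintegral_withDensity_eq_lintegral_mul _ (by fun_prop) hf,
    lintegral_prod (fun p => f (shear d p)) (hf.comp (measurable_shear hdm)).aemeasurable,
    lintegral_prod _ (by fun_prop)]
  refine lintegral_congr fun x => ?_
  have h := map_const_add_eq_withDensity hν (hd x)
  have h2 : ∫⁻ z, f (shear d (x, z)) ∂ν = ∫⁻ z, f (x, z) ∂(ν.map fun z => d x + z) := by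
    rw [lintegral_map (by fun_prop) (by fun_prop)]
    rfl
  rw [h2, h, lintegral_withDensity_eq_lintegral_mul _ (by fun_prop) (by fun_prop)]
  rfl

/-- The divergence of a family of translates of `P` from a centered Gaussian law. -/
theorem klDiv_map_shear_prod (ρ : Measure X) [IsProbabilityMeasure ρ] {P ν : Measure E}
    [IsProbabilityMeasure P] [IsGaussian ν] (hν : ν[id] = 0) (hPi : Integrable id P)
    (hP : P[id] = 0) {L : X → StrongDual ℝ E} {d : X → E} (hdm : Measurable d)
    (hL : Measurable fun p : X × E => L p.1 p.2)
    (hd : ∀ x (M : StrongDual ℝ E), M (d x) = covarianceBilinDual ν (L x) M)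
    (hint : Integrable (fun p : X × E => L p.1 p.2) (ρ.prod P))
    (hq : Integrable (fun x => L x (d x)) ρ) :
    klDiv ((ρ.prod P).map (shear d)) (ρ.prod ν) =
      klDiv P ν + ENNReal.ofReal ((∫ x, L x (d x) ∂ρ) / 2) := by
  have hsm := measurable_shear (X := X) hdm
  have hLd : Measurable fun x => L x (d x) := hL.comp (measurable_id.prodMk hdm)
  have hnn (x : X) : 0 ≤ L x (d x) := by rw [hd]; exact covarianceBilinDual_self_nonneg _
  have hprob1 : IsProbabilityMeasure ((ρ.prod P).map (shear d)) :=
    Measure.isProbabilityMeasure_map hsm.aemeasurable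
  have hprob2 : IsProbabilityMeasure ((ρ.prod ν).map (shear d)) :=
    Measure.isProbabilityMeasure_map hsm.aemeasurable
  set l : X × E → ℝ := fun p => L p.1 p.2 - L p.1 (d p.1) / 2 with hl
  have hlm : Measurable l := by fun_prop
  have hcomp : (fun p => l (shear d p)) =
      fun p : X × E => L p.1 p.2 + L p.1 (d p.1) / 2 := by
    ext p; simp only [hl, shear, map_add]; ring
  have hq' : Integrable (fun p : X × E => L p.1 (d p.1) / 2) (ρ.prod P) :=
    (hq.div_const 2).comp_fst P
  have hint' : Integrable l ((ρ.prod P).map (shear d)) := by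
    rw [integrable_map_measure hlm.aestronglyMeasurable hsm.aemeasurable]
    change Integrable (fun p => l (shear d p)) _
    rw [hcomp]
    exact hint.add hq'
  -- After the shift the log-density is L z + L d / 2, and the first term integrates to zero because
  -- `P` is centred.
  have hval : ∫ p, l p ∂((ρ.prod P).map (shear d)) = (∫ x, L x (d x) ∂ρ) / 2 := by
    rw [integral_map hsm.aemeasurable hlm.aestronglyMeasurable, hcomp, integral_add hint hq',
      integral_prod _ hint]
    have h0 (x : X) : ∫ z, L x z ∂P = 0 := by
      have := (L x).integral_comp_comm hPi
      simp only [id_eq] at this hP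
      rw [this, hP, map_zero]
    simp only [h0, integral_zero, zero_add]
    rw [integral_fun_fst (μ := ρ) (ν := P) (fun x => L x (d x) / 2)]
    simp [integral_div]
  have hmain := klDiv_eq_add_of_withDensity_exp hlm
    (map_shear_eq_withDensity ρ hν hdm hL hd) hint'
    (by rw [hval]; exact div_nonneg (integral_nonneg hnn) (by norm_num))
  rw [hmain, hval, klDiv_map_eq_of_leftInverse hsm (measurable_shear hdm.neg)
    (shear_leftInverse d), klDiv_prod_left]

/-- The mean of a law that is absolutely continuous with respect to a centered Gaussian law is
represented by its covariance. -/
theorem exists_covarianceBilinDual_eq_mean {P ν : Measure E} [IsProbabilityMeasure P]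
    [IsGaussian ν] (hν : ν[id] = 0) (hPi : Integrable id P) (hac : P ≪ ν) :
    ∃ L : StrongDual ℝ E, ∀ M : StrongDual ℝ E, M (P[id]) = covarianceBilinDual ν L M := by
  have : FiniteDimensional ℝ (StrongDual ℝ E) :=
    LinearEquiv.finiteDimensional (LinearMap.toContinuousLinearMap (𝕜 := ℝ) (E := E) (F' := ℝ))
  let B : StrongDual ℝ E →ₗ[ℝ] Module.Dual ℝ (StrongDual ℝ E) :=
    (covarianceBilinDual ν).toBilinForm
  let f : Module.Dual ℝ (StrongDual ℝ E) :=
    { toFun := fun M => M (P[id])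
      map_add' := fun _ _ => rfl
      map_smul' := fun _ _ => rfl }
  -- A functional in the kernel of the covariance vanishes ν-almost surely, hence P-almost surely,
  -- so it annihilates the mean of `P`.
  obtain ⟨L, hL⟩ := exists_bilin_eq_of_forall_ker B f (fun M hM => by
    have hMM : Var[M; ν] = 0 := by
      rw [← covarianceBilinDual_self_eq_variance IsGaussian.memLp_two_id]
      exact hM M
    have hM0 : ∀ᵐ x ∂ν, M x = 0 := by
      have := ae_eq_integral_of_variance_eq_zero
        (IsGaussian.memLp_dual ν M 2 (by norm_num)) hMM
      filter_upwards [this] with x hx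
      rw [hx, IsGaussian.integral_dual]
      simp only [id_eq] at hν
      simp [hν]
    change M (P[id]) = 0
    rw [← M.integral_comp_comm hPi]
    exact integral_eq_zero_of_ae (hac.ae_le hM0))
  exact ⟨L, fun M => by
    have := LinearMap.congr_fun hL M
    exact this.symm⟩

end CameronMartin

/-! ### Conditional laws that are translates of a fixed law -/

section Shift

variable {X E : Type*} [MeasurableSpace X] [NormedAddCommGroup E]
  [MeasurableSpace E] [BorelSpace E] [SecondCountableTopology E]

/-- The kernel sending `x` to the translate of `ν` by `h x`. -/
def shiftKernel {h : X → E} (hh : Measurable h) (ν : Measure E) [SFinite ν] : Kernel X E where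
  toFun x := ν.map fun z => h x + z
  measurable' := by
    refine Measure.measurable_of_measurable_coe _ fun s hs => ?_
    have hm : Measurable fun p : X × E => h p.1 + p.2 := (hh.comp measurable_fst).add measurable_snd
    have h1 : ∀ x, (ν.map fun z => h x + z) s =
        ν (Prod.mk x ⁻¹' ((fun p : X × E => h p.1 + p.2) ⁻¹' s)) :=
      fun x => Measure.map_apply (measurable_const_add (h x)) hs
    simp_rw [h1]
    exact measurable_measure_prodMk_left (hm hs)

theorem shiftKernel_apply {h : X → E} (hh : Measurable h) (ν : Measure E) [SFinite ν] (x : X) :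
    shiftKernel hh ν x = ν.map fun z => h x + z := rfl

instance {h : X → E} (hh : Measurable h) (ν : Measure E) [IsProbabilityMeasure ν] :
    IsMarkovKernel (shiftKernel hh ν) :=
  ⟨fun x => by
    rw [shiftKernel_apply]
    exact Measure.isProbabilityMeasure_map (measurable_const_add (h x)).aemeasurable⟩

theorem compProd_shiftKernel (ρ : Measure X) [SFinite ρ] {h : X → E} (hh : Measurable h)
    (ν : Measure E) [IsProbabilityMeasure ν] :
    ρ ⊗ₘ shiftKernel hh ν = (ρ.prod ν).map (shear h) := by
  refine Measure.ext_of_lintegral _ fun f hf => ?_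
  rw [Measure.lintegral_compProd hf, lintegral_map hf (measurable_shear hh),
    lintegral_prod (fun p => f (shear h p)) (hf.comp (measurable_shear hh)).aemeasurable]
  refine lintegral_congr fun x => ?_
  rw [shiftKernel_apply, lintegral_map (by fun_prop) (measurable_const_add (h x))]
  rfl

variable {Ω : Type*} [MeasurableSpace Ω] {P : Measure Ω} [IsProbabilityMeasure P]

/-- Together with `condDistrib_ae_eq_shift_iff` this turns a statement about a conditional law into
independence of a residual and the value of its law. -/
theorem map_prodMk_eq_shear_iff {Z : Ω → X} {F : Ω → E} (hZ : Measurable Z) (hF : Measurable F)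
    {h : X → E} (hh : Measurable h) (ν : Measure E) [IsProbabilityMeasure ν] :
    P.map (fun ω => (Z ω, F ω)) = ((P.map Z).prod ν).map (shear h) ↔
      IndepFun Z (fun ω => F ω - h (Z ω)) P ∧ P.map (fun ω => F ω - h (Z ω)) = ν := by
  have hR : Measurable fun ω => F ω - h (Z ω) := hF.sub (hh.comp hZ)
  have hprob : IsProbabilityMeasure (P.map Z) := Measure.isProbabilityMeasure_map hZ.aemeasurable
  have h1 : P.map (fun ω => (Z ω, F ω)) =
      (P.map fun ω => (Z ω, F ω - h (Z ω))).map (shear h) := by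
    rw [Measure.map_map (measurable_shear hh) (hZ.prodMk hR)]
    congr 1; ext ω <;> simp [shear]
  have h2 : P.map (fun ω => (Z ω, F ω - h (Z ω))) = (P.map Z).prod ν ↔
      IndepFun Z (fun ω => F ω - h (Z ω)) P ∧ P.map (fun ω => F ω - h (Z ω)) = ν := by
    rw [indepFun_iff_map_prod_eq_prod_map_map hZ.aemeasurable hR.aemeasurable]
    constructor
    · intro heq
      have h3 : P.map (fun ω => F ω - h (Z ω)) = ν := by
        have := congrArg (fun Q : Measure (X × E) => Q.map Prod.snd) heq
        simp only [Measure.map_snd_prod, measure_univ, one_smul] at this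
        rwa [Measure.map_map measurable_snd (hZ.prodMk hR)] at this
      exact ⟨by rw [heq, h3], h3⟩
    · rintro ⟨heq, h3⟩
      rw [heq, h3]
  rw [← h2, h1]
  constructor
  · intro heq
    have h3 (Q : Measure (X × E)) : (Q.map (shear h)).map (shear fun x => -h x) = Q := by
      rw [Measure.map_map (measurable_shear hh.fun_neg) (measurable_shear hh),
        (shear_leftInverse _).comp_eq_id, Measure.map_id]
    rw [← h3 (P.map _), heq, h3]
  · intro heq
    rw [heq]

variable [CompleteSpace E]

theorem condDistrib_ae_eq_shift_iff {Z : Ω → X} {F : Ω → E} (hF : Measurable F)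
    {h : X → E} (hh : Measurable h) (ν : Measure E) [IsProbabilityMeasure ν] :
    (∀ᵐ x ∂(P.map Z), condDistrib F Z P x = ν.map fun z => h x + z) ↔
      P.map (fun ω => (Z ω, F ω)) = ((P.map Z).prod ν).map (shear h) := by
  rw [← compProd_shiftKernel _ hh, ← condDistrib_ae_eq_iff_measure_eq_compProd Z hF.aemeasurable]
  rfl

end Shift

/-! ### Regression for jointly Gaussian vectors -/

section Regression

variable {E F : Type*} [NormedAddCommGroup E] [NormedSpace ℝ E] [FiniteDimensional ℝ E]
  [MeasurableSpace E] [BorelSpace E] [NormedAddCommGroup F] [NormedSpace ℝ F]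
  [FiniteDimensional ℝ F] [MeasurableSpace F] [BorelSpace F]

/-- The normal equations are solvable even for a singular covariance of the regressor: a functional
of zero variance is uncorrelated with everything. -/
theorem exists_dual_regression (J : Measure (E × F)) (N : StrongDual ℝ F) :
    ∃ L : StrongDual ℝ E, ∀ M : StrongDual ℝ E,
      covarianceBilinDual J (N.comp (.snd ℝ E F) - L.comp (.fst ℝ E F))
        (M.comp (.fst ℝ E F)) = 0 := by
  have : FiniteDimensional ℝ (StrongDual ℝ E) :=
    LinearEquiv.finiteDimensional (LinearMap.toContinuousLinearMap (𝕜 := ℝ) (E := E) (F' := ℝ))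
  let i : StrongDual ℝ E →ₗ[ℝ] StrongDual ℝ (E × F) :=
    { toFun := fun M => M.comp (.fst ℝ E F)
      map_add' := fun _ _ => rfl
      map_smul' := fun _ _ => rfl }
  let B : StrongDual ℝ E →ₗ[ℝ] Module.Dual ℝ (StrongDual ℝ E) :=
    ((covarianceBilinDual J).toBilinForm).compl₁₂ i i
  let f : Module.Dual ℝ (StrongDual ℝ E) :=
    ((covarianceBilinDual J).toBilinForm (N.comp (.snd ℝ E F))).comp i
  obtain ⟨L, hL⟩ := exists_bilin_eq_of_forall_ker B f (fun M hM => by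
    change covarianceBilinDual J (N.comp (.snd ℝ E F)) (M.comp (.fst ℝ E F)) = 0
    rw [covarianceBilinDual_comm]
    exact covarianceBilinDual_eq_zero_of_self_eq_zero (hM M) _)
  refine ⟨L, fun M => ?_⟩
  have h := LinearMap.congr_fun hL M
  change covarianceBilinDual J (L.comp (.fst ℝ E F)) (M.comp (.fst ℝ E F)) =
    covarianceBilinDual J (N.comp (.snd ℝ E F)) (M.comp (.fst ℝ E F)) at h
  rw [map_sub, _root_.sub_apply, h, sub_self]

/-- Jointly Gaussian vectors: the residual of a linear regression is independent of the
regressor. -/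
theorem exists_regression (J : Measure (E × F)) [IsGaussian J] :
    ∃ A : E →L[ℝ] F, IndepFun Prod.fst (fun p => p.2 - A p.1) J := by
  let b := Module.finBasis ℝ F
  let N (k : Fin (Module.finrank ℝ F)) : StrongDual ℝ F := (b.coord k).toContinuousLinearMap
  choose L hL using fun k => exists_dual_regression J (N k)
  let A : E →L[ℝ] F := ∑ k, (L k).smulRight (b k)
  refine ⟨A, ?_⟩
  have hjoint : HasGaussianLaw (fun p : E × F => (p.1, p.2 - A p.1)) J :=
    (IsGaussian.hasGaussianLaw_id (μ := J)).map_fun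
      ((ContinuousLinearMap.fst ℝ E F).prod
        (.snd ℝ E F - A.comp (.fst ℝ E F)))
  refine hjoint.indepFun_of_covariance_strongDual fun M M' => ?_
  have h2 : MemLp id 2 J := IsGaussian.memLp_two_id
  have h := covarianceBilinDual_eq_covariance h2
    (M.comp (.fst ℝ E F)) (M'.comp (.snd ℝ E F - A.comp (.fst ℝ E F)))
  change cov[M.comp (.fst ℝ E F), M'.comp (.snd ℝ E F - A.comp (.fst ℝ E F)); J] = 0
  rw [← h, covarianceBilinDual_comm]
  have hM' : M'.comp (.snd ℝ E F - A.comp (.fst ℝ E F)) =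
      ∑ k, M' (b k) • ((N k).comp (.snd ℝ E F) - (L k).comp (.fst ℝ E F)) := by
    refine ContinuousLinearMap.ext fun p => ?_
    have h1 : p.2 = ∑ k, b.coord k p.2 • b k := (b.sum_repr p.2).symm
    have h2 : M' p.2 = ∑ k, b.coord k p.2 * M' (b k) := by
      have := congrArg M' h1
      simpa only [map_sum, map_smul, smul_eq_mul] using this
    simp only [ContinuousLinearMap.comp_apply, _root_.sub_apply, ContinuousLinearMap.coe_fst',
      ContinuousLinearMap.coe_snd', map_sub, h2, A, N, _root_.sum_apply, _root_.smul_apply,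
      ContinuousLinearMap.smulRight_apply, map_sum, map_smul, smul_eq_mul,
      LinearMap.coe_toContinuousLinearMap', ← Finset.sum_sub_distrib]
    refine Finset.sum_congr rfl fun k _ => ?_
    ring
  rw [hM', map_sum, _root_.sum_apply]
  refine Finset.sum_eq_zero fun k _ => ?_
  rw [map_smul, _root_.smul_apply, hL, smul_zero]

variable {Ω : Type*} [MeasurableSpace Ω] {P : Measure Ω}

theorem exists_map_eq_shear {Z : Ω → E} {W : Ω → F} (hZ : Measurable Z) (hW : Measurable W)
    (hJ : HasGaussianLaw (fun ω => (Z ω, W ω)) P) :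
    ∃ (A : E →L[ℝ] F) (ν : Measure F), IsGaussian ν ∧
      P.map (fun ω => (Z ω, W ω)) = ((P.map Z).prod ν).map (shear A) := by
  have := hJ.isProbabilityMeasure
  have hJ' := hJ.isGaussian_map
  obtain ⟨A, hA⟩ := exists_regression (P.map fun ω => (Z ω, W ω))
  have hR : HasGaussianLaw (fun ω => W ω - A (Z ω)) P :=
    hJ.map_fun (.snd ℝ E F - A.comp (.fst ℝ E F))
  have := hR.isGaussian_map
  refine ⟨A, P.map fun ω => W ω - A (Z ω), inferInstance, ?_⟩
  rw [map_prodMk_eq_shear_iff hZ hW (by fun_prop)]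
  refine ⟨?_, rfl⟩
  have hm : Measurable fun p : E × F => p.2 - A p.1 := by fun_prop
  rw [indepFun_iff_map_prod_eq_prod_map_map (by fun_prop) hm.aemeasurable,
    Measure.map_map (by fun_prop) (by fun_prop), Measure.map_map (by fun_prop) (by fun_prop),
    Measure.map_map hm (by fun_prop)] at hA
  rw [indepFun_iff_map_prod_eq_prod_map_map (by fun_prop) (by fun_prop)]
  exact hA

end Regression

/-! ### Gaussian vectors -/

section GaussianVec

variable {ι : Type*} [Fintype ι]

/-- The functional `x ↦ w ⬝ᵥ x`. -/
def dotL (w : ι → ℝ) : StrongDual ℝ (ι → ℝ) := ∑ i, w i • ContinuousLinearMap.proj i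

theorem dotL_apply (w x : ι → ℝ) : dotL w x = w ⬝ᵥ x := by
  simp [dotL, dotProduct]

theorem exists_eq_dotL [DecidableEq ι] (L : StrongDual ℝ (ι → ℝ)) : ∃ w, L = dotL w := by
  refine ⟨fun i => L (Pi.single i 1), ContinuousLinearMap.ext fun x => ?_⟩
  rw [dotL_apply, dotProduct, ← ContinuousLinearMap.coe_coe, LinearMap.pi_apply_eq_sum_univ]
  refine Finset.sum_congr rfl fun i _ => ?_
  rw [smul_eq_mul, mul_comm]
  congr 2
  ext j
  simp [Pi.single_apply, eq_comm]

variable [DecidableEq ι]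

theorem gaussianVec_eq_map (m : ι → ℝ) (S : Matrix ι ι ℝ) :
    gaussianVec m S = (gaussianVec 0 S).map fun x => m + x := by
  simp only [gaussianVec, multivariateGaussian]
  rw [Measure.map_map (by fun_prop) (by fun_prop), Measure.map_map (by fun_prop) (by fun_prop),
    Measure.map_map (by fun_prop) (by fun_prop)]
  congr 1
  ext x
  simp

theorem gaussianVec_eq_map_equiv (m : ι → ℝ) (S : Matrix ι ι ℝ) :
    gaussianVec m S = (multivariateGaussian (WithLp.toLp 2 m) S).map
      (PiLp.continuousLinearEquiv 2 ℝ fun _ : ι => ℝ) := rfl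

instance (m : ι → ℝ) (S : Matrix ι ι ℝ) : IsGaussian (gaussianVec m S) := by
  rw [gaussianVec_eq_map_equiv]
  infer_instance

theorem integral_id_gaussianVec (m : ι → ℝ) (S : Matrix ι ι ℝ) : (gaussianVec m S)[id] = m := by
  rw [gaussianVec_eq_map_equiv, integral_map (by fun_prop) (by fun_prop)]
  simp only [id_eq]
  rw [ContinuousLinearEquiv.integral_comp_comm, integral_id_multivariateGaussian]
  rfl

theorem covarianceBilinDual_gaussianVec (m : ι → ℝ) {S : Matrix ι ι ℝ} (hS : S.PosSemidef)
    (w : ι → ℝ) (M : StrongDual ℝ (ι → ℝ)) :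
    covarianceBilinDual (gaussianVec m S) (dotL w) M = M (S *ᵥ w) := by
  obtain ⟨v, rfl⟩ := exists_eq_dotL M
  rw [covarianceBilinDual_eq_covariance IsGaussian.memLp_two_id, gaussianVec,
    covariance_map (by fun_prop) (by fun_prop) (by fun_prop)]
  have h (w : ι → ℝ) : (dotL w) ∘ WithLp.ofLp =
      fun u : EuclideanSpace ℝ ι => inner ℝ (WithLp.toLp 2 w) u := by
    ext u
    simp [dotL_apply, PiLp.inner_apply, dotProduct, mul_comm]
  rw [h, h, ← covarianceBilin_apply_eq_cov IsGaussian.memLp_two_id,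
    covarianceBilin_multivariateGaussian hS, dotL_apply]
  simp only
  rw [dotProduct_mulVec, ← mulVec_transpose, dotProduct_comm]
  congr 2
  have := hS.isHermitian
  rwa [Matrix.IsHermitian, conjTranspose_eq_transpose_of_trivial] at this

theorem exists_eq_gaussianVec (ν : Measure (ι → ℝ)) [IsGaussian ν] :
    ∃ m S, S.PosSemidef ∧ ν = gaussianVec m S := by
  let e := (PiLp.continuousLinearEquiv 2 ℝ fun _ : ι => ℝ)
  let ν' := ν.map e.symm
  let S : Matrix ι ι ℝ := Matrix.of fun i j => cov[fun x => x i, fun x => x j; ν]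
  have hL (i : ι) : MemLp (fun x : ι → ℝ => x i) 2 ν :=
    IsGaussian.memLp_dual ν (ContinuousLinearMap.proj i) 2 (by norm_num)
  have hc (x y : EuclideanSpace ℝ ι) : covarianceBilin ν' x y = x.ofLp ⬝ᵥ S *ᵥ y.ofLp := by
    have h := covarianceBilin_apply_pi (μ := ν) (X := fun i x => x i) hL x y
    refine h.trans ?_
    simp only [dotProduct, mulVec, Finset.mul_sum, S, Matrix.of_apply]
    refine Finset.sum_congr rfl fun i _ => Finset.sum_congr rfl fun j _ => ?_
    ring
  have hS : S.PosSemidef := by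
    refine Matrix.PosSemidef.of_dotProduct_mulVec_nonneg ?_ fun x => ?_
    · ext i j
      simp [S, covariance_comm]
    · have := covarianceBilin_self_nonneg (μ := ν') (WithLp.toLp 2 x)
      rw [hc] at this
      simpa using this
  refine ⟨ν[id], S, hS, ?_⟩
  have h : ν' = multivariateGaussian (WithLp.toLp 2 ν[id]) S := by
    refine IsGaussian.ext ?_ ?_
    · rw [integral_id_multivariateGaussian', integral_map (by fun_prop) (by fun_prop)]
      simp only [id_eq]
      rw [ContinuousLinearEquiv.integral_comp_comm]
      rfl
    · ext x y
      rw [hc, covarianceBilin_multivariateGaussian hS]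
  rw [gaussianVec_eq_map_equiv, ← h, Measure.map_map (by fun_prop) (by fun_prop)]
  simp [e]

/-- The mean must lie in the Cameron-Martin space of N(0, S), which is the range of `S`. -/
theorem exists_eq_mulVec_of_absolutelyContinuous {D : ι → ℝ} {S S' : Matrix ι ι ℝ}
    (hS : S.PosSemidef) (hac : gaussianVec D S' ≪ gaussianVec 0 S) : ∃ w, D = S *ᵥ w := by
  obtain ⟨L, hL⟩ := exists_covarianceBilinDual_eq_mean (integral_id_gaussianVec 0 S)
    (IsGaussian.integrable_id) hac
  obtain ⟨w, rfl⟩ := exists_eq_dotL L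
  refine ⟨w, ?_⟩
  funext i
  have := hL (ContinuousLinearMap.proj i)
  rwa [integral_id_gaussianVec, covarianceBilinDual_gaussianVec 0 hS] at this

end GaussianVec

/-! ### Laws that are stable under normalized sums -/

section Stable

/-- Iterating the equation n times writes the characteristic function as that of a normalized sum of
2^n independent copies, which tends to the Gaussian one by the central limit theorem. Variance zero
is split off because of the normalization by the standard deviation. -/
theorem exists_eq_gaussianReal_of_charFun_sq {Q : Measure ℝ} [IsProbabilityMeasure Q]
    (h2 : MemLp id 2 Q) (h0 : Q[id] = 0)
    (h : ∀ t, charFun Q t = charFun Q ((√2)⁻¹ * t) ^ 2) : ∃ v, Q = gaussianReal 0 v := by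
  have hpow (n : ℕ) (t : ℝ) : charFun Q t = charFun Q ((√((2 ^ n : ℕ) : ℝ))⁻¹ * t) ^ (2 ^ n) := by
    induction n with
    | zero => simp
    | succ n ih =>
      rw [ih, h, ← pow_mul, ← mul_assoc, ← mul_inv, ← Real.sqrt_mul (by norm_num)]
      push_cast
      rw [pow_succ, mul_comm 2 (2 ^ n : ℕ), mul_comm (2 : ℝ), pow_succ 2 n]
  by_cases hv : Var[id; Q] = 0
  · refine ⟨0, ?_⟩
    have := ae_eq_integral_of_variance_eq_zero h2 hv
    rw [gaussianReal_zero_var]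
    have h3 : Q.map id = Q.map fun _ => (0 : ℝ) := by
      refine Measure.map_congr ?_
      filter_upwards [this] with x hx
      rw [hx, h0]
    rwa [Measure.map_id, Measure.map_const, measure_univ, one_smul] at h3
  · have hvpos : 0 < Var[id; Q] := lt_of_le_of_ne (variance_nonneg _ _) (Ne.symm hv)
    set s := √Var[id; Q] with hs
    have hspos : 0 < s := Real.sqrt_pos.2 hvpos
    refine ⟨Var[id; Q].toNNReal, Measure.ext_of_charFun ?_⟩
    ext t
    rw [charFun_gaussianReal]
    have hX : AEMeasurable (fun x : ℝ => s⁻¹ * x) Q := by fun_prop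
    have hXm : ∫ x, s⁻¹ * x ∂Q = 0 := by
      simp only [id_eq] at h0
      rw [integral_const_mul, h0, mul_zero]
    have hX2 : Q[(fun x : ℝ => s⁻¹ * x) ^ 2] = 1 := by
      have hvar := variance_of_integral_eq_zero (μ := Q) (X := id) (by fun_prop) h0
      simp only [Pi.pow_apply, mul_pow]
      rw [integral_const_mul]
      have : ∫ x, x ^ 2 ∂Q = s ^ 2 := by
        rw [hs, Real.sq_sqrt hvpos.le, hvar]
        rfl
      rw [this]
      field_simp
    have hlim := tendsto_charFun_inv_sqrt_mul_pow (P := Q) hX hXm hX2 (s * t)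
    have hlim2 := hlim.comp (tendsto_pow_atTop_atTop_of_one_lt (one_lt_two (α := ℕ)))
    have hconst : ∀ n : ℕ, (charFun (Q.map fun x => s⁻¹ * x)
        ((√((2 ^ n : ℕ) : ℝ))⁻¹ * (s * t))) ^ (2 ^ n) = charFun Q t := by
      intro n
      rw [hpow n t, charFun_map_mul]
      congr 2
      field_simp
    have hlim3 : Tendsto (fun _ : ℕ => charFun Q t) atTop
        (𝓝 (Complex.exp (-((s * t : ℝ) : ℂ) ^ 2 / 2))) := by
      refine hlim2.congr fun n => ?_
      exact hconst n
    rw [tendsto_nhds_unique tendsto_const_nhds hlim3]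
    congr 1
    rw [Real.coe_toNNReal _ hvpos.le]
    have : ((s * t : ℝ) : ℂ) ^ 2 = (Var[id; Q] : ℂ) * t ^ 2 := by
      rw [← Complex.ofReal_pow, mul_pow, hs, Real.sq_sqrt hvpos.le]
      push_cast; ring
    rw [this]
    push_cast
    ring

variable {E : Type*} [NormedAddCommGroup E] [NormedSpace ℝ E] [FiniteDimensional ℝ E]
  [MeasurableSpace E] [BorelSpace E]

theorem isGaussian_of_map_normalized_add {Q : Measure E} [IsProbabilityMeasure Q]
    (h2 : MemLp id 2 Q) (h0 : Q[id] = 0)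
    (h : (Q.prod Q).map (fun p => (√2)⁻¹ • (p.1 + p.2)) = Q) : IsGaussian Q := by
  refine isGaussian_of_map_eq_gaussianReal fun L => ?_
  have hint : Integrable id Q := h2.integrable (by norm_num)
  have : IsProbabilityMeasure (Q.map L) := Measure.isProbabilityMeasure_map (by fun_prop)
  obtain ⟨v, hv⟩ := exists_eq_gaussianReal_of_charFun_sq (Q := Q.map L) (by
      rw [memLp_map_measure_iff (by fun_prop) (by fun_prop)]
      exact L.comp_memLp' h2) (by
      rw [integral_map (by fun_prop) (by fun_prop)]
      have := L.integral_comp_comm hint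
      simp only [id_eq] at this h0 ⊢
      rw [this, h0, map_zero]) (fun t => by
      have hL (s : ℝ) : charFun (Q.map L) s = charFunDual Q (s • L) :=
        charFun_map_eq_charFunDual_smul L s
      rw [hL, hL]
      conv_lhs => rw [← h]
      rw [charFunDual_apply, integral_map (by fun_prop) (by fun_prop), sq, charFunDual_apply,
        ← integral_prod_mul]
      congr 1
      ext p
      rw [← Complex.exp_add]
      congr 1
      simp only [map_smul, map_add, smul_eq_mul, FunLike.coe_smul, Pi.smul_apply]
      push_cast
      ring)
  exact ⟨0, v, hv⟩

end Stable

/-! ### Causality in terms of innovations -/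

/-- If `g - A k` is independent of `k`, then `f` and `g` are conditionally independent given `k`
exactly if `g - A k` is independent of `(k, f)`. -/
theorem condIndepFun_comap_iff_indepFun_sub {Ω X Y E : Type*} [MeasurableSpace Ω]
    [StandardBorelSpace Ω] [MeasurableSpace X] [MeasurableSpace Y] [StandardBorelSpace Y]
    [Nonempty Y] [NormedAddCommGroup E] [CompleteSpace E] [MeasurableSpace E] [BorelSpace E]
    [SecondCountableTopology E] {P : Measure Ω} [IsProbabilityMeasure P] {k : Ω → X} {f : Ω → Y}
    {g : Ω → E} {A : X → E} (hk : Measurable k) (hf : Measurable f) (hg : Measurable g)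
    (hA : Measurable A) (hind : IndepFun k (fun ω => g ω - A (k ω)) P) :
    CondIndepFun (MeasurableSpace.comap k inferInstance) hk.comap_le f g P ↔
      IndepFun (fun ω => (k ω, f ω)) (fun ω => g ω - A (k ω)) P := by
  have hR : Measurable fun ω => g ω - A (k ω) := hg.sub (hA.comp hk)
  set ν := P.map fun ω => g ω - A (k ω) with hν
  have : IsProbabilityMeasure ν := Measure.isProbabilityMeasure_map hR.aemeasurable
  have h1 : ∀ᵐ x ∂(P.map k), condDistrib g k P x = ν.map fun z => A x + z :=
    (condDistrib_ae_eq_shift_iff hg hA ν).2 ((map_prodMk_eq_shear_iff hk hg hA ν).2 ⟨hind, rfl⟩)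
  have h2 : ∀ᵐ x ∂(P.map fun ω => (k ω, f ω)),
      condDistrib g k P x.1 = ν.map fun z => A x.1 + z := by
    have : P.map k = (P.map fun ω => (k ω, f ω)).map Prod.fst := by
      rw [Measure.map_map measurable_fst (hk.prodMk hf)]; rfl
    rw [this] at h1
    exact ae_of_ae_map measurable_fst.aemeasurable h1
  -- Conditional independence means that the law of `g` given `(k, f)` is its law given `k`, which
  -- by `h2` is `ν` translated by `A k`.
  have h3 := condIndepFun_iff_condDistrib_prod_ae_eq_prodMkRight (μ := P) hg hf hk
  have h4 : (∀ᵐ x ∂(P.map fun ω => (k ω, f ω)),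
      condDistrib g (fun ω => (k ω, f ω)) P x = ν.map fun z => A x.1 + z) ↔
      IndepFun (fun ω => (k ω, f ω)) (fun ω => g ω - A (k ω)) P := by
    rw [condDistrib_ae_eq_shift_iff (h := fun x : X × Y => A x.1) hg (by fun_prop) ν,
      map_prodMk_eq_shear_iff (h := fun x : X × Y => A x.1) (hk.prodMk hf) hg (by fun_prop) ν]
    simp [hν]
  rw [← h4]
  refine h3.trans (eventually_congr ?_)
  filter_upwards [h2] with x hx
  rw [Kernel.prodMkRight_apply, hx]

section Innovation

variable {T : ℕ}

/-- `(u_{1:t}, y_{1:t})`. -/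
def past (t : Fin T) (z : Path T) : (UpTo t → ℝ) × (UpTo t → ℝ) := (upTo t z.1, upTo t z.2)

/-- The part of `u_{t+1:T}` that the gain `A` does not predict from `u_{1:t}`. -/
def innovation {t : Fin T} (A : (UpTo t → ℝ) →L[ℝ] (After t → ℝ)) (u : Fin T → ℝ) : After t → ℝ :=
  after t u - A (upTo t u)

/-- `u_{1:t}` as a continuous linear function of `u`. -/
def upToL (t : Fin T) : (Fin T → ℝ) →L[ℝ] (UpTo t → ℝ) :=
  .pi fun s => .proj (s : Fin T)

/-- `u_{t+1:T}` as a continuous linear function of `u`. -/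
def afterL (t : Fin T) : (Fin T → ℝ) →L[ℝ] (After t → ℝ) :=
  .pi fun s => .proj (s : Fin T)

/-- `u_{1:t-1}` as a continuous linear function of `u`. -/
def beforeL (t : Fin T) : (Fin T → ℝ) →L[ℝ] (Before t → ℝ) :=
  .pi fun s => .proj (s : Fin T)

/-- `(u_{1:t}, y_{1:t})` as a continuous linear function of `(u, y)`. -/
def pastL (t : Fin T) : Path T →L[ℝ] (UpTo t → ℝ) × (UpTo t → ℝ) :=
  ((upToL t).comp (.fst ℝ _ _)).prod ((upToL t).comp (.snd ℝ _ _))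

/-- The innovation as a continuous linear function of `u`. -/
def innovationL {t : Fin T} (A : (UpTo t → ℝ) →L[ℝ] (After t → ℝ)) :
    (Fin T → ℝ) →L[ℝ] (After t → ℝ) :=
  afterL t - A.comp (upToL t)

@[fun_prop] theorem measurable_upTo (t : Fin T) : Measurable (upTo t) := (upToL t).measurable

@[fun_prop] theorem measurable_after (t : Fin T) : Measurable (after t) := (afterL t).measurable

@[fun_prop] theorem measurable_before (t : Fin T) : Measurable (before t) := (beforeL t).measurable

@[fun_prop] theorem measurable_past (t : Fin T) : Measurable (past t) := (pastL t).measurable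

@[fun_prop] theorem measurable_innovation {t : Fin T} (A : (UpTo t → ℝ) →L[ℝ] (After t → ℝ)) :
    Measurable (innovation A) := (innovationL A).measurable

/-- The innovations with gains `A` are independent of the past. -/
def IsRegression (μ : Measure (Fin T → ℝ))
    (A : ∀ t : Fin T, (UpTo t → ℝ) →L[ℝ] (After t → ℝ)) : Prop :=
  ∀ t, IndepFun (upTo t) (innovation (A t)) μ

theorem exists_isRegression (μ : Measure (Fin T → ℝ)) [IsGaussian μ] :
    ∃ A : ∀ t : Fin T, (UpTo t → ℝ) →L[ℝ] (After t → ℝ), IsRegression μ A := by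
  have h (t : Fin T) : ∃ A : (UpTo t → ℝ) →L[ℝ] (After t → ℝ),
      IndepFun (upTo t) (innovation A) μ := by
    have hJ : HasGaussianLaw (fun u => (upTo t u, after t u)) μ :=
      (IsGaussian.hasGaussianLaw_id (μ := μ)).map_fun ((upToL t).prod (afterL t))
    obtain ⟨A, ν, _, hA⟩ := exists_map_eq_shear (by fun_prop) (by fun_prop) hJ
    rw [map_prodMk_eq_shear_iff (by fun_prop) (by fun_prop) (by fun_prop)] at hA
    exact ⟨A, hA.1⟩
  choose A hA using h
  exact ⟨A, hA⟩

variable {μ : Measure (Fin T → ℝ)} {A : ∀ t : Fin T, (UpTo t → ℝ) →L[ℝ] (After t → ℝ)}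

theorem IndepFun.of_map_fst {π : Measure (Path T)} {X Y : Type*} [MeasurableSpace X]
    [MeasurableSpace Y] {f : (Fin T → ℝ) → X} {g : (Fin T → ℝ) → Y} (hf : Measurable f)
    (hg : Measurable g) (h : IndepFun f g (π.map Prod.fst)) [IsFiniteMeasure π] :
    IndepFun (fun z : Path T => f z.1) (fun z : Path T => g z.1) π := by
  rw [indepFun_iff_map_prod_eq_prod_map_map (by fun_prop) (by fun_prop),
    Measure.map_map (by fun_prop) (by fun_prop), Measure.map_map (by fun_prop) (by fun_prop),
    Measure.map_map (by fun_prop) (by fun_prop)] at h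
  rw [indepFun_iff_map_prod_eq_prod_map_map (by fun_prop) (by fun_prop)]
  exact h

/-- The gains `A` depend on μ only, so conditional independence becomes ordinary independence of
quantities that do not depend on the coupling. -/
theorem mem_causalCouplings_iff (hA : IsRegression μ A) (π : ProbabilityMeasure (Path T)) :
    π ∈ causalCouplings μ ↔ (π : Measure (Path T)).map Prod.fst = μ ∧
      ∀ t, IndepFun (past t) (fun z => innovation (A t) z.1) (π : Measure (Path T)) := by
  refine and_congr_right fun h => forall_congr' fun t => ?_
  have hind : IndepFun (fun z : Path T => upTo t z.1)
      (fun z : Path T => after t z.1 - A t (upTo t z.1)) (π : Measure (Path T)) :=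
    IndepFun.of_map_fst (by fun_prop) (by fun_prop) (h ▸ hA t)
  exact condIndepFun_comap_iff_indepFun_sub (by fun_prop) (by fun_prop) (by fun_prop)
    (by fun_prop) hind

/-- The second factor involves μ instead of π, so both sides are linear in π; this is what makes the
constraint stable under midpoints and setwise limits. -/
theorem indepFun_past_innovation_iff {π : Measure (Path T)} [IsFiniteMeasure π]
    (h : π.map Prod.fst = μ) (t : Fin T) :
    IndepFun (past t) (fun z => innovation (A t) z.1) π ↔
      ∀ B C, MeasurableSet B → MeasurableSet C →
        π (past t ⁻¹' B ∩ (fun z => innovation (A t) z.1) ⁻¹' C) =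
          π (past t ⁻¹' B) * μ (innovation (A t) ⁻¹' C) := by
  rw [indepFun_iff_measure_inter_preimage_eq_mul]
  refine forall₄_congr fun B C hB hC => ?_
  rw [← h, Measure.map_apply measurable_fst (measurable_innovation _ hC)]
  rfl

theorem midpointLaw_mem_causalCouplings [IsGaussian μ] (P Q : ProbabilityMeasure (Path T))
    (hP : P ∈ causalCouplings μ)
    (hQ : Q ∈ causalCouplings μ) : midpointLaw P Q ∈ causalCouplings μ := by
  obtain ⟨A, hA⟩ := exists_isRegression μ
  rw [mem_causalCouplings_iff hA] at hP hQ ⊢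
  have hcoe : (midpointLaw P Q : Measure (Path T)) =
      (2⁻¹ : ℝ≥0∞) • ((P : Measure (Path T)) + (Q : Measure (Path T))) := rfl
  have hfst : (midpointLaw P Q : Measure (Path T)).map Prod.fst = μ := by
    rw [hcoe, Measure.map_smul, Measure.map_add _ _ measurable_fst, hP.1, hQ.1, ← two_smul ℝ≥0∞ μ,
      smul_smul, ENNReal.inv_mul_cancel (by norm_num) (by norm_num), one_smul]
  refine ⟨hfst, fun t => ?_⟩
  rw [indepFun_past_innovation_iff hfst]
  intro B C hB hC
  have h1 := (indepFun_past_innovation_iff hP.1 t).1 (hP.2 t) B C hB hC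
  have h2 := (indepFun_past_innovation_iff hQ.1 t).1 (hQ.2 t) B C hB hC
  rw [hcoe]
  simp only [Measure.smul_apply, Measure.add_apply, smul_eq_mul, h1, h2]
  ring

theorem mem_causalCouplings_of_tendsto [IsGaussian μ] (P : ℕ → ProbabilityMeasure (Path T))
    (R : ProbabilityMeasure (Path T)) (hP : ∀ n, P n ∈ causalCouplings μ)
    (h : ∀ A, MeasurableSet A →
      Tendsto (fun n => (P n : Measure (Path T)) A) atTop (𝓝 ((R : Measure (Path T)) A))) :
    R ∈ causalCouplings μ := by
  obtain ⟨A, hA⟩ := exists_isRegression μ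
  simp_rw [mem_causalCouplings_iff hA] at hP ⊢
  have hfst : (R : Measure (Path T)).map Prod.fst = μ := by
    ext B hB
    rw [Measure.map_apply measurable_fst hB]
    refine tendsto_nhds_unique (h _ (measurable_fst hB)) (tendsto_const_nhds.congr fun n => ?_)
    rw [← (hP n).1, Measure.map_apply measurable_fst hB]
  refine ⟨hfst, fun t => ?_⟩
  rw [indepFun_past_innovation_iff hfst]
  intro B C hB hC
  have hmB : MeasurableSet (past t ⁻¹' B) := measurable_past t hB
  have hmC : MeasurableSet ((fun z : Path T => innovation (A t) z.1) ⁻¹' C) :=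
    ((measurable_innovation (A t)).comp measurable_fst) hC
  refine tendsto_nhds_unique (h _ (hmB.inter hmC)) ?_
  simp_rw [fun n => (indepFun_past_innovation_iff (hP n).1 t).1 ((hP n).2 t) B C hB hC]
  exact ENNReal.Tendsto.mul_const (h _ hmB) (Or.inr (measure_ne_top _ _))

end Innovation

/-! ### Gaussianity of minimizers -/

section Gaussianity

variable {E : Type*} [NormedAddCommGroup E] [NormedSpace ℝ E] [FiniteDimensional ℝ E]
  [MeasurableSpace E] [BorelSpace E]

/-- Fernique's theorem for γ and the entropy inequality, applied to a small multiple of the squared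
norm. -/
theorem memLp_two_of_klDiv_ne_top {P γ : Measure E} [IsProbabilityMeasure P] [IsGaussian γ]
    (h : klDiv P γ ≠ ∞) : MemLp id 2 P := by
  obtain ⟨C, hC, hint⟩ := IsGaussian.exists_integrable_exp_sq γ
  have h1 := lintegral_ne_top_of_klDiv_ne_top h (g := fun x => C * ‖x‖ ^ 2) (by fun_prop) hint
  have h2 : Integrable (fun x : E => C * ‖x‖ ^ 2) P :=
    (lintegral_ofReal_ne_top_iff_integrable (by fun_prop)
      (.of_forall fun x => by positivity)).1 h1
  rw [memLp_two_iff_integrable_sq_norm (by fun_prop)]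
  simpa [hC.ne'] using h2.const_mul C⁻¹

/-- The price of the translation does not depend on the centred law `P`, so means drop out when
divergences of laws with a common mean are compared. -/
theorem klDiv_map_const_add {P ν : Measure E} [IsProbabilityMeasure P] [IsGaussian ν]
    (hν : ν[id] = 0) (hPi : Integrable id P) (hP : P[id] = 0) {L : StrongDual ℝ E} {d : E}
    (hd : ∀ M : StrongDual ℝ E, M d = covarianceBilinDual ν L M) :
    klDiv (P.map fun x => d + x) ν = klDiv P ν + ENNReal.ofReal (L d / 2) := by
  have hp1 : IsProbabilityMeasure (P.map fun x => d + x) :=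
    Measure.isProbabilityMeasure_map (by fun_prop)
  have hp2 : IsProbabilityMeasure (ν.map fun x => d + x) :=
    Measure.isProbabilityMeasure_map (by fun_prop)
  have hLi : Integrable (fun x => L x) P := L.integrable_comp hPi
  have hcomp : ((fun x => L x - L d / 2) ∘ fun x => d + x) = fun x => L x + L d / 2 := by
    ext x; simp only [Function.comp_apply, map_add]; ring
  have hint : Integrable (fun x => L x - L d / 2) (P.map fun x => d + x) := by
    rw [integrable_map_measure (by fun_prop) (by fun_prop), hcomp]
    exact hLi.add (integrable_const _)
  have hval : ∫ x, (L x - L d / 2) ∂(P.map fun x => d + x) = L d / 2 := by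
    rw [integral_map (by fun_prop) (by fun_prop)]
    have h0 : ∫ x, L x ∂P = 0 := by
      have := L.integral_comp_comm hPi
      simp only [id_eq] at this hP
      rw [this, hP, map_zero]
    change ∫ x, ((fun x => L x - L d / 2) ∘ fun x => d + x) x ∂P = _
    rw [hcomp, integral_add hLi (integrable_const _), h0]
    simp
  have hnn : 0 ≤ L d := by rw [hd]; exact covarianceBilinDual_self_nonneg _
  rw [klDiv_eq_add_of_withDensity_exp (by fun_prop) (map_const_add_eq_withDensity hν hd) hint
    (by rw [hval]; positivity), hval, klDiv_map_eq_of_leftInverse (g := fun x => -d + x)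
    (by fun_prop) (by fun_prop) (fun x => by simp)]

/-- The law of `c + a (ζ₁ - c) + b (ζ₂ - c)` for independent `ζ₁`, `ζ₂` with law `P`. -/
def mixedLaw (P : Measure E) (c : E) (a b : ℝ) : Measure E :=
  (P.prod P).map fun p => c + (a • (p.1 - c) + b • (p.2 - c))

instance (P : Measure E) [IsProbabilityMeasure P] (c : E) (a b : ℝ) :
    IsProbabilityMeasure (mixedLaw P c a b) :=
  Measure.isProbabilityMeasure_map (by fun_prop)

theorem mixedLaw_eq_map (P : Measure E) [IsProbabilityMeasure P] (c : E) (a b : ℝ) :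
    mixedLaw P c a b = (((P.map fun x => x - c).prod (P.map fun x => x - c)).map
      fun p => a • p.1 + b • p.2).map fun x => c + x := by
  rw [Measure.map_prod_map _ _ (by fun_prop) (by fun_prop), Measure.map_map (by fun_prop)
    (by fun_prop), Measure.map_map (by fun_prop) (by fun_prop)]
  rfl

/-- If `P` is the unique minimizer of `klDiv · γ` among the laws `mixedLaw P c a b`, then `P` is
Gaussian. -/
theorem isGaussian_of_klDiv_mixedLaw {P γ : Measure E} [IsProbabilityMeasure P] [IsGaussian γ]
    (hfin : klDiv P γ ≠ ∞)
    (hle : ∀ a b : ℝ, a ^ 2 + b ^ 2 = 1 → klDiv P γ ≤ klDiv (mixedLaw P P[id] a b) γ)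
    (huniq : ∀ a b : ℝ, a ^ 2 + b ^ 2 = 1 → klDiv (mixedLaw P P[id] a b) γ ≤ klDiv P γ →
      mixedLaw P P[id] a b = P) : IsGaussian P := by
  have h2 := memLp_two_of_klDiv_ne_top hfin
  have hPi : Integrable id P := h2.integrable (by norm_num)
  set c := P[id] with hc
  set m := γ[id] with hm
  set P₀ := P.map fun x => x - c with hP₀
  set γ₀ := γ.map fun x => x - m with hγ₀
  have : IsProbabilityMeasure P₀ := Measure.isProbabilityMeasure_map (by fun_prop)
  have : IsGaussian γ₀ := by rw [hγ₀]; infer_instance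
  have h2' : MemLp id 2 P₀ := by
    rw [memLp_map_measure_iff (by fun_prop) (by fun_prop)]
    exact h2.sub (memLp_const c)
  have hPi' : Integrable id P₀ := h2'.integrable (by norm_num)
  have hmeanP : P₀[id] = 0 := by
    rw [integral_map (by fun_prop) (by fun_prop)]
    simp only [id_eq] at hPi hc ⊢
    rw [integral_sub (f := fun x => x) hPi (integrable_const c)]
    simp [← hc]
  have hmeanγ : γ₀[id] = 0 := by
    rw [integral_map (by fun_prop) (by fun_prop)]
    have hi : Integrable id γ := IsGaussian.integrable_id
    simp only [id_eq] at hm hi ⊢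
    rw [integral_sub (f := fun x => x) hi (integrable_const m)]
    simp [← hm]
  have hshift (Q : Measure E) [IsProbabilityMeasure Q] :
      klDiv (Q.map fun x => c + x) γ = klDiv (Q.map fun x => (c - m) + x) γ₀ := by
    have : IsProbabilityMeasure (Q.map fun x => c + x) :=
      Measure.isProbabilityMeasure_map (by fun_prop)
    rw [← klDiv_map_eq_of_leftInverse (f := fun x => x - m) (g := fun x => x + m) (by fun_prop)
      (by fun_prop) (fun x => by simp), Measure.map_map (by fun_prop) (by fun_prop)]
    congr 2
    ext x
    simp only [Function.comp_apply]
    abel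
  have hPP₀ : P = P₀.map fun x => c + x := by
    rw [hP₀, Measure.map_map (by fun_prop) (by fun_prop)]
    simp [Function.comp_def]
  -- The difference of the means lies in the Cameron-Martin space of the centred `γ₀`, by absolute
  -- continuity.
  obtain ⟨L, hL⟩ : ∃ L : StrongDual ℝ E, ∀ M, M (c - m) = covarianceBilinDual γ₀ L M := by
    have : IsProbabilityMeasure (P.map fun x => x - m) :=
      Measure.isProbabilityMeasure_map (by fun_prop)
    have hac : P.map (fun x => x - m) ≪ γ₀ := (klDiv_ne_top_iff.1 hfin).1.map (by fun_prop)
    obtain ⟨L, hL⟩ := exists_covarianceBilinDual_eq_mean hmeanγ (by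
      rw [integrable_map_measure (by fun_prop) (by fun_prop)]
      exact hPi.sub (integrable_const m)) hac
    refine ⟨L, fun M => ?_⟩
    rw [← hL M, integral_map (by fun_prop) (by fun_prop)]
    simp only [id_eq] at hPi hc ⊢
    rw [integral_sub (f := fun x => x) hPi (integrable_const m)]
    simp [← hc]
  have hkl (Q : Measure E) [IsProbabilityMeasure Q] (hQi : Integrable id Q) (hQ : Q[id] = 0) :
      klDiv (Q.map fun x => c + x) γ = klDiv Q γ₀ + ENNReal.ofReal (L (c - m) / 2) := by
    rw [hshift, klDiv_map_const_add hmeanγ hQi hQ hL]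
  let Q (a b : ℝ) : Measure E := (P₀.prod P₀).map fun p => a • p.1 + b • p.2
  have hQp (a b : ℝ) : IsProbabilityMeasure (Q a b) := Measure.isProbabilityMeasure_map (by fun_prop)
  have hi1 (a : ℝ) : Integrable (fun p : E × E => a • p.1) (P₀.prod P₀) :=
    (hPi'.comp_fst P₀).smul a
  have hi2 (b : ℝ) : Integrable (fun p : E × E => b • p.2) (P₀.prod P₀) :=
    (hPi'.comp_snd P₀).smul b
  have hQi (a b : ℝ) : Integrable id (Q a b) := by
    rw [integrable_map_measure (by fun_prop) (by fun_prop)]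
    exact (hi1 a).add (hi2 b)
  have hQ0 (a b : ℝ) : (Q a b)[id] = 0 := by
    rw [integral_map (by fun_prop) (by fun_prop)]
    simp only [id_eq] at hmeanP ⊢
    rw [integral_add (hi1 a) (hi2 b), integral_smul, integral_smul,
      integral_fun_fst (μ := P₀) (ν := P₀) (fun x => x),
      integral_fun_snd (μ := P₀) (ν := P₀) (fun x => x), hmeanP]
    simp
  have hklP : klDiv P γ = klDiv P₀ γ₀ + ENNReal.ofReal (L (c - m) / 2) := by
    rw [← hkl P₀ hPi' hmeanP, ← hPP₀]
  have hklQ (a b : ℝ) : klDiv (mixedLaw P c a b) γ =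
      klDiv (Q a b) γ₀ + ENNReal.ofReal (L (c - m) / 2) := by
    rw [← hkl (Q a b) (hQi a b) (hQ0 a b), mixedLaw_eq_map]
  have hfin₀ : klDiv P₀ γ₀ ≠ ∞ := fun h => hfin (by rw [hklP, h, top_add])
  have hle₀ (a b : ℝ) (hab : a ^ 2 + b ^ 2 = 1) : klDiv P₀ γ₀ ≤ klDiv (Q a b) γ₀ := by
    have := hle a b hab
    rw [hklP, hklQ] at this
    exact (ENNReal.add_le_add_iff_right ENNReal.ofReal_ne_top).1 this
  set r : ℝ := (√2)⁻¹ with hr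
  have hr2 : r ^ 2 = 1 / 2 := by
    rw [hr, inv_pow, Real.sq_sqrt (by norm_num)]; norm_num
  have hcos : Real.cos (Real.pi / 4) = r := by
    rw [Real.cos_pi_div_four, hr]
    field_simp
    exact Real.sq_sqrt (by norm_num)
  have hsin : Real.sin (Real.pi / 4) = r := by rw [Real.sin_pi_div_four, ← hcos, Real.cos_pi_div_four]
  let rot : E × E →L[ℝ] E × E := ContinuousLinearMap.rotation (Real.pi / 4)
  have hrot (p : E × E) : rot p = (r • p.1 + r • p.2, -r • p.1 + r • p.2) := by
    simp only [rot, ContinuousLinearMap.rotation_apply, hcos, hsin]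
  have hrotm : Measurable rot := rot.measurable
  -- Rotating two independent copies by π/4 gives the marginals `Q r r` and `Q (-r) r`. The rotation
  -- preserves `γ₀.prod γ₀`, and superadditivity bounds the marginal divergences by the joint one,
  -- which is twice that of `P₀`.
  have hkey : klDiv (Q r r) γ₀ + klDiv (Q (-r) r) γ₀ ≤ klDiv P₀ γ₀ + klDiv P₀ γ₀ := by
    have h1 : ((P₀.prod P₀).map rot).map Prod.fst = Q r r := by
      rw [Measure.map_map measurable_fst hrotm]
      congr 1; ext p; simp [hrot]
    have h3 : ((P₀.prod P₀).map rot).map Prod.snd = Q (-r) r := by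
      rw [Measure.map_map measurable_snd hrotm]
      congr 1; ext p; simp [hrot]
    have hprob : IsProbabilityMeasure ((P₀.prod P₀).map rot) :=
      Measure.isProbabilityMeasure_map hrotm.aemeasurable
    have hprob2 : IsProbabilityMeasure (((P₀.prod P₀).map rot).map Prod.snd) :=
      Measure.isProbabilityMeasure_map measurable_snd.aemeasurable
    rw [← klDiv_prod P₀ γ₀ P₀ γ₀, ← h1, ← h3]
    refine (add_klDiv_marginals_le ((P₀.prod P₀).map rot) γ₀ γ₀).trans_eq ?_
    conv_lhs => rw [← IsGaussian.map_rotation_eq_self hmeanγ (Real.pi / 4)]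
    refine klDiv_map_eq_of_leftInverse (g := fun p => (r • p.1 - r • p.2, r • p.1 + r • p.2))
      hrotm (by fun_prop) (fun p => ?_) _ _
    rw [hrot]
    have h4 : r * r + r * r = 1 := by nlinarith
    refine Prod.ext ?_ ?_
    · simp only [smul_add, smul_smul, ← sub_eq_zero (b := p.1)]
      have : r * r + r * r - 1 = 0 := by linarith
      rw [show (r * r) • p.1 + (r * r) • p.2 - ((r * -r) • p.1 + (r * r) • p.2) - p.1 =
        (r * r + r * r - 1) • p.1 by module, this, zero_smul]
    · simp only [smul_add, smul_smul, ← sub_eq_zero (b := p.2)]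
      have : r * r + r * r - 1 = 0 := by linarith
      rw [show (r * r) • p.1 + (r * r) • p.2 + ((r * -r) • p.1 + (r * r) • p.2) - p.2 =
        (r * r + r * r - 1) • p.2 by module, this, zero_smul]
  -- Minimality bounds the divergence of `Q (-r) r` from below, so one finite copy cancels in
  -- `hkey`.
  have hleQ : klDiv (Q r r) γ₀ ≤ klDiv P₀ γ₀ := by
    refine (ENNReal.add_le_add_iff_right hfin₀).1 (le_trans ?_ hkey)
    gcongr
    exact hle₀ (-r) r (by nlinarith)
  have heq := huniq r r (by nlinarith) (by rw [hklP, hklQ]; gcongr)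
  have hstable : Q r r = P₀ := by
    have h5 : (mixedLaw P c r r).map (fun x => x - c) = Q r r := by
      rw [mixedLaw_eq_map, Measure.map_map (by fun_prop) (by fun_prop)]
      simp only [Function.comp_def, add_sub_cancel_left]
      exact Measure.map_id
    rw [← h5, heq]
  have : IsGaussian P₀ := isGaussian_of_map_normalized_add h2' hmeanP (by
    rw [← hr]
    conv_rhs => rw [← hstable]
    simp only [smul_add, Q])
  rw [hPP₀]
  infer_instance

end Gaussianity

/-! ### Independence for two independent copies -/

section ProdComm

variable {α β γ δ : Type*} [MeasurableSpace α] [MeasurableSpace β] [MeasurableSpace γ]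
  [MeasurableSpace δ]

theorem map_prodProdProdComm (P : Measure α) (Q : Measure β) (R : Measure γ) (S : Measure δ)
    [SFinite P] [SFinite Q] [SFinite R] [SFinite S] :
    ((P.prod Q).prod (R.prod S)).map (fun p => ((p.1.1, p.2.1), (p.1.2, p.2.2))) =
      (P.prod R).prod (Q.prod S) := by
  refine Measure.ext_of_lintegral _ fun f hf => ?_
  rw [lintegral_map hf (by fun_prop), lintegral_prod _ (by fun_prop), lintegral_prod _ (by fun_prop),
    lintegral_prod _ (by fun_prop), lintegral_prod _ (by fun_prop)]
  refine lintegral_congr fun a => ?_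
  simp_rw [fun b => lintegral_prod (μ := R) (ν := S)
    (fun y : γ × δ => f (((a, y.1), (b, y.2)))) (by fun_prop)]
  rw [lintegral_lintegral_swap (Measurable.aemeasurable
    (Measurable.lintegral_prod_right (f := fun (p : (β × γ)) d => f ((a, p.2), (p.1, d)))
      (by fun_prop)))]
  refine lintegral_congr fun c => ?_
  rw [lintegral_prod _ (by fun_prop)]

theorem IndepFun.prodMk_prod {Ω Ω' : Type*} [MeasurableSpace Ω] [MeasurableSpace Ω']
    {P : Measure Ω} {P' : Measure Ω'} [IsProbabilityMeasure P] [IsProbabilityMeasure P']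
    {f : Ω → α} {g : Ω → β} {f' : Ω' → γ} {g' : Ω' → δ} (hf : Measurable f) (hg : Measurable g)
    (hf' : Measurable f') (hg' : Measurable g') (h : IndepFun f g P) (h' : IndepFun f' g' P') :
    IndepFun (fun p : Ω × Ω' => (f p.1, f' p.2)) (fun p => (g p.1, g' p.2)) (P.prod P') := by
  have := Measure.isProbabilityMeasure_map (μ := P) hf.aemeasurable
  have := Measure.isProbabilityMeasure_map (μ := P) hg.aemeasurable
  have := Measure.isProbabilityMeasure_map (μ := P') hf'.aemeasurable
  have := Measure.isProbabilityMeasure_map (μ := P') hg'.aemeasurable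
  rw [indepFun_iff_map_prod_eq_prod_map_map (by fun_prop) (by fun_prop)] at h h' ⊢
  have h1 : (P.prod P').map (fun p => (f p.1, f' p.2)) = (P.map f).prod (P'.map f') :=
    (Measure.map_prod_map P P' hf hf').symm
  have h2 : (P.prod P').map (fun p => (g p.1, g' p.2)) = (P.map g).prod (P'.map g') :=
    (Measure.map_prod_map P P' hg hg').symm
  rw [h1, h2, ← map_prodProdProdComm, ← h, ← h', Measure.map_prod_map _ _ (by fun_prop)
    (by fun_prop), Measure.map_map (by fun_prop) (by fun_prop)]
  rfl

end ProdComm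

/-! ### Rotated mixtures: linear images, Gaussian invariance, independence -/

section Mixed

variable {E F : Type*} [NormedAddCommGroup E] [NormedSpace ℝ E] [FiniteDimensional ℝ E]
  [MeasurableSpace E] [BorelSpace E] [NormedAddCommGroup F] [NormedSpace ℝ F]
  [FiniteDimensional ℝ F] [MeasurableSpace F] [BorelSpace F]

theorem map_mixedLaw (L : E →L[ℝ] F) (P : Measure E) [IsProbabilityMeasure P] (c : E) (a b : ℝ) :
    (mixedLaw P c a b).map L = mixedLaw (P.map L) (L c) a b := by
  rw [mixedLaw, mixedLaw, Measure.map_prod_map _ _ (by fun_prop) (by fun_prop),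
    Measure.map_map (by fun_prop) (by fun_prop), Measure.map_map (by fun_prop) (by fun_prop)]
  congr 1
  ext p
  simp

/-- The pair (a, b) is (cos θ, sin θ), and a product of two equal centred Gaussian laws is rotation
invariant. This keeps the input marginal of the competitors in place. -/
theorem mixedLaw_eq_self (P : Measure E) [IsGaussian P] {a b : ℝ} (hab : a ^ 2 + b ^ 2 = 1) :
    mixedLaw P P[id] a b = P := by
  set c := P[id] with hc
  obtain ⟨θ, ha, hb⟩ : ∃ θ, Real.cos θ = a ∧ Real.sin θ = b := by
    have hn : ‖(⟨a, b⟩ : ℂ)‖ = 1 := by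
      rw [Complex.norm_eq_sqrt_sq_add_sq, hab, Real.sqrt_one]
    refine ⟨Complex.arg ⟨a, b⟩, ?_, ?_⟩
    · simpa [hn] using Complex.norm_mul_cos_arg ⟨a, b⟩
    · simpa [hn] using Complex.norm_mul_sin_arg ⟨a, b⟩
  set P₀ := P.map fun x => x - c with hP₀
  have : IsGaussian P₀ := by rw [hP₀]; infer_instance
  have hmean : P₀[id] = 0 := by
    rw [integral_map (by fun_prop) (by fun_prop)]
    have hi : Integrable id P := IsGaussian.integrable_id
    simp only [id_eq] at hc hi ⊢
    rw [integral_sub (f := fun x => x) hi (integrable_const c)]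
    simp [← hc]
  rw [mixedLaw_eq_map, ← hP₀]
  have hrot := congrArg (Measure.map Prod.fst) (IsGaussian.map_rotation_eq_self hmean θ)
  rw [Measure.map_map (by fun_prop) (ContinuousLinearMap.measurable _), Measure.map_fst_prod,
    measure_univ, one_smul] at hrot
  have h2 : (P₀.prod P₀).map (fun p => a • p.1 + b • p.2) = P₀ := by
    refine Eq.trans ?_ hrot
    congr 1
    ext p
    simp [ContinuousLinearMap.rotation_apply, ha, hb]
  rw [h2, hP₀, Measure.map_map (by fun_prop) (by fun_prop)]
  simp [Function.comp_def]

/-- By linearity the mixture acts on `f` and on `g` separately, so independence of `f` and `g`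
passes from the two copies to the mixture. -/
theorem indepFun_mixedLaw {X Y : Type*} [NormedAddCommGroup X] [NormedSpace ℝ X]
    [SecondCountableTopology X]
    [MeasurableSpace X] [BorelSpace X] [NormedAddCommGroup Y] [NormedSpace ℝ Y]
    [SecondCountableTopology Y] [MeasurableSpace Y] [BorelSpace Y] (f : E →L[ℝ] X) (g : E →L[ℝ] Y)
    (P : Measure E) [IsProbabilityMeasure P] (h : IndepFun f g P) (c : E) (a b : ℝ) :
    IndepFun f g (mixedLaw P c a b) := by
  have h1 := (IndepFun.prodMk_prod f.measurable g.measurable f.measurable g.measurable h h).comp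
    (φ := fun q : X × X => f c + (a • (q.1 - f c) + b • (q.2 - f c)))
    (ψ := fun q : Y × Y => g c + (a • (q.1 - g c) + b • (q.2 - g c))) (by fun_prop) (by fun_prop)
  have hm : Measurable fun p : E × E => c + (a • (p.1 - c) + b • (p.2 - c)) := by fun_prop
  have hf := f.measurable
  have hg := g.measurable
  rw [indepFun_iff_map_prod_eq_prod_map_map (by fun_prop) (by fun_prop)] at h1 ⊢
  rw [mixedLaw, Measure.map_map hf hm, Measure.map_map hg hm, Measure.map_map (by fun_prop) hm]
  convert h1 using 2
  · ext p <;> simp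
  · congr 2
    ext p
    simp
  · congr 1
    ext p
    simp

end Mixed

/-! ### The unique Gaussian minimizer among causal couplings -/

section Causal

variable {T : ℕ} {μ : Measure (Fin T → ℝ)} [IsGaussian μ]

theorem mixedLaw_mem_causalCouplings {π : ProbabilityMeasure (Path T)}
    (hπ : π ∈ causalCouplings μ) (hint : Integrable id (π : Measure (Path T))) {a b : ℝ}
    (hab : a ^ 2 + b ^ 2 = 1) :
    (⟨mixedLaw (π : Measure (Path T)) (π : Measure (Path T))[id] a b, inferInstance⟩ :
      ProbabilityMeasure (Path T)) ∈ causalCouplings μ := by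
  obtain ⟨A, hA⟩ := exists_isRegression μ
  rw [mem_causalCouplings_iff hA] at hπ
  refine (mem_causalCouplings_iff hA _).2 ⟨?_, fun t => ?_⟩
  · change (mixedLaw (π : Measure (Path T)) _ a b).map
      (ContinuousLinearMap.fst ℝ (Fin T → ℝ) (Fin T → ℝ)) = μ
    have h1 : (π : Measure (Path T)).map (ContinuousLinearMap.fst ℝ (Fin T → ℝ) (Fin T → ℝ)) = μ :=
      hπ.1
    have h2 : ContinuousLinearMap.fst ℝ (Fin T → ℝ) (Fin T → ℝ) (π : Measure (Path T))[id] =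
        μ[id] := by
      rw [← h1, integral_map (by fun_prop) (by fun_prop), ← ContinuousLinearMap.integral_comp_comm _ hint]
      rfl
    rw [map_mixedLaw, h1, h2, mixedLaw_eq_self _ hab]
  · exact indepFun_mixedLaw (pastL t) ((innovationL (A t)).comp (.fst ℝ _ _)) _ (hπ.2 t) _ a b

/-- The divergence from a Gaussian law has a unique minimizer on the causal couplings of a Gaussian
input law, and it is Gaussian. -/
theorem exists_unique_causalProjection (γ : Measure (Path T)) [IsGaussian γ]
    (hγ : (⨅ π' ∈ causalCouplings μ, klDiv (π' : Measure (Path T)) γ) < ⊤) :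
    ∃ π ∈ causalCouplings μ, klDiv (π : Measure (Path T)) γ < ⊤ ∧
      (∀ π' ∈ causalCouplings μ, klDiv (π : Measure (Path T)) γ ≤ klDiv (π' : Measure (Path T)) γ) ∧
      (∀ π' ∈ causalCouplings μ, klDiv (π' : Measure (Path T)) γ ≤ klDiv (π : Measure (Path T)) γ →
        π' = π) ∧ IsGaussian (π : Measure (Path T)) := by
  obtain ⟨π, hπ, hfin, hle, huniq⟩ := exists_unique_klDiv_minimizer (γ := γ)
    (fun P hP Q hQ => midpointLaw_mem_causalCouplings (μ := μ) P Q hP hQ) mem_causalCouplings_of_tendsto hγ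
  refine ⟨π, hπ, hfin, hle, huniq, ?_⟩
  have hint : Integrable id (π : Measure (Path T)) :=
    (memLp_two_of_klDiv_ne_top hfin.ne).integrable (by norm_num)
  exact isGaussian_of_klDiv_mixedLaw hfin.ne
    (fun a b hab => hle _ (mixedLaw_mem_causalCouplings hπ hint hab))
    (fun a b hab h => congrArg Subtype.val (huniq _ (mixedLaw_mem_causalCouplings hπ hint hab) h))

end Causal

/-! ### Gaussian conditional laws -/

section CondLaw

variable {Ω X : Type*} [MeasurableSpace Ω] [MeasurableSpace X] {P : Measure Ω}
  {Z : Ω → X} {ι : Type*} [Fintype ι] [DecidableEq ι]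

theorem condDistrib_ae_eq_gaussianReal_iff [IsProbabilityMeasure P] (hZ : Measurable Z) {F : Ω → ℝ}
    (hF : Measurable F) {h : X → ℝ} (hh : Measurable h) (v : ℝ≥0) :
    (∀ᵐ x ∂(P.map Z), condDistrib F Z P x = gaussianReal (h x) v) ↔
      IndepFun Z (fun ω => F ω - h (Z ω)) P ∧
        P.map (fun ω => F ω - h (Z ω)) = gaussianReal 0 v := by
  rw [← map_prodMk_eq_shear_iff hZ hF hh, ← condDistrib_ae_eq_shift_iff hF hh]
  refine eventually_congr (.of_forall fun x => ?_)
  rw [gaussianReal_map_const_add, zero_add]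

theorem condDistrib_ae_eq_gaussianVec_iff [IsProbabilityMeasure P] (hZ : Measurable Z)
    {F : Ω → ι → ℝ} (hF : Measurable F) {h : X → ι → ℝ} (hh : Measurable h) (S : Matrix ι ι ℝ) :
    (∀ᵐ x ∂(P.map Z), condDistrib F Z P x = gaussianVec (h x) S) ↔
      IndepFun Z (fun ω => F ω - h (Z ω)) P ∧
        P.map (fun ω => F ω - h (Z ω)) = gaussianVec 0 S := by
  rw [← map_prodMk_eq_shear_iff hZ hF hh, ← condDistrib_ae_eq_shift_iff hF hh]
  refine eventually_congr (.of_forall fun x => ?_)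
  rw [gaussianVec_eq_map (h x)]

variable {E : Type*} [NormedAddCommGroup E] [NormedSpace ℝ E] [FiniteDimensional ℝ E]
  [MeasurableSpace E] [BorelSpace E] {Z : Ω → E}

theorem exists_condDistrib_ae_eq_gaussianReal [IsFiniteMeasure P] (hZ : Measurable Z) {F : Ω → ℝ}
    (hF : Measurable F)
    (hJ : HasGaussianLaw (fun ω => (Z ω, F ω)) P) :
    ∃ (A : StrongDual ℝ E) (m v : ℝ), 0 ≤ v ∧
      ∀ᵐ x ∂(P.map Z), condDistrib F Z P x = gaussianReal (A x + m) v.toNNReal := by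
  have := hJ.isProbabilityMeasure
  obtain ⟨A, ν, hν, h⟩ := exists_map_eq_shear hZ hF hJ
  obtain ⟨m, v, rfl⟩ : ∃ m v, ν = gaussianReal m v := ⟨_, _, hν.eq_gaussianReal⟩
  refine ⟨A, m, v, v.2, ?_⟩
  rw [← condDistrib_ae_eq_shift_iff hF (by fun_prop)] at h
  filter_upwards [h] with x hx
  rw [hx, gaussianReal_map_const_add, add_comm, Real.toNNReal_coe]

theorem exists_condDistrib_ae_eq_gaussianVec [IsFiniteMeasure P] (hZ : Measurable Z)
    {F : Ω → ι → ℝ} (hF : Measurable F) (hJ : HasGaussianLaw (fun ω => (Z ω, F ω)) P) :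
    ∃ (A : E →L[ℝ] (ι → ℝ)) (m : ι → ℝ) (S : Matrix ι ι ℝ), S.PosSemidef ∧
      ∀ᵐ x ∂(P.map Z), condDistrib F Z P x = gaussianVec (A x + m) S := by
  have := hJ.isProbabilityMeasure
  obtain ⟨A, ν, hν, h⟩ := exists_map_eq_shear hZ hF hJ
  obtain ⟨m, S, hS, rfl⟩ := exists_eq_gaussianVec ν
  refine ⟨A, m, S, hS, ?_⟩
  rw [← condDistrib_ae_eq_shift_iff hF (by fun_prop)] at h
  filter_upwards [h] with x hx
  rw [hx, gaussianVec_eq_map m, gaussianVec_eq_map (A x + m),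
    Measure.map_map (by fun_prop) (by fun_prop)]
  congr 1
  ext y
  simp [add_assoc]

end CondLaw

/-! ### Existence of the parameters of the conditional laws -/

section Existence

variable {T : ℕ}

/-- `(u_{1:t}, y_{1:t-1})`. -/
def regressor (t : Fin T) (z : Path T) : (UpTo t → ℝ) × (Before t → ℝ) :=
  (upTo t z.1, before t z.2)

/-- `(u_{1:t}, y_{1:t-1}, y_t)`. -/
def fullRegressor (t : Fin T) (z : Path T) : (UpTo t → ℝ) × (Before t → ℝ) × ℝ :=
  (upTo t z.1, before t z.2, z.2 t)

/-- `(u_{1:t}, y_{1:t-1})` as a continuous linear function of `(u, y)`. -/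
def regressorL (t : Fin T) : Path T →L[ℝ] (UpTo t → ℝ) × (Before t → ℝ) :=
  ((upToL t).comp (.fst ℝ _ _)).prod ((beforeL t).comp (.snd ℝ _ _))

/-- `y_t` as a continuous linear function of `(u, y)`. -/
def outputL (t : Fin T) : Path T →L[ℝ] ℝ :=
  (ContinuousLinearMap.proj (R := ℝ) (φ := fun _ : Fin T => ℝ) t).comp (.snd ℝ _ _)

/-- `(u_{1:t}, y_{1:t-1}, y_t)` as a continuous linear function of `(u, y)`. -/
def fullRegressorL (t : Fin T) : Path T →L[ℝ] (UpTo t → ℝ) × (Before t → ℝ) × ℝ :=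
  ((upToL t).comp (.fst ℝ _ _)).prod (((beforeL t).comp (.snd ℝ _ _)).prod (outputL t))

/-- `z_{t+1:T}` as a continuous linear function of `z`. -/
def futureL (t : Fin T) : Path T →L[ℝ] (After t ⊕ After t → ℝ) :=
  .pi fun s => s.elim
    (fun r => (ContinuousLinearMap.proj (R := ℝ) (φ := fun _ : Fin T => ℝ) r.1).comp (.fst ℝ _ _))
    (fun r => (ContinuousLinearMap.proj (R := ℝ) (φ := fun _ : Fin T => ℝ) r.1).comp (.snd ℝ _ _))

theorem futureL_apply (t : Fin T) (z : Path T) : futureL t z = future t z := by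
  ext s
  cases s <;> rfl

@[fun_prop] theorem measurable_future (t : Fin T) : Measurable (future t) := by
  rw [show future t = futureL t from funext fun z => (futureL_apply t z).symm]
  exact (futureL t).measurable

@[fun_prop] theorem measurable_regressor (t : Fin T) : Measurable (regressor t) :=
  (regressorL t).measurable

@[fun_prop] theorem measurable_fullRegressor (t : Fin T) : Measurable (fullRegressor t) :=
  (fullRegressorL t).measurable

theorem exists_isMarginalLaw (μ : Measure (Fin T → ℝ)) [IsGaussian μ] (t : Fin T) :
    ∃ a, IsMarginalLaw μ t a := by
  have hJ : HasGaussianLaw (fun u : Fin T → ℝ => (before t u, u t)) μ :=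
    (IsGaussian.hasGaussianLaw_id (μ := μ)).map_fun ((beforeL t).prod (.proj t))
  obtain ⟨A, m, v, hv, h⟩ := exists_condDistrib_ae_eq_gaussianReal (by fun_prop) (by fun_prop) hJ
  obtain ⟨K, rfl⟩ := exists_eq_dotL A
  simp_rw [dotL_apply] at h
  exact ⟨⟨K, m, v⟩, hv, h⟩

theorem exists_isOutputLaw (ρ : Measure (Path T)) [IsGaussian ρ] (t : Fin T) :
    ∃ b, IsOutputLaw ρ t b := by
  have hJ : HasGaussianLaw (fun z : Path T => (regressor t z, z.2 t)) ρ :=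
    (IsGaussian.hasGaussianLaw_id (μ := ρ)).map_fun ((regressorL t).prod (outputL t))
  obtain ⟨A, m, v, hv, h⟩ := exists_condDistrib_ae_eq_gaussianReal (by fun_prop) (by fun_prop) hJ
  obtain ⟨K, hK⟩ := exists_eq_dotL (A.comp (.inl ℝ _ _))
  obtain ⟨K', hK'⟩ := exists_eq_dotL (A.comp (.inr ℝ _ _))
  have hA (x : (UpTo t → ℝ) × (Before t → ℝ)) : A x = K ⬝ᵥ x.1 + K' ⬝ᵥ x.2 := by
    rw [← dotL_apply, ← dotL_apply, ← hK, ← hK']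
    simp [← map_add]
  simp_rw [hA] at h
  exact ⟨⟨K, K', m, v⟩, hv, h⟩

theorem exists_isFutureLaw (ρ : Measure (Path T)) [IsGaussian ρ] (t : Fin T) :
    ∃ c, IsFutureLaw ρ t c := by
  have hJ : HasGaussianLaw (fun z : Path T => (fullRegressor t z, future t z)) ρ := by
    simp_rw [← futureL_apply]
    exact (IsGaussian.hasGaussianLaw_id (μ := ρ)).map_fun ((fullRegressorL t).prod (futureL t))
  obtain ⟨A, m, S, hS, h⟩ := exists_condDistrib_ae_eq_gaussianVec (by fun_prop) (by fun_prop) hJ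
  let A₁ := A.comp (.inl ℝ (UpTo t → ℝ) ((Before t → ℝ) × ℝ))
  let A₂ := (A.comp (.inr ℝ (UpTo t → ℝ) ((Before t → ℝ) × ℝ))).comp (.inl ℝ (Before t → ℝ) ℝ)
  let A₃ := (A.comp (.inr ℝ (UpTo t → ℝ) ((Before t → ℝ) × ℝ))).comp (.inr ℝ (Before t → ℝ) ℝ)
  have hA (x : (UpTo t → ℝ) × (Before t → ℝ) × ℝ) : A x =
      LinearMap.toMatrix' (A₁ : (UpTo t → ℝ) →ₗ[ℝ] _) *ᵥ x.1 +
      LinearMap.toMatrix' (A₂ : (Before t → ℝ) →ₗ[ℝ] _) *ᵥ x.2.1 + x.2.2 • A₃ 1 := by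
    rw [LinearMap.toMatrix'_mulVec, LinearMap.toMatrix'_mulVec, ← map_smul]
    simp [A₁, A₂, A₃, ← map_add]
  simp_rw [hA] at h
  exact ⟨⟨_, _, _, m, S⟩, hS, h⟩

end Existence

/-! ### The conditional laws of the inputs -/

section Input

/-- The difference g(Z) = R - R' is uncorrelated with R and with R', hence with itself. So two
residuals of one variable on the same regressor agree up to a constant. -/
theorem ae_eq_const_of_indepFun_add {Ω X : Type*} [MeasurableSpace Ω] [MeasurableSpace X]
    {P : Measure Ω} [IsProbabilityMeasure P] {Z : Ω → X} {R R' : Ω → ℝ} {g : X → ℝ}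
    (hg : Measurable g) (hR : IndepFun Z R P) (hR' : IndepFun Z R' P) (h2 : MemLp R 2 P)
    (h2' : MemLp R' 2 P) (h : ∀ ω, R ω = R' ω + g (Z ω)) :
    ∃ c, ∀ᵐ ω ∂P, R ω = R' ω + c := by
  have hgZ : (fun ω => g (Z ω)) = R - R' := by
    ext ω
    simp [h]
  have hgZ2 : MemLp (fun ω => g (Z ω)) 2 P := hgZ ▸ h2.sub h2'
  have hi : IndepFun (fun ω => g (Z ω)) R P := hR.comp hg measurable_id
  have hi' : IndepFun (fun ω => g (Z ω)) R' P := hR'.comp hg measurable_id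
  have hvar : Var[fun ω => g (Z ω); P] = 0 := by
    rw [← covariance_self hgZ2.aestronglyMeasurable.aemeasurable]
    conv_lhs => rw [show cov[fun ω => g (Z ω), fun ω => g (Z ω); P] =
      cov[fun ω => g (Z ω), R - R'; P] by rw [← hgZ]]
    rw [covariance_sub_right hgZ2 h2 h2', hi.covariance_eq_zero hgZ2 h2,
      hi'.covariance_eq_zero hgZ2 h2', sub_zero]
  refine ⟨∫ ω, g (Z ω) ∂P, ?_⟩
  filter_upwards [ae_eq_integral_of_variance_eq_zero hgZ2 hvar] with ω hω
  rw [h, hω]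

variable {T : ℕ} {μ : Measure (Fin T → ℝ)} [IsGaussian μ]

/-- The residual of U_t on U_{1:t-1} equals, up to a constant, the U_t component of the innovation
at time t - 1, which causality makes independent of Y_{1:t-1} as well. -/
theorem isInputLaw_of_isMarginalLaw {π : ProbabilityMeasure (Path T)}
    (hπ : π ∈ causalCouplings μ) {t : Fin T} {a : MarginalParams t} (ha : IsMarginalLaw μ t a) :
    IsInputLaw (π : Measure (Path T)) t ⟨a.K, 0, a.m, a.var⟩ := by
  obtain ⟨A, hA⟩ := exists_isRegression μ
  rw [mem_causalCouplings_iff hA] at hπ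
  obtain ⟨hπ1, hπ2⟩ := hπ
  refine ⟨ha.1, ?_⟩
  have h1 := ha.2
  rw [condDistrib_ae_eq_gaussianReal_iff (h := fun x => a.K ⬝ᵥ x + a.m) (by fun_prop)
    (by fun_prop) (by unfold dotProduct; fun_prop)] at h1
  set R : (Fin T → ℝ) → ℝ := fun u => u t - (a.K ⬝ᵥ before t u + a.m) with hR
  have hRm : Measurable R := by
    simp only [hR, dotProduct]
    fun_prop
  rw [condDistrib_ae_eq_gaussianReal_iff
    (h := fun x : (Before t → ℝ) × (Before t → ℝ) => a.K ⬝ᵥ x.1 + 0 ⬝ᵥ x.2 + a.m) (by fun_prop)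
    (by fun_prop) (by unfold dotProduct; fun_prop)]
  simp only [zero_dotProduct, add_zero]
  constructor
  · change IndepFun _ (fun z : Path T => R z.1) _
    -- At the first time the conditioning is void; otherwise `r` is the preceding time, and `UpTo r`
    -- and `Before t` contain the same times.
    rcases Nat.eq_zero_or_pos t.val with ht | ht
    · have hc : (fun z : Path T => (before t z.1, before t z.2)) = fun _ => 0 := by
        have : IsEmpty (Before t) := ⟨fun s => by have := Fin.lt_def.1 s.2; omega⟩
        ext z s <;> exact isEmptyElim s
      rw [hc]
      exact indepFun_const_left _ _
    · let r : Fin T := ⟨t.val - 1, by omega⟩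
      have hrt : r < t := Fin.lt_def.2 (by change t.val - 1 < t.val; omega)
      have hle (s : Fin T) : s ≤ r ↔ s < t := by
        rw [Fin.le_def, Fin.lt_def]
        change s.val ≤ t.val - 1 ↔ _
        omega
      let e (q : Before t) : UpTo r := ⟨q.1, (hle _).2 q.2⟩
      let B : (UpTo r → ℝ) → (Before t → ℝ) := fun x q => x (e q)
      have hB : Measurable B := by fun_prop
      have hBu (u : Fin T → ℝ) : B (upTo r u) = before t u := rfl
      let W : (Fin T → ℝ) → ℝ := fun u => innovation (A r) u ⟨t, hrt⟩
      have hW : IndepFun (upTo r) W μ := (hA r).comp measurable_id (measurable_pi_apply _)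
      have hRi : IndepFun (upTo r) R μ := by
        let e' (q : UpTo r) : Before t := ⟨q.1, (hle _).1 q.2⟩
        exact h1.1.comp (φ := fun (x : Before t → ℝ) q => x (e' q)) (by fun_prop) measurable_id
      let g : (UpTo r → ℝ) → ℝ := fun x => A r x ⟨t, hrt⟩ - (a.K ⬝ᵥ B x + a.m)
      have hg : Measurable g := by
        simp only [g, dotProduct]
        fun_prop
      have h2 : MemLp R 2 μ := by
        have hL (L : StrongDual ℝ (Fin T → ℝ)) : MemLp L 2 μ :=
          IsGaussian.memLp_dual μ L 2 (by norm_num)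
        have := (hL (.proj t - (dotL a.K).comp (beforeL t))).sub (memLp_const a.m)
        refine this.ae_eq (.of_forall fun u => ?_)
        rw [hR]
        change u t - dotL a.K (before t u) - a.m = u t - (a.K ⬝ᵥ before t u + a.m)
        rw [dotL_apply]
        ring
      have h2W : MemLp W 2 μ :=
        IsGaussian.memLp_dual μ ((ContinuousLinearMap.proj (R := ℝ)
          (φ := fun _ : After r => ℝ) ⟨t, hrt⟩).comp (innovationL (A r))) 2 (by norm_num)
      obtain ⟨c, hc⟩ := ae_eq_const_of_indepFun_add hg hRi hW h2 h2W (fun u => by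
        rw [hR]
        change u t - (a.K ⬝ᵥ before t u + a.m) = u t - A r (upTo r u) ⟨t, hrt⟩ +
          (A r (upTo r u) ⟨t, hrt⟩ - (a.K ⬝ᵥ before t u + a.m))
        ring)
      have hc' : ∀ᵐ z ∂(π : Measure (Path T)), W z.1 + c = R z.1 := by
        rw [← hπ1] at hc
        filter_upwards [ae_of_ae_map measurable_fst.aemeasurable hc] with z hz
        exact hz.symm
      refine IndepFun.congr ?_ (.of_forall fun _ => rfl) hc'
      exact (hπ2 r).comp (φ := fun p => (B p.1, B p.2))
        (ψ := fun w : After r → ℝ => w ⟨t, hrt⟩ + c) (by fun_prop) (by fun_prop)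
  · change (π : Measure (Path T)).map (R ∘ Prod.fst) = _
    rw [← Measure.map_map hRm measurable_fst, hπ1]
    exact h1.2

end Input

/-! ### Reweighting causal couplings -/

section Reweight

theorem map_withDensity_comp {Ω X : Type*} [MeasurableSpace Ω] [MeasurableSpace X] (P : Measure Ω)
    {f : Ω → X} (hf : Measurable f) {H : X → ℝ≥0∞} (hH : Measurable H) :
    (P.withDensity (H ∘ f)).map f = (P.map f).withDensity H := by
  ext s hs
  rw [Measure.map_apply hf hs, withDensity_apply _ (hf hs), withDensity_apply _ hs,
    setLIntegral_map hs hH hf]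
  rfl

theorem map_prodMk_withDensity_of_indepFun {Ω X Y : Type*} [MeasurableSpace Ω] [MeasurableSpace X]
    [MeasurableSpace Y] {P : Measure Ω} [IsProbabilityMeasure P] {f : Ω → X} {g : Ω → Y}
    (hf : Measurable f) (hg : Measurable g) (h : IndepFun f g P) {H : X → ℝ≥0∞}
    (hH : Measurable H) [IsProbabilityMeasure (P.withDensity (H ∘ f))] :
    (P.withDensity (H ∘ f)).map (fun ω => (f ω, g ω)) =
      ((P.withDensity (H ∘ f)).map f).prod (P.map g) := by
  have := Measure.isProbabilityMeasure_map (μ := P) hf.aemeasurable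
  have := Measure.isProbabilityMeasure_map (μ := P) hg.aemeasurable
  have h1 := map_withDensity_comp P (hf.prodMk hg) (hH.comp measurable_fst)
  change (P.withDensity (H ∘ f)).map (fun ω => (f ω, g ω)) = _ at h1
  rw [indepFun_iff_map_prod_eq_prod_map_map hf.aemeasurable hg.aemeasurable] at h
  rw [h1, h, map_withDensity_comp P hf hH, prod_withDensity_left hH]
  rfl

variable {T : ℕ} {μ : Measure (Fin T → ℝ)} [IsGaussian μ]

/-- Changing the conditional law of `Y_t` given `(U_{1:t}, Y_{1:t-1})` preserves causality. -/
theorem mem_causalCouplings_of_withDensity {π π' : ProbabilityMeasure (Path T)}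
    (hπ : π ∈ causalCouplings μ) (t : Fin T) {H : ((UpTo t → ℝ) × (Before t → ℝ)) × ℝ → ℝ≥0∞}
    (hH : Measurable H)
    (hπ' : (π' : Measure (Path T)) =
      (π : Measure (Path T)).withDensity fun z => H (regressor t z, z.2 t))
    (hreg : (π' : Measure (Path T)).map (regressor t) = (π : Measure (Path T)).map (regressor t)) :
    π' ∈ causalCouplings μ := by
  obtain ⟨A, hA⟩ := exists_isRegression μ
  rw [mem_causalCouplings_iff hA] at hπ ⊢
  obtain ⟨hπ1, hπ2⟩ := hπ
  -- For s ≥ t the density is a function of `past s`, so the innovation at s keeps its law and its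
  -- independence.
  have hlater (s : Fin T) (hts : t ≤ s) :
      (π' : Measure (Path T)).map (fun z => (past s z, innovation (A s) z.1)) =
        ((π' : Measure (Path T)).map (past s)).prod
          ((π : Measure (Path T)).map fun z => innovation (A s) z.1) := by
    let r : (UpTo s → ℝ) × (UpTo s → ℝ) → ((UpTo t → ℝ) × (Before t → ℝ)) × ℝ := fun p =>
      ((fun q => p.1 ⟨q.1, q.2.trans hts⟩, fun q => p.2 ⟨q.1, q.2.le.trans hts⟩), p.2 ⟨t, hts⟩)
    have hr : Measurable r := by fun_prop
    have hd : (π' : Measure (Path T)) = (π : Measure (Path T)).withDensity ((H ∘ r) ∘ past s) := hπ'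
    have : IsProbabilityMeasure ((π : Measure (Path T)).withDensity ((H ∘ r) ∘ past s)) := by
      rw [← hd]; infer_instance
    rw [hd]
    exact map_prodMk_withDensity_of_indepFun (by fun_prop) (by fun_prop) (hπ2 s) (hH.comp hr)
  have hprobW (s : Fin T) : IsProbabilityMeasure
      ((π : Measure (Path T)).map fun z => innovation (A s) z.1) :=
    Measure.isProbabilityMeasure_map (by fun_prop)
  have hprobP (s : Fin T) : IsProbabilityMeasure ((π' : Measure (Path T)).map (past s)) :=
    Measure.isProbabilityMeasure_map (by fun_prop)
  -- Neither the law of the regressor nor that of the innovation at t changes, and both couplings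
  -- make them independent.
  have hsame : (π' : Measure (Path T)).map (fun z => (regressor t z, innovation (A t) z.1)) =
      (π : Measure (Path T)).map (fun z => (regressor t z, innovation (A t) z.1)) := by
    let r : (UpTo t → ℝ) × (UpTo t → ℝ) → (UpTo t → ℝ) × (Before t → ℝ) := fun p =>
      (p.1, fun q => p.2 ⟨q.1, q.2.le⟩)
    have hr : Measurable r := by fun_prop
    have hi : IndepFun (regressor t) (fun z => innovation (A t) z.1) (π : Measure (Path T)) :=
      (hπ2 t).comp (φ := r) hr measurable_id
    rw [indepFun_iff_map_prod_eq_prod_map_map (by fun_prop) (by fun_prop)] at hi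
    have h1 := congrArg (Measure.map (Prod.map r id)) (hlater t le_rfl)
    rw [← Measure.map_prod_map _ _ hr measurable_id, Measure.map_id,
      Measure.map_map hr (by fun_prop), Measure.map_map (by fun_prop) (by fun_prop)] at h1
    rw [hi, ← hreg]
    exact h1
  -- The whole input path is recovered from u_{1:t} and the innovation at t. Hence `hsame` transfers
  -- the joint law of (u, y_{1:t-1}), which contains the input marginal and causality at all times
  -- before t.
  let Ψ : ((UpTo t → ℝ) × (Before t → ℝ)) × (After t → ℝ) → Fin T → ℝ := fun p s =>
    if h : s ≤ t then p.1.1 ⟨s, h⟩ else p.2 ⟨s, not_le.1 h⟩ + A t p.1.1 ⟨s, not_le.1 h⟩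
  have hΨ : Measurable Ψ := by
    refine measurable_pi_lambda _ fun s => ?_
    by_cases h : s ≤ t
    · simp only [Ψ, h, dite_true]
      fun_prop
    · simp only [Ψ, h, dite_false]
      fun_prop
  have hΨ_eq (z : Path T) : Ψ (regressor t z, innovation (A t) z.1) = z.1 := by
    ext s
    by_cases h : s ≤ t
    · simp only [Ψ, h, dite_true]
      rfl
    · simp only [Ψ, h, dite_false]
      change z.1 s - A t (upTo t z.1) _ + A t (upTo t z.1) _ = _
      ring
  refine ⟨?_, fun s => ?_⟩
  · have h1 := congrArg (Measure.map Ψ) hsame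
    rw [Measure.map_map hΨ (by fun_prop), Measure.map_map hΨ (by fun_prop)] at h1
    simp only [Function.comp_def, hΨ_eq] at h1
    rw [← hπ1]
    exact h1
  · rcases le_or_gt t s with hts | hst
    · rw [indepFun_iff_map_prod_eq_prod_map_map (by fun_prop) (by fun_prop)]
      have h1 := congrArg (Measure.map Prod.snd) (hlater s hts)
      rw [Measure.map_snd_prod, measure_univ, one_smul, Measure.map_map (by fun_prop)
        (by fun_prop)] at h1
      change (π' : Measure (Path T)).map (fun z => innovation (A s) z.1) = _ at h1
      rw [hlater s hts, h1]
    · let r : ((UpTo t → ℝ) × (Before t → ℝ)) × (After t → ℝ) →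
          (UpTo s → ℝ) × (UpTo s → ℝ) := fun p =>
        (fun q => p.1.1 ⟨q.1, q.2.trans hst.le⟩, fun q => p.1.2 ⟨q.1, q.2.trans_lt hst⟩)
      have hr : Measurable r := by fun_prop
      have h2 : IndepFun r (innovation (A s) ∘ Ψ)
          ((π : Measure (Path T)).map fun z => (regressor t z, innovation (A t) z.1)) := by
        rw [indepFun_iff_map_prod_eq_prod_map_map (by fun_prop) (by fun_prop),
          Measure.map_map (by fun_prop) (by fun_prop), Measure.map_map (by fun_prop) (by fun_prop),
          Measure.map_map (by fun_prop) (by fun_prop)]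
        simp only [Function.comp_def, hΨ_eq]
        exact (indepFun_iff_map_prod_eq_prod_map_map (by fun_prop) (by fun_prop)).1 (hπ2 s)
      rw [← hsame, indepFun_iff_map_prod_eq_prod_map_map (by fun_prop) (by fun_prop),
          Measure.map_map (by fun_prop) (by fun_prop), Measure.map_map (by fun_prop) (by fun_prop),
          Measure.map_map (by fun_prop) (by fun_prop)] at h2
      simp only [Function.comp_def, hΨ_eq] at h2
      exact (indepFun_iff_map_prod_eq_prod_map_map (by fun_prop) (by fun_prop)).2 h2

end Reweight

/-! ### Divergences between Gaussian conditional laws -/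

section ShearDivergence

theorem map_shear_congr {X E : Type*} [MeasurableSpace X] [AddGroup E] [MeasurableSpace E]
    (P : Measure X) [IsProbabilityMeasure P] (ν : Measure E) [IsProbabilityMeasure ν]
    {h h' : X → E} (hh : h =ᵐ[P] h') :
    (P.prod ν).map (shear h) = (P.prod ν).map (shear h') := by
  refine Measure.map_congr ?_
  have := Measure.quasiMeasurePreserving_fst (μ := P) (ν := ν) |>.ae hh
  filter_upwards [this] with p hp
  simp only [shear, hp]

variable {X E : Type*} [MeasurableSpace X] [NormedAddCommGroup E] [MeasurableSpace E]
  [BorelSpace E] [SecondCountableTopology E]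

theorem isProbabilityMeasure_map_shear (ρ : Measure X) [IsProbabilityMeasure ρ] (ν : Measure E)
    [IsProbabilityMeasure ν] {h : X → E} (hh : Measurable h) :
    IsProbabilityMeasure ((ρ.prod ν).map (shear h)) :=
  Measure.isProbabilityMeasure_map (measurable_shear hh).aemeasurable

theorem klDiv_map_shear_eq_add (P Q : Measure X) [IsProbabilityMeasure P] [IsProbabilityMeasure Q]
    (ν ν' : Measure E) [IsProbabilityMeasure ν] [IsProbabilityMeasure ν'] {h h' : X → E}
    (hh : Measurable h) (hh' : Measurable h') :
    klDiv ((P.prod ν).map (shear h)) ((Q.prod ν').map (shear h')) =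
      klDiv P Q + klDiv ((P.prod ν).map (shear h)) ((P.prod ν').map (shear h')) := by
  simp_rw [← compProd_shiftKernel _ hh, ← compProd_shiftKernel _ hh']
  exact klDiv_compProd_eq_add _ _ _ _

theorem klDiv_map_shear_map_shear (P : Measure X) [IsProbabilityMeasure P]
    (ν ν' : Measure E) [IsProbabilityMeasure ν] [IsProbabilityMeasure ν'] {h h' : X → E}
    (hh : Measurable h) (hh' : Measurable h') :
    klDiv ((P.prod ν).map (shear h)) ((P.prod ν').map (shear h')) =
      klDiv ((P.prod ν).map (shear fun x => h x - h' x)) (P.prod ν') := by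
  have hd : Measurable fun x => h x - h' x := hh.sub hh'
  have := isProbabilityMeasure_map_shear P ν hd
  rw [← klDiv_map_eq_of_leftInverse (measurable_shear hh') (measurable_shear hh'.neg)
    (shear_leftInverse h') _ (P.prod ν'), Measure.map_map (measurable_shear hh')
      (measurable_shear hd)]
  congr 2
  ext1 p
  refine Prod.ext rfl ?_
  simp only [shear, Function.comp_apply]
  abel

end ShearDivergence

/-! ### Divergence between normal kernels on the line -/

section GaussianReal

theorem klDiv_gaussianReal {s σ : ℝ≥0} (hs : s ≠ 0) (hσ : σ ≠ 0) :
    klDiv (gaussianReal 0 s) (gaussianReal 0 σ) =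
      ENNReal.ofReal ((s / σ - 1 - Real.log (s / σ)) / 2) := by
  have hs' : (0 : ℝ) < s := NNReal.coe_pos.2 (pos_iff_ne_zero.2 hs)
  have hσ' : (0 : ℝ) < σ := NNReal.coe_pos.2 (pos_iff_ne_zero.2 hσ)
  set l : ℝ → ℝ := fun x => ((σ : ℝ)⁻¹ - (s : ℝ)⁻¹) / 2 * x ^ 2 - Real.log (s / σ) / 2 with hl
  have hdens : gaussianReal 0 s =
      (gaussianReal 0 σ).withDensity fun x => ENNReal.ofReal (Real.exp (l x)) := by
    rw [gaussianReal_of_var_ne_zero _ hs, gaussianReal_of_var_ne_zero _ hσ,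
      ← withDensity_mul _ (measurable_gaussianPDF _ _) (by fun_prop)]
    congr 1
    ext x
    rw [Pi.mul_apply, gaussianPDF, gaussianPDF, ← ENNReal.ofReal_mul (gaussianPDFReal_nonneg _ _ _),
      gaussianPDFReal, gaussianPDFReal]
    congr 1
    have h1 : Real.exp (l x) = Real.exp (-(x - 0) ^ 2 / (2 * s)) * Real.exp ((x - 0) ^ 2 / (2 * σ)) *
        (√s)⁻¹ * √σ := by
      have h2 : (√(s : ℝ))⁻¹ * √(σ : ℝ) = Real.exp (-(Real.log (s / σ) / 2)) := by
        rw [Real.log_div hs'.ne' hσ'.ne', ← Real.exp_log (Real.sqrt_pos.2 hs'),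
          ← Real.exp_log (Real.sqrt_pos.2 hσ'), ← Real.exp_neg, ← Real.exp_add,
          Real.log_sqrt hs'.le, Real.log_sqrt hσ'.le]
        congr 1
        ring
      rw [mul_assoc, h2, ← Real.exp_add, ← Real.exp_add]
      congr 1
      simp only [hl]
      field_simp
      ring
    have h3 : Real.exp (-(x - 0) ^ 2 / (2 * σ)) * Real.exp ((x - 0) ^ 2 / (2 * σ)) = 1 := by
      rw [← Real.exp_add, ← Real.exp_zero]
      congr 1
      ring
    rw [h1, Real.sqrt_mul (x := 2 * Real.pi) (by positivity),
      Real.sqrt_mul (x := 2 * Real.pi) (by positivity)]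
    have h4 : √(σ : ℝ) * (√(σ : ℝ))⁻¹ = 1 := mul_inv_cancel₀ (Real.sqrt_pos.2 hσ').ne'
    rw [mul_inv, mul_inv]
    calc (√(2 * Real.pi))⁻¹ * (√(s : ℝ))⁻¹ * Real.exp (-(x - 0) ^ 2 / (2 * s))
        = (√(2 * Real.pi))⁻¹ * (√(s : ℝ))⁻¹ * Real.exp (-(x - 0) ^ 2 / (2 * s)) *
          (√(σ : ℝ) * (√(σ : ℝ))⁻¹) *
          (Real.exp (-(x - 0) ^ 2 / (2 * σ)) * Real.exp ((x - 0) ^ 2 / (2 * σ))) := by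
            rw [h3, h4]; ring
      _ = _ := by ring
  have hsq : Integrable (fun x : ℝ => x ^ 2) (gaussianReal 0 s) :=
    (memLp_id_gaussianReal' 2 (by norm_num)).integrable_sq
  have hsqv : ∫ x, x ^ 2 ∂(gaussianReal 0 s) = s := by
    have := variance_of_integral_eq_zero (μ := gaussianReal 0 s) (X := fun x => x) (by fun_prop)
      integral_id_gaussianReal
    rw [← this]
    exact variance_fun_id_gaussianReal
  have hint : Integrable l (gaussianReal 0 s) :=
    (hsq.const_mul _).sub (integrable_const _)
  have hval : ∫ x, l x ∂(gaussianReal 0 s) = (s / σ - 1 - Real.log (s / σ)) / 2 := by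
    simp only [hl]
    rw [integral_sub (hsq.const_mul _) (integrable_const _), integral_const_mul, hsqv]
    simp
    field_simp
  have hnn : 0 ≤ ((s : ℝ) / σ - 1 - Real.log (s / σ)) / 2 := by
    have := Real.log_le_sub_one_of_pos (div_pos hs' hσ')
    linarith
  -- The tilted law is the first argument itself, so only the integral of the log-density remains.
  rw [klDiv_eq_add_of_withDensity_exp (by fun_prop) hdens hint (by rw [hval]; exact hnn),
    klDiv_self, zero_add, hval]

variable {X : Type*} [MeasurableSpace X]

theorem klDiv_map_shear_gaussianReal (ρ : Measure X) [IsProbabilityMeasure ρ] {s σ : ℝ≥0}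
    (hs : s ≠ 0) (hσ : σ ≠ 0) {m m' : X → ℝ} (hm : Measurable m) (hm' : Measurable m')
    (h2 : MemLp (fun x => m x - m' x) 2 ρ) :
    klDiv ((ρ.prod (gaussianReal 0 s)).map (shear m)) ((ρ.prod (gaussianReal 0 σ)).map (shear m')) =
      ENNReal.ofReal ((s / σ - 1 - Real.log (s / σ)) / 2) +
        ENNReal.ofReal ((∫ x, (m x - m' x) ^ 2 / σ ∂ρ) / 2) := by
  have hσ' : (0 : ℝ) < σ := NNReal.coe_pos.2 (pos_iff_ne_zero.2 hσ)
  let L (x : X) : StrongDual ℝ ℝ := ((m x - m' x) / σ) • .id ℝ ℝ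
  have hLv (x : X) : L x (m x - m' x) = (m x - m' x) ^ 2 / σ := by
    simp only [L, FunLike.coe_smul, Pi.smul_apply, ContinuousLinearMap.id_apply, smul_eq_mul]
    ring
  have hid : Integrable (fun z : ℝ => z) (gaussianReal 0 s) :=
    (memLp_id_gaussianReal' 1 (by norm_num)).integrable le_rfl
  have hd1 : Integrable (fun x => (m x - m' x) / σ) ρ :=
    (h2.integrable (by norm_num)).div_const _
  rw [klDiv_map_shear_map_shear ρ _ _ hm hm',
    klDiv_map_shear_prod ρ (P := gaussianReal 0 s) (ν := gaussianReal 0 σ) (L := L)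
      (by simp) hid
      (by simp) (by fun_prop)
      (by simp only [L, FunLike.coe_smul, Pi.smul_apply, ContinuousLinearMap.id_apply, smul_eq_mul]
          fun_prop) ?_ ?_ ?_, klDiv_gaussianReal hs hσ]
  · simp_rw [hLv]
  · intro x M
    have hM : M = M 1 • .id ℝ ℝ := by ext; simp
    have hv : covarianceBilinDual (gaussianReal 0 σ) (.id ℝ ℝ) (.id ℝ ℝ) = σ := by
      rw [covarianceBilinDual_self_eq_variance IsGaussian.memLp_two_id]
      exact variance_fun_id_gaussianReal
    have h1 : M (m x - m' x) = (m x - m' x) * M 1 := by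
      rw [← smul_eq_mul, ← map_smul, smul_eq_mul, mul_one]
    rw [h1]
    conv_rhs => rw [hM]
    simp only [L, map_smul, FunLike.coe_smul, Pi.smul_apply, smul_eq_mul, hv]
    field_simp
  · simpa [L] using hd1.mul_prod hid
  · simp_rw [hLv]
    exact h2.integrable_sq.div_const _

end GaussianReal

/-! ### Divergence between Gaussian kernels with singular covariance -/

section GaussianVecDivergence

variable {X ι : Type*} [MeasurableSpace X] [Fintype ι] [DecidableEq ι]

/-- By `hG` the vector w = G(h - h') solves S w = h - h', so `dotL w` is the Cameron-Martin
functional and the cost is half the mean of wᵀSw. Writing it with Gᵀ S G gives a symmetric positive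
semidefinite form even if `G` is neither. -/
theorem klDiv_map_shear_gaussianVec (ρ : Measure X) [IsProbabilityMeasure ρ] {S S' G : Matrix ι ι ℝ}
    (hS : S.PosSemidef) {h h' : X → ι → ℝ} (hh : Measurable h) (hh' : Measurable h')
    (h2 : ∀ i, MemLp (fun x => h x i - h' x i) 2 ρ)
    (hG : ∀ᵐ x ∂ρ, S *ᵥ (G *ᵥ (h x - h' x)) = h x - h' x) :
    klDiv ((ρ.prod (gaussianVec 0 S')).map (shear h)) ((ρ.prod (gaussianVec 0 S)).map (shear h')) =
      klDiv (gaussianVec 0 S') (gaussianVec 0 S) +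
        ENNReal.ofReal ((∫ x, (h x - h' x) ⬝ᵥ ((Gᵀ * S * G) *ᵥ (h x - h' x)) ∂ρ) / 2) := by
  let w (x : X) : ι → ℝ := G *ᵥ (h x - h' x)
  have hq (x : X) : dotL (w x) (S *ᵥ w x) =
      (h x - h' x) ⬝ᵥ ((Gᵀ * S * G) *ᵥ (h x - h' x)) := by
    simp only [w]
    rw [dotL_apply, dotProduct_comm (h x - h' x), ← mulVec_mulVec, ← mulVec_mulVec,
      mulVec_transpose, ← dotProduct_mulVec, dotProduct_comm]
  have hw2 (i : ι) : MemLp (fun x => w x i) 2 ρ := by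
    simp only [w, mulVec, dotProduct]
    exact memLp_finsetSum _ fun j _ => (h2 j).const_mul _
  have hSw2 (i : ι) : MemLp (fun x => (S *ᵥ w x) i) 2 ρ := by
    simp only [mulVec, dotProduct]
    exact memLp_finsetSum _ fun j _ => (hw2 j).const_mul _
  have hwm : Measurable w := by
    fun_prop
  have hSwm : Measurable fun x => S *ᵥ w x := by
    fun_prop
  have hid : Integrable id (gaussianVec 0 S') := IsGaussian.integrable_id
  have hidi (i : ι) : Integrable (fun z : ι → ℝ => z i) (gaussianVec 0 S') :=
    (ContinuousLinearMap.proj (R := ℝ) (φ := fun _ : ι => ℝ) i).integrable_comp hid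
  rw [klDiv_map_shear_map_shear ρ _ _ hh hh', map_shear_congr ρ (gaussianVec 0 S')
    (h := fun x => h x - h' x) (h' := fun x => S *ᵥ w x) (by
      filter_upwards [hG] with x hx using hx.symm),
    klDiv_map_shear_prod ρ (P := gaussianVec 0 S') (ν := gaussianVec 0 S)
      (L := fun x => dotL (w x)) (integral_id_gaussianVec 0 S) hid (integral_id_gaussianVec 0 S')
      hSwm (by simp only [dotL_apply, dotProduct]; fun_prop)
      (fun x M => (covarianceBilinDual_gaussianVec 0 hS (w x) M).symm) ?_ ?_]
  · simp_rw [hq]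
  · simp only [dotL_apply, dotProduct]
    exact integrable_finsetSum _ fun i _ => ((hw2 i).integrable (by norm_num)).mul_prod (hidi i)
  · simp only [dotL_apply, dotProduct]
    exact integrable_finsetSum _ fun i _ => (hw2 i).integrable_mul (hSw2 i)

end GaussianVecDivergence

/-! ### Optimizing the conditional law of one output -/

section OneStep

variable {X ι : Type*} [MeasurableSpace X]

/-- The law of `(x, y, f)` where `x` has law `ρ`, `y` has law `N(m x, s)` given `x`, and `f` has law
`N(h (x, y), S)` given `(x, y)`. -/
def twoStepLaw [Fintype ι] [DecidableEq ι] (ρ : Measure X) (m : X → ℝ) (s : ℝ≥0)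
    (h : X × ℝ → ι → ℝ) (S : Matrix ι ι ℝ) :
    Measure ((X × ℝ) × (ι → ℝ)) :=
  (((ρ.prod (gaussianReal 0 s)).map (shear m)).prod (gaussianVec 0 S)).map (shear h)

theorem dotProduct_mulVec_smul_add [Fintype ι] {H : Matrix ι ι ℝ} (hH : Hᵀ = H) (y : ℝ)
    (δ r : ι → ℝ) :
    (y • δ + r) ⬝ᵥ (H *ᵥ (y • δ + r)) =
      (δ ⬝ᵥ (H *ᵥ δ)) * y ^ 2 + 2 * (δ ⬝ᵥ (H *ᵥ r)) * y + r ⬝ᵥ (H *ᵥ r) := by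
  have h : r ⬝ᵥ (H *ᵥ δ) = δ ⬝ᵥ (H *ᵥ r) := by
    rw [dotProduct_mulVec, ← mulVec_transpose, hH, dotProduct_comm]
  simp only [mulVec_add, mulVec_smul, add_dotProduct, dotProduct_add, smul_dotProduct,
    dotProduct_smul, smul_eq_mul, h]
  ring

variable {ρ : Measure X} [IsProbabilityMeasure ρ] {m : X → ℝ} {s : ℝ≥0} {r : X → ι → ℝ}

theorem memLp_smul_add_map_shear (hm : Measurable m) (hr : Measurable r) (hm2 : MemLp m 2 ρ)
    (hr2 : ∀ i, MemLp (fun x => r x i) 2 ρ) (δ : ι → ℝ) (i : ι) :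
    MemLp (fun p : X × ℝ => (p.2 • δ + r p.1) i) 2
      ((ρ.prod (gaussianReal 0 s)).map (shear m)) := by
  have hri : Measurable fun x => r x i := by fun_prop
  rw [memLp_map_measure_iff (by
    simp only [Pi.add_apply, Pi.smul_apply, smul_eq_mul]
    exact ((measurable_snd.mul_const _).add (hri.comp measurable_fst)).aestronglyMeasurable)
    (measurable_shear hm).aemeasurable]
  have h1 : MemLp (fun p : X × ℝ => m p.1) 2 (ρ.prod (gaussianReal 0 s)) :=
    hm2.comp_measurePreserving measurePreserving_fst
  have h2 : MemLp (fun p : X × ℝ => r p.1 i) 2 (ρ.prod (gaussianReal 0 s)) :=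
    (hr2 i).comp_measurePreserving measurePreserving_fst
  have h3 : MemLp (fun p : X × ℝ => p.2) 2 (ρ.prod (gaussianReal 0 s)) :=
    (memLp_id_gaussianReal' 2 (by norm_num)).comp_measurePreserving measurePreserving_snd
  exact ((h1.add h3).mul_const (δ i)).add h2

theorem integral_map_shear_gaussianReal (hm : Measurable m) (hm2 : MemLp m 2 ρ) {b q : X → ℝ}
    (hb : Measurable b) (hq : Measurable q) (hb2 : MemLp b 2 ρ) (hqi : Integrable q ρ) (a : ℝ) :
    ∫ p, (a * p.2 ^ 2 + 2 * b p.1 * p.2 + q p.1) ∂((ρ.prod (gaussianReal 0 s)).map (shear m)) =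
      ∫ x, (a * (m x ^ 2 + s) + 2 * b x * m x + q x) ∂ρ := by
  have hsq : Integrable (fun x : ℝ => x ^ 2) (gaussianReal 0 s) :=
    (memLp_id_gaussianReal' 2 (by norm_num)).integrable_sq
  have hsqv : ∫ x, x ^ 2 ∂(gaussianReal 0 s) = s := by
    have := variance_of_integral_eq_zero (μ := gaussianReal 0 s) (X := fun x => x) (by fun_prop)
      integral_id_gaussianReal
    rw [← this]
    exact variance_fun_id_gaussianReal
  have hid : Integrable (fun z : ℝ => z) (gaussianReal 0 s) :=
    (memLp_id_gaussianReal' 1 (by norm_num)).integrable le_rfl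
  have hA : Integrable (fun x => a * m x ^ 2 + 2 * b x * m x + q x) ρ := by
    refine Integrable.add (Integrable.add (hm2.integrable_sq.const_mul a) ?_) hqi
    simp_rw [mul_assoc]
    exact (hb2.integrable_mul hm2).const_mul 2
  have hB : Integrable (fun x => 2 * a * m x + 2 * b x) ρ :=
    ((hm2.integrable (by norm_num)).const_mul _).add ((hb2.integrable (by norm_num)).const_mul _)
  rw [integral_map (measurable_shear hm).aemeasurable (by fun_prop)]
  have h1 : ∀ p : X × ℝ, a * (shear m p).2 ^ 2 + 2 * b (shear m p).1 * (shear m p).2 +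
      q (shear m p).1 = (a * m p.1 ^ 2 + 2 * b p.1 * m p.1 + q p.1) + a * p.2 ^ 2 +
        (2 * a * m p.1 + 2 * b p.1) * p.2 := by
    intro p
    simp only [shear]
    ring
  simp_rw [h1]
  have hA' := hA.comp_fst (gaussianReal 0 s)
  have hS' := (hsq.const_mul a).comp_snd ρ
  have hAS : Integrable (fun p : X × ℝ => (a * m p.1 ^ 2 + 2 * b p.1 * m p.1 + q p.1) + a * p.2 ^ 2)
      (ρ.prod (gaussianReal 0 s)) := hA'.add hS'
  rw [integral_add hAS (hB.mul_prod hid), integral_add hA' hS',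
    integral_fun_fst (μ := ρ) (ν := gaussianReal 0 s)
      (fun x => a * m x ^ 2 + 2 * b x * m x + q x),
    integral_fun_snd (μ := ρ) (ν := gaussianReal 0 s) (fun z => a * z ^ 2),
    integral_prod_mul (μ := ρ) (ν := gaussianReal 0 s) (fun x => 2 * a * m x + 2 * b x) (fun z => z)]
  simp only [probReal_univ, one_smul, integral_const_mul, hsqv, integral_id_gaussianReal, mul_zero,
    add_zero]
  have h2 : ∀ x, a * (m x ^ 2 + s) + 2 * b x * m x + q x =
      (a * m x ^ 2 + 2 * b x * m x + q x) + a * s := fun x => by ring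
  simp_rw [h2]
  rw [integral_add hA (integrable_const _)]
  simp

variable [Fintype ι] [DecidableEq ι]

/-- Chain rule applied twice. Only the last bracket depends on `m` and `s`: the divergence of the
y-kernels, and the cost of the mismatch of the future means, a quadratic polynomial in y integrated
against N(m, s). -/
theorem klDiv_twoStepLaw {ρ' : Measure X} [IsProbabilityMeasure ρ'] {m' : X → ℝ} {σ : ℝ≥0}
    {h h' : X × ℝ → ι → ℝ} {S S' G : Matrix ι ι ℝ} {δ : ι → ℝ}
    (hs : s ≠ 0) (hσ : σ ≠ 0) (hS : S.PosSemidef) (hm : Measurable m) (hm' : Measurable m')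
    (hr : Measurable r) (hh : Measurable h) (hh' : Measurable h') (hm2 : MemLp m 2 ρ)
    (hm2' : MemLp m' 2 ρ) (hr2 : ∀ i, MemLp (fun x => r x i) 2 ρ)
    (hd : ∀ p, h p - h' p = p.2 • δ + r p.1)
    (hG : ∀ᵐ p ∂((ρ.prod (gaussianReal 0 s)).map (shear m)),
      S *ᵥ (G *ᵥ (h p - h' p)) = h p - h' p) :
    klDiv (twoStepLaw ρ m s h S') (twoStepLaw ρ' m' σ h' S) =
      klDiv ρ ρ' + klDiv (gaussianVec 0 S') (gaussianVec 0 S) +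
        (ENNReal.ofReal ((s / σ - 1 - Real.log (s / σ)) / 2) +
          ENNReal.ofReal ((∫ x, (m x - m' x) ^ 2 / σ ∂ρ) / 2) +
          ENNReal.ofReal ((∫ x, ((δ ⬝ᵥ ((Gᵀ * S * G) *ᵥ δ)) * (m x ^ 2 + s) +
            2 * (δ ⬝ᵥ ((Gᵀ * S * G) *ᵥ r x)) * m x + r x ⬝ᵥ ((Gᵀ * S * G) *ᵥ r x)) ∂ρ) / 2)) := by
  have hp1 := isProbabilityMeasure_map_shear ρ (gaussianReal 0 s) hm
  have hp2 := isProbabilityMeasure_map_shear ρ' (gaussianReal 0 σ) hm'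
  have hH : (Gᵀ * S * G)ᵀ = Gᵀ * S * G := by
    have := hS.isHermitian
    rw [Matrix.IsHermitian, conjTranspose_eq_transpose_of_trivial] at this
    rw [transpose_mul, transpose_mul, transpose_transpose, this, Matrix.mul_assoc]
  have hHr2 (i : ι) : MemLp (fun x => ((Gᵀ * S * G) *ᵥ r x) i) 2 ρ := by
    simp only [mulVec, dotProduct]
    exact memLp_finsetSum _ fun j _ => (hr2 j).const_mul _
  have hb2 : MemLp (fun x => δ ⬝ᵥ ((Gᵀ * S * G) *ᵥ r x)) 2 ρ := by
    simp only [dotProduct]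
    exact memLp_finsetSum _ fun j _ => (hHr2 j).const_mul _
  have hqi : Integrable (fun x => r x ⬝ᵥ ((Gᵀ * S * G) *ᵥ r x)) ρ := by
    simp only [dotProduct]
    exact integrable_finsetSum _ fun i _ => (hr2 i).integrable_mul (hHr2 i)
  have hHr : Measurable fun x => (Gᵀ * S * G) *ᵥ r x := by fun_prop
  rw [twoStepLaw, twoStepLaw, klDiv_map_shear_eq_add _ _ _ _ hh hh',
    klDiv_map_shear_eq_add _ _ _ _ hm hm',
    klDiv_map_shear_gaussianReal ρ hs hσ hm hm' (hm2.sub hm2'),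
    klDiv_map_shear_gaussianVec _ hS hh hh' (fun i => by
      have hdi (p : X × ℝ) : h p i - h' p i = (p.2 • δ + r p.1) i := by rw [← hd]; rfl
      simp_rw [hdi]
      exact memLp_smul_add_map_shear hm hr hm2 hr2 δ i) hG]
  simp_rw [hd, dotProduct_mulVec_smul_add hH]
  rw [integral_map_shear_gaussianReal hm hm2 (by simp only [dotProduct]; fun_prop)
    (by simp only [dotProduct]; fun_prop) hb2 hqi]
  ring

/-- With p = δᵀHδ and b = δᵀHr for H = GᵀSG, the optimum is the normalized product of the density of
N(m', σ) and exp(-(p y² + 2 b y)/2): its precision is 1/σ + p and its mean solves (1/σ + p) m₀ =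
m'/σ - b. -/
theorem klDiv_twoStepLaw_le {ρ' : Measure X} [IsProbabilityMeasure ρ'] {m' m₀ : X → ℝ}
    {σ s₀ : ℝ≥0} {h h' : X × ℝ → ι → ℝ} {S S' G : Matrix ι ι ℝ} {δ : ι → ℝ}
    (hs : s ≠ 0) (hσ : σ ≠ 0) (hS : S.PosSemidef) (hm : Measurable m) (hm' : Measurable m')
    (hm₀ : Measurable m₀)
    (hr : Measurable r) (hh : Measurable h) (hh' : Measurable h') (hm2 : MemLp m 2 ρ)
    (hm2' : MemLp m' 2 ρ) (hm₀2 : MemLp m₀ 2 ρ) (hr2 : ∀ i, MemLp (fun x => r x i) 2 ρ)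
    (hd : ∀ p, h p - h' p = p.2 • δ + r p.1)
    (hG : ∀ᵐ p ∂((ρ.prod (gaussianReal 0 s)).map (shear m)),
      S *ᵥ (G *ᵥ (h p - h' p)) = h p - h' p)
    (hG₀ : ∀ᵐ p ∂((ρ.prod (gaussianReal 0 s₀)).map (shear m₀)),
      S *ᵥ (G *ᵥ (h p - h' p)) = h p - h' p)
    (hs₀ : (s₀ : ℝ) = σ / (1 + σ * (δ ⬝ᵥ ((Gᵀ * S * G) *ᵥ δ))))
    (hm₀' : ∀ x, m₀ x = (m' x - σ * (δ ⬝ᵥ ((Gᵀ * S * G) *ᵥ r x))) /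
      (1 + σ * (δ ⬝ᵥ ((Gᵀ * S * G) *ᵥ δ)))) :
    klDiv (twoStepLaw ρ m₀ s₀ h S') (twoStepLaw ρ' m' σ h' S) ≤
      klDiv (twoStepLaw ρ m s h S') (twoStepLaw ρ' m' σ h' S) := by
  have hHpos : (Gᵀ * S * G).PosSemidef := by
    have := hS.conjTranspose_mul_mul_same G
    rwa [conjTranspose_eq_transpose_of_trivial] at this
  have hH : (Gᵀ * S * G)ᵀ = Gᵀ * S * G := by
    have := hHpos.isHermitian
    rwa [Matrix.IsHermitian, conjTranspose_eq_transpose_of_trivial] at this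
  have hnn (v : ι → ℝ) : 0 ≤ v ⬝ᵥ ((Gᵀ * S * G) *ᵥ v) := by
    simpa using hHpos.dotProduct_mulVec_nonneg v
  have hσ' : (0 : ℝ) < σ := NNReal.coe_pos.2 (pos_iff_ne_zero.2 hσ)
  have hs' : (0 : ℝ) < s := NNReal.coe_pos.2 (pos_iff_ne_zero.2 hs)
  have hden : 0 < 1 + σ * (δ ⬝ᵥ ((Gᵀ * S * G) *ᵥ δ)) := by
    have := mul_nonneg hσ'.le (hnn δ)
    linarith
  have hs₀' : (0 : ℝ) < s₀ := by rw [hs₀]; positivity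
  have hs₀ne : s₀ ≠ 0 := (pos_iff_ne_zero.1 (NNReal.coe_pos.1 hs₀'))
  rw [klDiv_twoStepLaw hs hσ hS hm hm' hr hh hh' hm2 hm2' hr2 hd hG,
    klDiv_twoStepLaw hs₀ne hσ hS hm₀ hm' hr hh hh' hm₀2 hm2' hr2 hd hG₀]
  refine add_le_add le_rfl ?_
  set H := Gᵀ * S * G with hHdef
  set p := δ ⬝ᵥ (H *ᵥ δ) with hp
  set b : X → ℝ := fun x => δ ⬝ᵥ (H *ᵥ r x) with hb
  set q : X → ℝ := fun x => r x ⬝ᵥ (H *ᵥ r x) with hq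
  have hHr2 (i : ι) : MemLp (fun x => (H *ᵥ r x) i) 2 ρ := by
    simp only [mulVec, dotProduct]
    exact memLp_finsetSum _ fun j _ => (hr2 j).const_mul _
  have hb2 : MemLp b 2 ρ := by
    simp only [hb, dotProduct]
    exact memLp_finsetSum _ fun j _ => (hHr2 j).const_mul _
  have hqi : Integrable q ρ := by
    simp only [hq, dotProduct]
    exact integrable_finsetSum _ fun i _ => (hr2 i).integrable_mul (hHr2 i)
  have hi1 {n : X → ℝ} (hn : MemLp n 2 ρ) : Integrable (fun x => (n x - m' x) ^ 2 / σ) ρ :=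
    (hn.sub hm2').integrable_sq.div_const _
  have hi2 {n : X → ℝ} (hn : MemLp n 2 ρ) (v : ℝ) :
      Integrable (fun x => p * (n x ^ 2 + v) + 2 * b x * n x + q x) ρ := by
    refine Integrable.add (Integrable.add ((hn.integrable_sq.add (integrable_const v)).const_mul p)
      ?_) hqi
    simp_rw [mul_assoc]
    exact (hb2.integrable_mul hn).const_mul 2
  have hlog {v : ℝ} (hv : 0 < v) : 0 ≤ (v / σ - 1 - Real.log (v / σ)) / 2 := by
    have := Real.log_le_sub_one_of_pos (div_pos hv hσ')
    linarith
  have hqnn (x : X) (y v : ℝ) (hv : 0 ≤ v) :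
      0 ≤ p * (y ^ 2 + v) + 2 * b x * y + q x := by
    have h1 := hnn (y • δ + r x)
    rw [dotProduct_mulVec_smul_add hH] at h1
    have h2 := mul_nonneg (hnn δ) hv
    simp only [hp, hb, hq]
    linarith
  have hnn2 : 0 ≤ (∫ x, (m₀ x - m' x) ^ 2 / σ ∂ρ) / 2 :=
    div_nonneg (integral_nonneg fun x => div_nonneg (sq_nonneg _) hσ'.le) (by norm_num)
  have hnn3 : 0 ≤ (∫ x, (p * (m₀ x ^ 2 + s₀) + 2 * b x * m₀ x + q x) ∂ρ) / 2 :=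
    div_nonneg (integral_nonneg fun x => hqnn x _ _ s₀.2) (by norm_num)
  rw [← ENNReal.ofReal_add (hlog hs₀') hnn2,
    ← ENNReal.ofReal_add (add_nonneg (hlog hs₀') hnn2) hnn3]
  -- For the competitor subadditivity of `ENNReal.ofReal` suffices; only the terms of the optimum
  -- must be nonnegative.
  refine le_trans (ENNReal.ofReal_le_ofReal ?_)
    (ENNReal.ofReal_add_le.trans (add_le_add ENNReal.ofReal_add_le le_rfl))
  -- As 1/σ + p = 1/s₀, this compares v/s₀ - log v at v = s with its minimum at v = s₀.
  have hvar : (s₀ : ℝ) / σ - Real.log (s₀ / σ) + p * s₀ ≤ s / σ - Real.log (s / σ) + p * s := by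
    have h1 : ∀ v : ℝ, v / σ + p * v = v / s₀ := fun v => by
      rw [hs₀]
      field_simp
    have h2 := Real.log_le_sub_one_of_pos (div_pos hs' hs₀')
    have h3 : Real.log ((s : ℝ) / s₀) = Real.log (s / σ) - Real.log (s₀ / σ) := by
      rw [Real.log_div hs'.ne' hs₀'.ne', Real.log_div hs'.ne' hσ'.ne',
        Real.log_div hs₀'.ne' hσ'.ne']
      ring
    have h4 := h1 s
    have h5 := h1 s₀
    rw [div_self hs₀'.ne'] at h5
    linarith
  -- The terms p s₀ and p s are removed since `hvar` already accounts for them; the rest differs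
  -- pointwise by (1/σ + p)(m - m₀)².
  have hmean : ∫ x, (m₀ x - m' x) ^ 2 / σ ∂ρ +
      ∫ x, (p * (m₀ x ^ 2 + s₀) + 2 * b x * m₀ x + q x) ∂ρ - p * s₀ ≤
      ∫ x, (m x - m' x) ^ 2 / σ ∂ρ +
        ∫ x, (p * (m x ^ 2 + s) + 2 * b x * m x + q x) ∂ρ - p * s := by
    have hc (v : ℝ) : p * v = ∫ _, p * v ∂ρ := by simp
    have hi3 {n : X → ℝ} (hn : MemLp n 2 ρ) (v : ℝ) : Integrable (fun x => (n x - m' x) ^ 2 / σ +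
        (p * (n x ^ 2 + v) + 2 * b x * n x + q x)) ρ := (hi1 hn).add (hi2 hn v)
    rw [hc s₀, hc s, ← integral_add (hi1 hm₀2) (hi2 hm₀2 _), ← integral_add (hi1 hm2) (hi2 hm2 _),
      ← integral_sub (hi3 hm₀2 _) (integrable_const _),
      ← integral_sub (hi3 hm2 _) (integrable_const _)]
    refine integral_mono ((hi3 hm₀2 _).sub (integrable_const _))
      ((hi3 hm2 _).sub (integrable_const _)) fun x => ?_
    have h1 : m' x = (1 + σ * p) * m₀ x + σ * b x := by
      rw [hm₀']
      field_simp
      ring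
    have h2 : 0 ≤ (1 / σ + p) * (m x - m₀ x) ^ 2 := by
      have := hnn δ
      positivity
    have h3 : ((m x - m' x) ^ 2 / σ + (p * (m x ^ 2 + s) + 2 * b x * m x + q x) - p * s) -
        ((m₀ x - m' x) ^ 2 / σ + (p * (m₀ x ^ 2 + s₀) + 2 * b x * m₀ x + q x) - p * s₀) =
        (1 / σ + p) * (m x - m₀ x) ^ 2 := by
      rw [h1]
      field_simp
      ring
    simp only
    linarith
  linarith

end OneStep

/-! ### The conditional laws of the outputs under the projection -/

section Output

variable {T : ℕ} {t : Fin T}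

/-- The conditional mean of `y_t`. -/
def OutputParams.mean (b : OutputParams t) (x : (UpTo t → ℝ) × (Before t → ℝ)) : ℝ :=
  b.Ku ⬝ᵥ x.1 + b.Ky ⬝ᵥ x.2 + b.m

/-- The conditional mean of `z_{t+1:T}`. -/
def FutureParams.mean (c : FutureParams t) (p : ((UpTo t → ℝ) × (Before t → ℝ)) × ℝ) :
    After t ⊕ After t → ℝ :=
  c.Ku *ᵥ p.1.1 + c.Ky *ᵥ p.1.2 + p.2 • c.Kyt + c.m

@[fun_prop] theorem OutputParams.measurable_mean (b : OutputParams t) : Measurable b.mean := by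
  unfold OutputParams.mean dotProduct
  fun_prop

@[fun_prop] theorem FutureParams.measurable_mean (c : FutureParams t) : Measurable c.mean := by
  unfold FutureParams.mean
  fun_prop

theorem memLp_dotProduct {ρ : Measure ((UpTo t → ℝ) × (Before t → ℝ))} [IsGaussian ρ]
    (k : UpTo t → ℝ) (l : Before t → ℝ) (a : ℝ) :
    MemLp (fun x => k ⬝ᵥ x.1 + l ⬝ᵥ x.2 + a) 2 ρ := by
  have h := (IsGaussian.memLp_dual ρ
    ((dotL k).comp (.fst ℝ _ _) + (dotL l).comp (.snd ℝ _ _)) 2 (by norm_num)).add (memLp_const a)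
  refine h.ae_eq (.of_forall fun x => ?_)
  simp [dotL_apply]

/-- The splitting of a path into `((u_{1:t}, y_{1:t-1}), y_t)` and `z_{t+1:T}`. -/
def splitPath (t : Fin T) (z : Path T) :
    (((UpTo t → ℝ) × (Before t → ℝ)) × ℝ) × (After t ⊕ After t → ℝ) :=
  ((regressor t z, z.2 t), future t z)

/-- The inverse of `splitPath`. -/
def joinPath (t : Fin T)
    (p : (((UpTo t → ℝ) × (Before t → ℝ)) × ℝ) × (After t ⊕ After t → ℝ)) : Path T :=
  (fun s => if h : s ≤ t then p.1.1.1 ⟨s, h⟩ else p.2 (.inl ⟨s, not_le.1 h⟩),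
    fun s => if h : s < t then p.1.1.2 ⟨s, h⟩
      else if h' : t < s then p.2 (.inr ⟨s, h'⟩) else p.1.2)

@[fun_prop] theorem measurable_splitPath (t : Fin T) : Measurable (splitPath t) := by
  unfold splitPath
  fun_prop

theorem measurable_joinPath (t : Fin T) : Measurable (joinPath t) := by
  refine Measurable.prodMk (measurable_pi_lambda _ fun s => ?_)
    (measurable_pi_lambda _ fun s => ?_)
  · by_cases h : s ≤ t
    · simp only [h, dite_true]
      fun_prop
    · simp only [h, dite_false]
      fun_prop
  · by_cases h : s < t
    · simp only [h, dite_true]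
      fun_prop
    · by_cases h' : t < s
      · simp only [h, h', dite_true, dite_false]
        fun_prop
      · simp only [h, h', dite_false]
        fun_prop

theorem joinPath_splitPath (t : Fin T) : Function.LeftInverse (joinPath t) (splitPath t) := by
  intro z
  refine Prod.ext (funext fun s => ?_) (funext fun s => ?_)
  · by_cases h : s ≤ t
    · simp only [joinPath, h, dite_true]
      rfl
    · simp only [joinPath, h, dite_false]
      rfl
  · by_cases h : s < t
    · simp only [joinPath, h, dite_true]
      rfl
    · by_cases h' : t < s
      · simp only [joinPath, h, h', dite_true, dite_false]
        rfl
      · simp only [joinPath, h, h', dite_false]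
        rw [le_antisymm (not_lt.1 h') (not_lt.1 h)]
        rfl

theorem isOutputLaw_iff (ρ : Measure (Path T)) [IsProbabilityMeasure ρ] (b : OutputParams t) :
    IsOutputLaw ρ t b ↔ 0 ≤ b.var ∧ ρ.map (fun z => (regressor t z, z.2 t)) =
      ((ρ.map (regressor t)).prod (gaussianReal 0 b.var.toNNReal)).map (shear b.mean) := by
  refine and_congr_right fun _ => ?_
  rw [map_prodMk_eq_shear_iff (by fun_prop) (by fun_prop) (by fun_prop)]
  exact condDistrib_ae_eq_gaussianReal_iff (h := b.mean) (by fun_prop) (by fun_prop) (by fun_prop) _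

theorem map_splitPath_eq {ρ : Measure (Path T)} [IsProbabilityMeasure ρ] {c : FutureParams t}
    (hc : IsFutureLaw ρ t c) : ρ.map (splitPath t) =
      ((ρ.map fun z => (regressor t z, z.2 t)).prod (gaussianVec 0 c.cov)).map (shear c.mean) := by
  have h := (condDistrib_ae_eq_gaussianVec_iff
    (h := fun x : (UpTo t → ℝ) × (Before t → ℝ) × ℝ =>
      c.Ku *ᵥ x.1 + c.Ky *ᵥ x.2.1 + x.2.2 • c.Kyt + c.m)
    (measurable_fullRegressor t) (by fun_prop) (by fun_prop) _).1 hc.2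
  change ρ.map (fun z => ((regressor t z, z.2 t), future t z)) = _
  rw [map_prodMk_eq_shear_iff (by fun_prop) (by fun_prop) (by fun_prop)]
  exact ⟨h.1.comp (φ := fun x : (UpTo t → ℝ) × (Before t → ℝ) × ℝ => ((x.1, x.2.1), x.2.2))
    (by fun_prop) measurable_id, h.2⟩

theorem map_splitPath_eq_twoStepLaw {ρ : Measure (Path T)} [IsProbabilityMeasure ρ]
    {b : OutputParams t} {c : FutureParams t} (hb : IsOutputLaw ρ t b) (hc : IsFutureLaw ρ t c) :
    ρ.map (splitPath t) =
      twoStepLaw (ρ.map (regressor t)) b.mean b.var.toNNReal c.mean c.cov := by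
  rw [map_splitPath_eq hc, ((isOutputLaw_iff ρ b).1 hb).2]
  rfl

theorem withDensity_map_shear {X E : Type*} [MeasurableSpace X] [NormedAddCommGroup E]
    [MeasurableSpace E] [BorelSpace E] [SecondCountableTopology E] (P : Measure X) [SFinite P]
    (ν : Measure E) [SFinite ν] {h : X → E} (hh : Measurable h) {H : X → ℝ≥0∞}
    (hH : Measurable H) [SFinite (P.withDensity H)] :
    ((P.prod ν).map (shear h)).withDensity (H ∘ Prod.fst) =
      ((P.withDensity H).prod ν).map (shear h) := by
  rw [← map_withDensity_comp _ (measurable_shear hh) (hH.comp measurable_fst),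
    prod_withDensity_left hH]
  rfl

/-- Replacing the conditional law of `Y_t` by another one that is absolutely continuous. -/
theorem exists_causalCoupling_of_absolutelyContinuous {μ : Measure (Fin T → ℝ)} [IsGaussian μ]
    {π : ProbabilityMeasure (Path T)} (hπ : π ∈ causalCouplings μ) {b b' : OutputParams t}
    {c : FutureParams t} (hb : IsOutputLaw (π : Measure (Path T)) t b)
    (hc : IsFutureLaw (π : Measure (Path T)) t c) (hvar : 0 < b.var) (hvar' : 0 < b'.var) :
    ∃ π' ∈ causalCouplings μ,
      (π' : Measure (Path T)).map (regressor t) = (π : Measure (Path T)).map (regressor t) ∧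
      (π' : Measure (Path T)).map (splitPath t) =
        twoStepLaw ((π : Measure (Path T)).map (regressor t)) b'.mean b'.var.toNNReal c.mean c.cov ∧
      (((π : Measure (Path T)).map (regressor t)).prod (gaussianReal 0 b'.var.toNNReal)).map
        (shear b'.mean) ≪
      (((π : Measure (Path T)).map (regressor t)).prod (gaussianReal 0 b.var.toNNReal)).map
        (shear b.mean) := by
  have hprob : IsProbabilityMeasure ((π : Measure (Path T)).map (regressor t)) :=
    Measure.isProbabilityMeasure_map (by fun_prop)
  set ρ := (π : Measure (Path T)).map (regressor t) with hρ
  have hJ := ((isOutputLaw_iff _ b).1 hb).2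
  set J := (ρ.prod (gaussianReal 0 b.var.toNNReal)).map (shear b.mean) with hJdef
  set J' := (ρ.prod (gaussianReal 0 b'.var.toNNReal)).map (shear b'.mean) with hJ'def
  have hJp : IsProbabilityMeasure J := isProbabilityMeasure_map_shear _ _ (by fun_prop)
  have hJp' : IsProbabilityMeasure J' := isProbabilityMeasure_map_shear _ _ (by fun_prop)
  -- All nondegenerate normal laws on the line are equivalent to Lebesgue measure.
  have hac : J' ≪ J := by
    rw [hJdef, hJ'def, ← compProd_shiftKernel _ b.measurable_mean,
      ← compProd_shiftKernel _ b'.measurable_mean]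
    refine Measure.AbsolutelyContinuous.compProd_right (.of_forall fun x => ?_)
    rw [shiftKernel_apply, shiftKernel_apply, gaussianReal_map_const_add,
      gaussianReal_map_const_add]
    exact (gaussianReal_absolutelyContinuous _ (Real.toNNReal_pos.2 hvar').ne').trans
      (gaussianReal_absolutelyContinuous' _ (Real.toNNReal_pos.2 hvar).ne')
  -- Reweighting `π` by a density in (u_{1:t}, y_{1:t-1}, y_t) leaves the kernel of the future
  -- unchanged.
  let H := J'.rnDeriv J
  have hH : Measurable H := Measure.measurable_rnDeriv _ _
  have hHJ : J.withDensity H = J' := Measure.withDensity_rnDeriv_eq _ _ hac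
  let φ (z : Path T) : ((UpTo t → ℝ) × (Before t → ℝ)) × ℝ := (regressor t z, z.2 t)
  have hφ : Measurable φ := by fun_prop
  have hmapφ : ((π : Measure (Path T)).withDensity (H ∘ φ)).map φ = J' := by
    rw [map_withDensity_comp _ hφ hH, ← hHJ, ← hJ]
  have hprob' : IsProbabilityMeasure ((π : Measure (Path T)).withDensity (H ∘ φ)) := by
    constructor
    have h1 := hJp'.measure_univ
    rwa [← hmapφ, Measure.map_apply hφ MeasurableSet.univ, Set.preimage_univ] at h1
  let π' : ProbabilityMeasure (Path T) := ⟨_, hprob'⟩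
  have hreg : (π' : Measure (Path T)).map (regressor t) = ρ := by
    have h1 := congrArg (Measure.map Prod.fst) hmapφ
    rw [Measure.map_map measurable_fst hφ, hJ'def,
      Measure.map_map measurable_fst (measurable_shear (by fun_prop))] at h1
    have h2 : ((Prod.fst : ((UpTo t → ℝ) × (Before t → ℝ)) × ℝ → _) ∘ shear b'.mean) = Prod.fst :=
      rfl
    rw [h2, Measure.map_fst_prod, measure_univ, one_smul] at h1
    exact h1
  refine ⟨π', mem_causalCouplings_of_withDensity hπ t hH rfl hreg, hreg, ?_, hac⟩
  have h1 := map_withDensity_comp (π : Measure (Path T)) (measurable_splitPath t)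
    (hH.comp measurable_fst)
  have hJH : SFinite (J.withDensity H) := by rw [hHJ]; infer_instance
  rw [map_splitPath_eq hc, hJ, withDensity_map_shear _ _ (by fun_prop) hH, hHJ] at h1
  exact h1

end Output

/-! ### Consequences of absolute continuity and of nondegenerate y_t -/

section Degenerate

/-- Otherwise a Dirac mass would be absolutely continuous with respect to a normal law without
atoms. -/
theorem var_ne_zero_of_absolutelyContinuous {X : Type*} [MeasurableSpace X] {ρ ρ' : Measure X}
    [IsProbabilityMeasure ρ] [IsProbabilityMeasure ρ'] {s σ : ℝ≥0} {m m' : X → ℝ}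
    (hm : Measurable m) (hm' : Measurable m') (hσ : σ ≠ 0)
    (hac : (ρ.prod (gaussianReal 0 s)).map (shear m) ≪
      (ρ'.prod (gaussianReal 0 σ)).map (shear m')) : s ≠ 0 := by
  rintro rfl
  rw [← compProd_shiftKernel _ hm, ← compProd_shiftKernel _ hm',
    Measure.absolutelyContinuous_compProd_iff'] at hac
  obtain ⟨x, hx⟩ := hac.2.exists
  rw [shiftKernel_apply, shiftKernel_apply, gaussianReal_map_const_add,
    gaussianReal_map_const_add, gaussianReal_zero_var] at hx
  have hna := nullSingletonClass_gaussianReal (μ := 0 + m' x) hσ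
  have h1 := hx (measure_singleton (0 + m x))
  simp at h1

/-- For some fixed first coordinate the affine equation in y holds at two distinct points, since the
normal law has no atoms. -/
theorem eq_zero_of_ae_smul_add_eq_zero {X V : Type*} [MeasurableSpace X] [AddCommGroup V]
    [Module ℝ V] {ρ : Measure X} [IsProbabilityMeasure ρ] {s : ℝ≥0} (hs : s ≠ 0) {m : X → ℝ}
    (hm : Measurable m) {a : V} {r : X → V}
    (h : ∀ᵐ p ∂((ρ.prod (gaussianReal 0 s)).map (shear m)), p.2 • a + r p.1 = 0) : a = 0 := by
  obtain ⟨x, hx⟩ := (Measure.ae_ae_of_ae_prod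
    (ae_of_ae_map (measurable_shear hm).aemeasurable h)).exists
  have hna := nullSingletonClass_gaussianReal (μ := 0) hs
  obtain ⟨z, hz⟩ := hx.exists
  have hne : ∀ᵐ w ∂(gaussianReal 0 s), w ≠ z := by
    rw [ae_iff]
    simp
  obtain ⟨w, hw, hwz⟩ := (hx.and hne).exists
  simp only [shear] at hz hw
  have h1 : (w - z) • a = 0 := by
    have : (w - z) • a = ((m x + w) • a + r x) - ((m x + z) • a + r x) := by module
    rw [this, hw, hz, sub_zero]
  exact (smul_eq_zero.1 h1).resolve_left (sub_ne_zero.2 hwz)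

end Degenerate

/-! ### Removing the symmetrization of a generalized inverse -/

section GeneralizedInverse

variable {ι : Type*} [Fintype ι] {S G : Matrix ι ι ℝ} {δ : ι → ℝ}

/-- Move S onto Gδ and use S G δ = δ. Thus the symmetrized form in the divergence agrees with the
possibly non-symmetric `G` of the formulas. -/
theorem dotProduct_transpose_mul_mul_mulVec (hS : Sᵀ = S) (hδ : S *ᵥ (G *ᵥ δ) = δ) (v : ι → ℝ) :
    δ ⬝ᵥ ((Gᵀ * S * G) *ᵥ v) = δ ⬝ᵥ (G *ᵥ v) := by
  rw [← mulVec_mulVec, ← mulVec_mulVec, mulVec_transpose, dotProduct_comm, ← dotProduct_mulVec]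
  conv_rhs => rw [← hδ, dotProduct_comm]
  rw [dotProduct_mulVec, ← mulVec_transpose, dotProduct_mulVec, ← mulVec_transpose, hS,
    mulVec_transpose, ← dotProduct_mulVec]

end GeneralizedInverse

/-! ### The formulas for the output kernels -/

section Projection

variable {T : ℕ} {μ : Measure (Fin T → ℝ)} [IsGaussian μ] {γ : Measure (Path T)} [IsGaussian γ]
  {t : Fin T}

theorem OutputParams.mean_oddOutputParams (b : OutputParams t) (c c' : FutureParams t)
    (G : Matrix (After t ⊕ After t) (After t ⊕ After t) ℝ)
    (x : (UpTo t → ℝ) × (Before t → ℝ)) :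
    (oddOutputParams b c c' G).mean x = alpha b c c' G * b.mean x -
      (1 - alpha b c c' G) * (1 / psiPrecision c c' G) * ((c'.Kyt - c.Kyt) ⬝ᵥ (G *ᵥ
        ((c'.Ku - c.Ku) *ᵥ x.1 + (c'.Ky - c.Ky) *ᵥ x.2 + (c'.m - c.m)))) := by
  simp only [OutputParams.mean, oddOutputParams, psiParams, add_dotProduct, smul_dotProduct,
    smul_eq_mul, dotProduct_mulVec, dotProduct_add, neg_mul]
  ring

/-- Both branches of `alpha` give 1. Under γ the output equals its conditional mean almost surely,
and absolute continuity carries this over to π. -/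
theorem isOutputLaw_oddOutputParams_of_var_eq_zero {π : Measure (Path T)} [IsProbabilityMeasure π]
    (hac : π ≪ γ) {b : OutputParams t} (hb : IsOutputLaw γ t b) (hvar : b.var = 0)
    (c c' : FutureParams t) (G : Matrix (After t ⊕ After t) (After t ⊕ After t) ℝ) :
    IsOutputLaw π t (oddOutputParams b c c' G) := by
  have hα : alpha b c c' G = 1 := by
    unfold alpha
    split_ifs with h
    · rfl
    · simp [psiParams, hvar, h]
  have hv : (oddOutputParams b c c' G).var = 0 := by simp [oddOutputParams, hvar]
  have hmean : (oddOutputParams b c c' G).mean = b.mean := by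
    ext x
    rw [OutputParams.mean_oddOutputParams, hα]
    simp
  rw [isOutputLaw_iff, hv, hmean]
  refine ⟨le_rfl, ?_⟩
  have h1 := ((isOutputLaw_iff γ b).1 hb).2
  rw [map_prodMk_eq_shear_iff (by fun_prop) (by fun_prop) (by fun_prop)] at h1 ⊢
  have hm : Measurable fun z : Path T => z.2 t - b.mean (regressor t z) := by fun_prop
  have h2 : ∀ᵐ z ∂γ, z.2 t - b.mean (regressor t z) = 0 := by
    have h3 := h1.2
    rw [hvar, Real.toNNReal_zero, gaussianReal_zero_var] at h3
    have h4 : ∀ᵐ w ∂(γ.map fun z => z.2 t - b.mean (regressor t z)), w = 0 := by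
      rw [h3, ae_dirac_eq]
      rfl
    exact ae_of_ae_map hm.aemeasurable h4
  have h5 : (fun z : Path T => z.2 t - b.mean (regressor t z)) =ᵐ[π] fun _ => 0 := hac.ae_le h2
  refine ⟨(indepFun_const_right _ _).congr (.of_forall fun _ => rfl) h5.symm, ?_⟩
  rw [Measure.map_congr h5, Measure.map_const, measure_univ, one_smul, Real.toNNReal_zero,
    gaussianReal_zero_var]

/-- The competitor keeps every kernel of `π` except that of Y_t, in particular the future parameters
`c'` that enter the formulas. It is at least as good as `π`, so it is `π`. -/
theorem isOutputLaw_oddOutputParams {π : ProbabilityMeasure (Path T)}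
    (hπ : π ∈ causalCouplings μ) (hfin : klDiv (π : Measure (Path T)) γ < ⊤)
    (huniq : ∀ π' ∈ causalCouplings μ,
      klDiv (π' : Measure (Path T)) γ ≤ klDiv (π : Measure (Path T)) γ → π' = π)
    [IsGaussian (π : Measure (Path T))] {b : OutputParams t} {c c' : FutureParams t}
    {G : Matrix (After t ⊕ After t) (After t ⊕ After t) ℝ} (hb : IsOutputLaw γ t b)
    (hc : IsFutureLaw γ t c) (hc' : IsFutureLaw (π : Measure (Path T)) t c')
    (hG : c.cov * G * c.cov = c.cov) :
    IsOutputLaw (π : Measure (Path T)) t (oddOutputParams b c c' G) := by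
  have hac : (π : Measure (Path T)) ≪ γ := (klDiv_ne_top_iff.1 hfin.ne).1
  rcases hb.1.eq_or_lt with hvar | hvar
  · exact isOutputLaw_oddOutputParams_of_var_eq_zero hac hb hvar.symm c c' G
  obtain ⟨e, he⟩ := exists_isOutputLaw (π : Measure (Path T)) t
  have hp1 : IsProbabilityMeasure ((π : Measure (Path T)).map (regressor t)) :=
    Measure.isProbabilityMeasure_map (by fun_prop)
  have hp2 : IsProbabilityMeasure (γ.map (regressor t)) :=
    Measure.isProbabilityMeasure_map (by fun_prop)
  have hgauss : IsGaussian ((π : Measure (Path T)).map (regressor t)) :=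
    isGaussian_map (regressorL t)
  set ρ := (π : Measure (Path T)).map (regressor t) with hρ
  have hJ := ((isOutputLaw_iff _ e).1 he).2
  have hJγ := ((isOutputLaw_iff _ b).1 hb).2
  have hσ : b.var.toNNReal ≠ 0 := (Real.toNNReal_pos.2 hvar).ne'
  have hs : e.var.toNNReal ≠ 0 := by
    refine var_ne_zero_of_absolutelyContinuous (ρ := ρ) (ρ' := γ.map (regressor t))
      e.measurable_mean b.measurable_mean hσ ?_
    rw [← hJ, ← hJγ]
    exact hac.map (by fun_prop)
  have hevar : 0 < e.var := Real.toNNReal_pos.1 (pos_iff_ne_zero.2 hs)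
  set δ := c'.Kyt - c.Kyt with hδ
  set r : (UpTo t → ℝ) × (Before t → ℝ) → After t ⊕ After t → ℝ := fun x =>
    (c'.Ku - c.Ku) *ᵥ x.1 + (c'.Ky - c.Ky) *ᵥ x.2 + (c'.m - c.m) with hr
  have hd (p : ((UpTo t → ℝ) × (Before t → ℝ)) × ℝ) :
      c'.mean p - c.mean p = p.2 • δ + r p.1 := by
    simp only [FutureParams.mean, hδ, hr, sub_mulVec, smul_sub]
    abel
  -- The future kernel of π is absolutely continuous with respect to that of γ, so the mean
  -- difference is in the range of `c.cov`, on which `c.cov * G` is the identity by `hG`.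
  have hrange : ∀ᵐ p ∂((ρ.prod (gaussianReal 0 e.var.toNNReal)).map (shear e.mean)),
      c.cov *ᵥ (G *ᵥ (c'.mean p - c.mean p)) = c'.mean p - c.mean p := by
    have h1 : (π : Measure (Path T)).map (splitPath t) ≪ γ.map (splitPath t) :=
      hac.map (by fun_prop)
    have := isProbabilityMeasure_map_shear ρ (gaussianReal 0 e.var.toNNReal) e.measurable_mean
    have := isProbabilityMeasure_map_shear (γ.map (regressor t)) (gaussianReal 0 b.var.toNNReal)
      b.measurable_mean
    rw [map_splitPath_eq hc, map_splitPath_eq hc', hJ, hJγ,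
      ← compProd_shiftKernel _ c.measurable_mean, ← compProd_shiftKernel _ c'.measurable_mean,
      Measure.absolutelyContinuous_compProd_iff'] at h1
    filter_upwards [h1.2] with p hp
    rw [shiftKernel_apply, shiftKernel_apply] at hp
    have h2 := hp.map (f := fun x => -c.mean p + x) (by fun_prop)
    rw [Measure.map_map (by fun_prop) (by fun_prop), Measure.map_map (by fun_prop) (by fun_prop)]
      at h2
    have h3 : ((fun x => -c.mean p + x) ∘ fun x => c'.mean p + x) =
        fun x => (c'.mean p - c.mean p) + x := by
      ext1 x
      simp only [Function.comp_apply]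
      abel
    have h4 : ((fun x => -c.mean p + x) ∘ fun x => c.mean p + x) = id := by
      ext1 x
      simp
    rw [h3, h4, Measure.map_id, ← gaussianVec_eq_map] at h2
    obtain ⟨w, hw⟩ := exists_eq_mulVec_of_absolutelyContinuous hc.1 h2
    rw [hw, mulVec_mulVec, mulVec_mulVec, hG]
  -- As y_t has positive conditional variance, the range condition on y_t δ + r holds for the
  -- coefficient δ alone.
  have hδrange : c.cov *ᵥ (G *ᵥ δ) = δ := by
    refine sub_eq_zero.1 (eq_zero_of_ae_smul_add_eq_zero (ρ := ρ) hs e.measurable_mean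
      (r := fun x => c.cov *ᵥ (G *ᵥ r x) - r x) ?_)
    filter_upwards [hrange] with p hp
    rw [hd, mulVec_add, mulVec_add, mulVec_smul, mulVec_smul, ← sub_eq_zero] at hp
    rw [smul_sub, ← hp]
    abel
  have hsymm : c.covᵀ = c.cov := by
    have := hc.1.isHermitian
    rwa [Matrix.IsHermitian, conjTranspose_eq_transpose_of_trivial] at this
  have hform (v : After t ⊕ After t → ℝ) :
      δ ⬝ᵥ ((Gᵀ * c.cov * G) *ᵥ v) = δ ⬝ᵥ (G *ᵥ v) :=
    dotProduct_transpose_mul_mul_mulVec hsymm hδrange v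
  have hHpos : (Gᵀ * c.cov * G).PosSemidef := by
    have := hc.1.conjTranspose_mul_mul_same G
    rwa [conjTranspose_eq_transpose_of_trivial] at this
  have hprec : psiPrecision c c' G = δ ⬝ᵥ (G *ᵥ δ) := rfl
  have hnn : 0 ≤ δ ⬝ᵥ (G *ᵥ δ) := by
    rw [← hform]
    simpa using hHpos.dotProduct_mulVec_nonneg δ
  have hden : 0 < 1 + b.var * (δ ⬝ᵥ (G *ᵥ δ)) := by positivity
  -- This form covers infinite Σ^ψ as well, where the precision is zero and the weight is 1.
  have hα : alpha b c c' G = 1 / (1 + b.var * (δ ⬝ᵥ (G *ᵥ δ))) := by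
    unfold alpha
    split_ifs with h
    · rw [← hprec, h]
      simp
    · have h0 : 0 < δ ⬝ᵥ (G *ᵥ δ) := lt_of_le_of_ne hnn (Ne.symm h)
      simp only [psiParams, hprec]
      field_simp
      ring
  set o := oddOutputParams b c c' G with ho
  have hovar : o.var = b.var / (1 + b.var * (δ ⬝ᵥ (G *ᵥ δ))) := by
    simp only [ho, oddOutputParams, hα]
    ring
  have hopos : 0 < o.var := by rw [hovar]; positivity
  have homean (x : (UpTo t → ℝ) × (Before t → ℝ)) :
      o.mean x = (b.mean x - b.var * (δ ⬝ᵥ (G *ᵥ r x))) / (1 + b.var * (δ ⬝ᵥ (G *ᵥ δ))) := by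
    rw [ho, OutputParams.mean_oddOutputParams, hα, hprec]
    by_cases h : δ ⬝ᵥ (G *ᵥ δ) = 0
    -- If the precision vanishes, positive semidefiniteness makes δ a null vector of the form, so
    -- the term linear in y_t vanishes too.
    · have h1 : (Gᵀ * c.cov * G) *ᵥ δ = 0 :=
        (hHpos.dotProduct_mulVec_zero_iff δ).1 (by rw [star_trivial, hform, h])
      have hHt : (Gᵀ * c.cov * G)ᵀ = Gᵀ * c.cov * G := by
        have := hHpos.isHermitian
        rwa [Matrix.IsHermitian, conjTranspose_eq_transpose_of_trivial] at this
      have h2 : δ ⬝ᵥ (G *ᵥ r x) = 0 := by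
        rw [← hform, dotProduct_mulVec, ← mulVec_transpose, hHt, h1, zero_dotProduct]
      rw [h, h2]
      simp
    · have h3 : (c'.Ku - c.Ku) *ᵥ x.1 + (c'.Ky - c.Ky) *ᵥ x.2 + (c'.m - c.m) = r x := rfl
      rw [h3]
      field_simp
      ring
  obtain ⟨π', hπ', hreg, hsplit, hac'⟩ :=
    exists_causalCoupling_of_absolutelyContinuous (b' := o) hπ he hc' hevar hopos
  have hkl (Q : ProbabilityMeasure (Path T)) : klDiv (Q : Measure (Path T)) γ =
      klDiv ((Q : Measure (Path T)).map (splitPath t)) (γ.map (splitPath t)) :=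
    (klDiv_map_eq_of_leftInverse (measurable_splitPath t) (measurable_joinPath t)
      (joinPath_splitPath t) _ _).symm
  have hmem (d : OutputParams t) : MemLp d.mean 2 ρ := memLp_dotProduct d.Ku d.Ky d.m
  have hle : klDiv (π' : Measure (Path T)) γ ≤ klDiv (π : Measure (Path T)) γ := by
    rw [hkl, hkl, hsplit, map_splitPath_eq_twoStepLaw he hc', map_splitPath_eq_twoStepLaw hb hc]
    refine klDiv_twoStepLaw_le (G := G) (δ := δ) (r := r) hs hσ hc.1 (by fun_prop) (by fun_prop)
      (by fun_prop) (by fun_prop) (by fun_prop) (by fun_prop) (hmem e) (hmem b) (hmem o)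
      (fun i => memLp_dotProduct ((c'.Ku - c.Ku) i) ((c'.Ky - c.Ky) i) ((c'.m - c.m) i)) hd hrange
      (hac'.ae_le hrange) ?_ fun x => ?_
    · rw [hform, Real.coe_toNNReal _ hopos.le, Real.coe_toNNReal _ hvar.le, hovar]
    · rw [hform, hform, Real.coe_toNNReal _ hvar.le, homean]
  have heq := huniq π' hπ' hle
  rw [isOutputLaw_iff]
  refine ⟨hopos.le, ?_⟩
  have h1 := congrArg (Measure.map Prod.fst) hsplit
  have := isProbabilityMeasure_map_shear ρ (gaussianReal 0 o.var.toNNReal) o.measurable_mean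
  rw [heq, twoStepLaw, Measure.map_map measurable_fst (by fun_prop),
    Measure.map_map measurable_fst (measurable_shear (by fun_prop))] at h1
  have h2 : (Prod.fst ∘ shear c'.mean : (((UpTo t → ℝ) × (Before t → ℝ)) × ℝ) ×
      (After t ⊕ After t → ℝ) → _) = Prod.fst := rfl
  rw [h2, Measure.map_fst_prod, measure_univ, one_smul] at h1
  exact h1

end Projection

end CausalSB

end

open CausalSB in
theorem theorem1 (T : ℕ)
    (μ : MeasureTheory.Measure (Fin T → ℝ)) [ProbabilityTheory.IsGaussian μ]
    (hμ : (covMatrix μ).PosDef)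
    (γ : MeasureTheory.Measure (Path T)) [ProbabilityTheory.IsGaussian γ]
    (hγ : (⨅ π' ∈ causalCouplings μ,
      InformationTheory.klDiv (π' : MeasureTheory.Measure (Path T)) γ) < ⊤) :
    ∃ π : MeasureTheory.ProbabilityMeasure (Path T),
      -- `π` is the unique minimizer, and it is Gaussian
      IsCausalProjection μ γ π ∧
      (∀ π', IsCausalProjection μ γ π' → π' = π) ∧
      ProbabilityTheory.IsGaussian (π : MeasureTheory.Measure (Path T)) ∧
      -- the conditional law of `U_t` is that of `μ`
      (∀ t : Fin T,
        (∃ a, IsMarginalLaw μ t a) ∧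
        ∀ a, IsMarginalLaw μ t a → IsInputLaw π t ⟨a.K, 0, a.m, a.var⟩) ∧
      -- the conditional law of `Y_t`; `G` is the inverse of `c.cov` (if that is invertible)
      (∀ t : Fin T,
        (∃ b, IsOutputLaw γ t b) ∧ (∃ c, IsFutureLaw γ t c) ∧ (∃ c', IsFutureLaw π t c') ∧
        ∀ b c c' G, IsOutputLaw γ t b → IsFutureLaw γ t c → IsFutureLaw π t c' →
          c.cov * G * c.cov = c.cov →
          IsOutputLaw π t (oddOutputParams b c c' G)) := by
  obtain ⟨π, hπ, hfin, hle, huniq, hgauss⟩ := exists_unique_causalProjection (μ := μ) γ hγ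
  exact ⟨π, ⟨hπ, hle⟩, fun π' h => huniq π' h.1 (h.2 π hπ), hgauss,
    fun t => ⟨exists_isMarginalLaw μ t, fun a ha => isInputLaw_of_isMarginalLaw hπ ha⟩,
    fun t => ⟨exists_isOutputLaw γ t, exists_isFutureLaw γ t, exists_isFutureLaw _ t,
      fun b c c' G hb hc hc' hG => isOutputLaw_oddOutputParams hπ hfin huniq hb hc hc' hG⟩⟩
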